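/- Let $n,m\in\mathbb N$, let $0<p,q\le\infty$, and let $\mathbb D^n$, $\mathbb D^m$ be the open unit polydiscs in $\mathbb C^n$, $\mathbb C^m$. For $0<p<\infty$, $H^p(\mathbb D^n)$ is the space of analytic functions $f$ on $\mathbb D^n$ with $\|f\|_p=\sup_{0\le r<1}\bigl(\int_{\mathbb T^n}|f(r\zeta)|^p\,dm(\zeta)\bigr)^{1/p}<\infty$, where $m$ is the normalised Lebesgue measure on the torus $\mathbb T^n$, and $H^\infty(\mathbb D^n)$ is the space of bounded analytic functions on $\mathbb D^n$ with the supremum norm. For $p<\infty$ give $H^p(\mathbb D^n)$ the topology of its norm (for $p<1$, of the metric $\|f-g\|_p^p$); give $H^\infty(\mathbb D^n)$ the weak-star topology that it carries as a weak-star closed subspace of $L^\infty(\mathbb T^n)=L^1(\mathbb T^n)^*$. On $H^q(\mathbb D^m)$ take the topology of its norm (or metric); when $q=\infty$, either the norm topology or the weak-star topology may be taken. **Theorem.** Let $T:H^p(\mathbb D^n)\to H^q(\mathbb D^m)$ be a continuous function (not assumed linear) such that $T(0)=0$ and $(T1)(w)\neq0$ for every $w\in\mathbb D^m$. Suppose that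 for all complex polynomials $P,Q$ in $n$ variables and every $w\in\mathbb D^m$, the polynomial $$\bigl((TP)(w)-(TQ)(w)\bigr)\cdot 1-(T1)(w)\,(P-Q)$$ has a zero in $\mathbb D^n$. Then there exist $\psi\in H^q(\mathbb D^m)$ and an analytic map $\varphi:\mathbb D^m\to\mathbb D^n$ such that $$Tf=\psi\cdot(f\circ\varphi)\qquad\text{for every } f\in H^p(\mathbb D^n).$$ -/

import Mathlib

open scoped ENNReal Topology
open MeasureTheory Set Filter

noncomputable section

/-- The open unit polydisc `𝔻ⁿ` in `ℂⁿ`. -/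
def polydisc (n : ℕ) : Set (Fin n → ℂ) := {z | ∀ i, ‖z i‖ < 1}

/-- The point `r ζ` of `ℂⁿ`, where `ζ = (exp (2 π i θ₁), …, exp (2 π i θₙ))` runs through the
torus `𝕋ⁿ`. The torus is parametrised by `θ ∈ (ℝ/ℤ)ⁿ`, whose volume is the normalised Haar
(Lebesgue) measure. -/
def torusPoint (n : ℕ) (r : ℝ) (θ : UnitAddTorus (Fin n)) : Fin n → ℂ :=
  fun i => (r : ℂ) * (AddCircle.toCircle (θ i) : ℂ)

/-- The Hardy (quasi-)norm of a function on `𝔻ⁿ`, with values in `[0, ∞]`: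
`sup_{0 ≤ r < 1} (∫_{𝕋ⁿ} |f(rζ)|^p dm(ζ))^{1/p}` for `p < ∞`, and `sup_{z ∈ 𝔻ⁿ} |f(z)|` for
`p = ∞`. -/
def hardyNorm (n : ℕ) (p : ℝ≥0∞) (f : (Fin n → ℂ) → ℂ) : ℝ≥0∞ :=
  if p = ∞ then ⨆ z ∈ polydisc n, ‖f z‖ₑ
  else ⨆ r ∈ Ico (0 : ℝ) 1,
    eLpNorm (fun θ : UnitAddTorus (Fin n) => f (torusPoint n r θ)) p volume

/-- The Hardy space `H^p(𝔻ⁿ)`: analytic functions on `𝔻ⁿ` of finite Hardy norm. A function on `𝔻ⁿ`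
is represented by its extension by `0` to `ℂⁿ`, so that two elements are equal exactly when they
agree on `𝔻ⁿ`. -/
@[ext] structure HardySpace (n : ℕ) (p : ℝ≥0∞) where
  toFun : (Fin n → ℂ) → ℂ
  analytic' : AnalyticOnNhd ℂ toFun (polydisc n)
  eq_zero' : ∀ z, z ∉ polydisc n → toFun z = 0
  norm_lt_top' : hardyNorm n p toFun < ∞

instance (n : ℕ) (p : ℝ≥0∞) : CoeFun (HardySpace n p) (fun _ => (Fin n → ℂ) → ℂ) :=
  ⟨HardySpace.toFun⟩

theorem isOpen_polydisc (n : ℕ) : IsOpen (polydisc n) := by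
  have h : polydisc n = ⋂ i, {z : Fin n → ℂ | ‖z i‖ < 1} := by
    ext z
    simp [polydisc]
  rw [h]
  exact isOpen_iInter_of_finite fun i =>
    isOpen_lt (continuous_norm.comp (continuous_apply i)) continuous_const

theorem torusPoint_mem (n : ℕ) {r : ℝ} (hr : r ∈ Ico (0 : ℝ) 1) (θ : UnitAddTorus (Fin n)) :
    torusPoint n r θ ∈ polydisc n := by
  intro i
  have h : ‖torusPoint n r θ i‖ = r := by
    rw [torusPoint, norm_mul, Circle.norm_coe, mul_one, Complex.norm_real,
      Real.norm_of_nonneg hr.1]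
  exact h.trans_lt hr.2

/-- A function that is bounded on `𝔻ⁿ` has finite Hardy norm. -/
theorem hardyNorm_lt_top_of_bound (n : ℕ) (p : ℝ≥0∞) (f : (Fin n → ℂ) → ℂ) (C : ℝ)
    (hC : ∀ z ∈ polydisc n, ‖f z‖ ≤ C) : hardyNorm n p f < ∞ := by
  unfold hardyNorm
  split_ifs with hp
  · refine lt_of_le_of_lt (iSup₂_le fun z hz => ?_) (ENNReal.ofReal_lt_top (r := C))
    rw [← ofReal_norm]
    exact ENNReal.ofReal_le_ofReal (hC z hz)
  · refine lt_of_le_of_lt (iSup₂_le fun r hr => ?_) (ENNReal.ofReal_lt_top (r := C))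
    refine (eLpNorm_le_of_ae_bound (C := C)
      (Filter.Eventually.of_forall fun θ => hC _ (torusPoint_mem n hr θ))).trans ?_
    have h : (volume : Measure (UnitAddTorus (Fin n))) univ = 1 := by
      rw [volume_pi, Measure.pi_univ]
      simp
    rw [h, ENNReal.one_rpow, one_mul]

theorem exists_bound_polynomial (n : ℕ) (P : MvPolynomial (Fin n) ℂ) :
    ∃ C : ℝ, ∀ z ∈ polydisc n, ‖MvPolynomial.eval z P‖ ≤ C := by
  have hK : IsCompact (Set.pi univ fun _ : Fin n => Metric.closedBall (0 : ℂ) 1) :=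
    isCompact_univ_pi fun _ => isCompact_closedBall 0 1
  obtain ⟨C, hC⟩ := hK.exists_bound_of_continuousOn
    (MvPolynomial.continuous_eval P).continuousOn
  exact ⟨C, fun z hz => hC z fun i _ => by simpa using (hz i).le⟩

/-- A complex polynomial in `n` variables, restricted to `𝔻ⁿ`, as an element of `H^p(𝔻ⁿ)`. -/
def HardySpace.ofPolynomial {n : ℕ} (p : ℝ≥0∞) (P : MvPolynomial (Fin n) ℂ) : HardySpace n p where
  toFun := (polydisc n).indicator fun z => MvPolynomial.eval z P
  analytic' := by
    have h : AnalyticOnNhd ℂ (fun z : Fin n → ℂ => MvPolynomial.eval z P) (polydisc n) :=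
      (AnalyticOnNhd.eval_mvPolynomial P).mono (subset_univ _)
    exact h.congr (isOpen_polydisc n) fun z hz =>
      (indicator_of_mem hz fun z => MvPolynomial.eval z P).symm
  eq_zero' := fun z hz => indicator_of_notMem hz _
  norm_lt_top' := by
    obtain ⟨C, hC⟩ := exists_bound_polynomial n P
    refine hardyNorm_lt_top_of_bound n p _ C fun z hz => ?_
    rw [indicator_of_mem hz]
    exact hC z hz

instance (n : ℕ) (p : ℝ≥0∞) : Zero (HardySpace n p) := ⟨HardySpace.ofPolynomial p 0⟩

instance (n : ℕ) (p : ℝ≥0∞) : One (HardySpace n p) := ⟨HardySpace.ofPolynomial p 1⟩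

/-- The topology of `H^p(𝔻ⁿ)` given by its (quasi-)norm: `U` is open when it contains a ball
around each of its points. For `p ≥ 1` this is the topology of the metric `‖f - g‖_p`, and for
`p < 1` that of the metric `‖f - g‖_p ^ p`. -/
@[reducible] def hardyNormTopology (n : ℕ) (p : ℝ≥0∞) : TopologicalSpace (HardySpace n p) where
  IsOpen U := ∀ f ∈ U, ∃ ε > (0 : ℝ≥0∞), ∀ g : HardySpace n p,
    hardyNorm n p (fun z => g z - f z) < ε → g ∈ U
  isOpen_univ := fun _ _ => ⟨1, one_pos, fun _ _ => mem_univ _⟩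
  isOpen_inter := fun U V hU hV f hf => by
    obtain ⟨ε, hε, h⟩ := hU f hf.1
    obtain ⟨δ, hδ, h'⟩ := hV f hf.2
    exact ⟨min ε δ, lt_min hε hδ, fun g hg =>
      ⟨h g (hg.trans_le (min_le_left _ _)), h' g (hg.trans_le (min_le_right _ _))⟩⟩
  isOpen_sUnion := fun S hS f hf => by
    obtain ⟨U, hU, hfU⟩ := hf
    obtain ⟨ε, hε, h⟩ := hS U hU f hfU
    exact ⟨ε, hε, fun g hg => ⟨U, hU, h g hg⟩⟩

/-- The duality pairing `⟨f, g⟩ = ∫_{𝕋ⁿ} f* g dm` of `f ∈ H^∞(𝔻ⁿ)` with `g ∈ L¹(𝕋ⁿ)`, where `f*`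
is the boundary function of `f`. It is computed as `lim_{r → 1⁻} ∫_{𝕋ⁿ} f(rζ) g(ζ) dm(ζ)`; the
limit exists for every bounded analytic `f`, since `f(r ·) → f*` weak-star in `L^∞(𝕋ⁿ)`. -/
def boundaryPairing (n : ℕ) (g : UnitAddTorus (Fin n) → ℂ) (f : (Fin n → ℂ) → ℂ) : ℂ :=
  limUnder (𝓝[<] (1 : ℝ)) fun r : ℝ =>
    ∫ θ : UnitAddTorus (Fin n), f (torusPoint n r θ) * g θ

/-- The weak-star topology of `H^∞(𝔻ⁿ)`, a weak-star closed subspace of `L^∞(𝕋ⁿ) = L¹(𝕋ⁿ)*`: the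
coarsest topology for which all pairings with functions in `L¹(𝕋ⁿ)` are continuous. (It is used
for `p = ∞` only.) -/
@[reducible] def hardyWeakStarTopology (n : ℕ) (p : ℝ≥0∞) : TopologicalSpace (HardySpace n p) :=
  ⨅ (g : UnitAddTorus (Fin n) → ℂ) (_ : Integrable g volume),
    TopologicalSpace.induced (fun f : HardySpace n p => boundaryPairing n g f) inferInstance

open scoped Classical in
/-- The weak-star topology on `H^p(𝔻ⁿ)` for `p = ∞`, and the topology of the (quasi-)norm for
`p < ∞`. -/
@[reducible] def hardyTopology (n : ℕ) (p : ℝ≥0∞) : TopologicalSpace (HardySpace n p) :=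
  if p = ∞ then hardyWeakStarTopology n p else hardyNormTopology n p

end

/-! ### Functionals with values in the spectrum -/

section SpectralFunctionals

set_option linter.unusedSectionVars false

variable {A : Type*} [NormedCommRing A] [NormedAlgebra ℂ A] [CompleteSpace A] [NormOneClass A]

theorem LinearMap.map_complex_smul_of_map_I_smul {E : Type*} [AddCommGroup E] [Module ℂ E]
    [Module ℝ E] [IsScalarTower ℝ ℂ E] (f : E →ₗ[ℝ] ℂ)
    (hf : ∀ x, f (Complex.I • x) = Complex.I * f x) (c : ℂ) (x : E) : f (c • x) = c * f x := by
  have h : c • x = c.re • x + c.im • (Complex.I • x) := by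
    rw [← algebraMap_smul ℂ c.re x, ← algebraMap_smul ℂ c.im (Complex.I • x), smul_smul, ← add_smul]
    congr 1
    simp
  rw [h, map_add, map_smul, map_smul, hf]
  simp only [Complex.real_smul]
  rw [← mul_assoc, ← add_mul, Complex.re_add_im]

theorem norm_le_of_forall_mem_spectrum {L : A → ℂ} (hL : ∀ x, L x ∈ spectrum ℂ x) (x : A) :
    ‖L x‖ ≤ ‖x‖ :=
  spectrum.norm_le_norm_of_mem (hL x)

theorem ne_zero_of_isUnit_of_mem_spectrum {x : A} {c : ℂ} (hx : IsUnit x)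
    (hc : c ∈ spectrum ℂ x) : c ≠ 0 := by
  rintro rfl
  exact (spectrum.zero_notMem_iff ℂ).2 hx hc

/-- The complex linear part of a real linear functional. -/
noncomputable def complexPart (L : A →ₗ[ℝ] ℂ) (hL : ∀ x, L x ∈ spectrum ℂ x) : A →L[ℂ] ℂ :=
  LinearMap.mkContinuous
    { toFun := fun x => (L x - Complex.I * L (Complex.I • x)) / 2
      map_add' := fun x y => by simp only [map_add, smul_add]; ring
      map_smul' := fun c x => by
        let f : A →ₗ[ℝ] ℂ :=
          { toFun := fun x => (L x - Complex.I * L (Complex.I • x)) / 2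
            map_add' := fun x y => by simp only [map_add, smul_add]; ring
            map_smul' := fun r x => by
              rw [smul_comm Complex.I r x, map_smul, map_smul]
              simp only [Complex.real_smul, RingHom.id_apply]; ring }
        refine f.map_complex_smul_of_map_I_smul (fun x => ?_) c x
        change (L (Complex.I • x) - Complex.I * L (Complex.I • Complex.I • x)) / 2 =
          Complex.I * ((L x - Complex.I * L (Complex.I • x)) / 2)
        rw [smul_smul, Complex.I_mul_I, neg_one_smul, map_neg]
        linear_combination (L (Complex.I • x) / 2) * Complex.I_mul_I } 1 fun x => by
    have h1 := norm_le_of_forall_mem_spectrum hL x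
    have h2 := norm_le_of_forall_mem_spectrum hL (Complex.I • x)
    have h3 : ‖Complex.I • x‖ = ‖x‖ := by rw [norm_smul, Complex.norm_I, one_mul]
    change ‖(L x - Complex.I * L (Complex.I • x)) / 2‖ ≤ 1 * ‖x‖
    have h4 := norm_sub_le (L x) (Complex.I * L (Complex.I • x))
    rw [norm_mul, Complex.norm_I, one_mul] at h4
    rw [norm_div, Complex.norm_ofNat]
    linarith

/-- The conjugate of the conjugate-linear part of a real linear functional. -/
noncomputable def conjPart (L : A →ₗ[ℝ] ℂ) (hL : ∀ x, L x ∈ spectrum ℂ x) : A →L[ℂ] ℂ :=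
  LinearMap.mkContinuous
    { toFun := fun x => (starRingEnd ℂ) ((L x + Complex.I * L (Complex.I • x)) / 2)
      map_add' := fun x y => by
        rw [← map_add]; congr 1; simp only [map_add, smul_add]; ring
      map_smul' := fun c x => by
        let f : A →ₗ[ℝ] ℂ :=
          { toFun := fun x => (starRingEnd ℂ) ((L x + Complex.I * L (Complex.I • x)) / 2)
            map_add' := fun x y => by
              rw [← map_add]; congr 1; simp only [map_add, smul_add]; ring
            map_smul' := fun r x => by
              rw [smul_comm Complex.I r x, map_smul, map_smul, RingHom.id_apply, Complex.real_smul,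
                Complex.real_smul, Complex.real_smul,
                show (r : ℂ) = starRingEnd ℂ r from (Complex.conj_ofReal r).symm, ← map_mul,
                Complex.conj_ofReal]
              congr 1; ring }
        refine f.map_complex_smul_of_map_I_smul (fun x => ?_) c x
        change (starRingEnd ℂ) ((L (Complex.I • x) + Complex.I * L (Complex.I • Complex.I • x)) / 2)
          = Complex.I * (starRingEnd ℂ) ((L x + Complex.I * L (Complex.I • x)) / 2)
        rw [smul_smul, Complex.I_mul_I, neg_one_smul, map_neg,
          show Complex.I = starRingEnd ℂ (-Complex.I) by simp, ← map_mul]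
        congr 1
        simp only [map_neg, Complex.conj_I, neg_neg]
        linear_combination (L (Complex.I • x) / 2) * Complex.I_mul_I } 1 fun x => by
    have h1 := norm_le_of_forall_mem_spectrum hL x
    have h2 := norm_le_of_forall_mem_spectrum hL (Complex.I • x)
    have h3 : ‖Complex.I • x‖ = ‖x‖ := by rw [norm_smul, Complex.norm_I, one_mul]
    change ‖(starRingEnd ℂ) ((L x + Complex.I * L (Complex.I • x)) / 2)‖ ≤ 1 * ‖x‖
    have h4 := norm_add_le (L x) (Complex.I * L (Complex.I • x))
    rw [norm_mul, Complex.norm_I, one_mul] at h4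
    rw [RCLike.norm_conj, norm_div, Complex.norm_ofNat]
    linarith

theorem complexPart_apply (L : A →ₗ[ℝ] ℂ) (hL : ∀ x, L x ∈ spectrum ℂ x) (x : A) :
    complexPart L hL x = (L x - Complex.I * L (Complex.I • x)) / 2 := rfl

theorem conjPart_apply (L : A →ₗ[ℝ] ℂ) (hL : ∀ x, L x ∈ spectrum ℂ x) (x : A) :
    conjPart L hL x = (starRingEnd ℂ) ((L x + Complex.I * L (Complex.I • x)) / 2) := rfl

theorem complexPart_add_conj_conjPart (L : A →ₗ[ℝ] ℂ) (hL : ∀ x, L x ∈ spectrum ℂ x) (x : A) :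
    L x = complexPart L hL x + starRingEnd ℂ (conjPart L hL x) := by
  rw [complexPart_apply, conjPart_apply, Complex.conj_conj]; ring

theorem norm_complexPart_ne_norm_conjPart (L : A →ₗ[ℝ] ℂ) (hL : ∀ x, L x ∈ spectrum ℂ x) {x : A}
    (hx : IsUnit x) : ‖complexPart L hL x‖ ≠ ‖conjPart L hL x‖ := by
  intro h
  set a := complexPart L hL x with ha
  set b := conjPart L hL x with hb
  obtain ⟨u, hu1, hu⟩ : ∃ u : ℂ, ‖u‖ = 1 ∧ u ^ 2 * a + starRingEnd ℂ b = 0 := by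
    by_cases h0 : a = 0
    · rw [h0, norm_zero, eq_comm, norm_eq_zero] at h
      exact ⟨1, by simp, by simp [h0, h]⟩
    · obtain ⟨u, hu⟩ := IsAlgClosed.exists_pow_nat_eq (-(starRingEnd ℂ b) / a) (n := 2) (by norm_num)
      refine ⟨u, ?_, by rw [hu]; field_simp; ring⟩
      have h2 := congrArg norm hu
      rw [norm_pow, norm_div, norm_neg, RCLike.norm_conj, h, div_self] at h2
      · exact (pow_eq_one_iff_of_nonneg (norm_nonneg _) two_ne_zero).1 h2
      · rw [← h]; exact norm_ne_zero_iff.2 h0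
  have hu0 : u ≠ 0 := by rintro rfl; simp at hu1
  refine ne_zero_of_isUnit_of_mem_spectrum (x := u • x) ?_ (hL (u • x)) ?_
  · exact (IsUnit.smul (Units.mk0 u hu0) hx :)
  · rw [complexPart_add_conj_conjPart L hL, map_smul, map_smul, ← ha, ← hb, smul_eq_mul,
      smul_eq_mul, map_mul]
    have h3 : u * starRingEnd ℂ u = 1 := by
      rw [Complex.mul_conj, Complex.normSq_eq_norm_sq, hu1]; simp
    linear_combination (starRingEnd ℂ u) * hu - u * a * h3

theorem hasDerivAt_clm_mul_exp_smul (l : A →L[ℂ] ℂ) (g f : A) (s : ℂ) :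
    HasDerivAt (fun s : ℂ => l (g * NormedSpace.exp (s • f)))
      (l (g * (f * NormedSpace.exp (s • f)))) s := by
  have h := hasDerivAt_exp_smul_const' (𝕂 := ℂ) f s
  have h2 : HasDerivAt (fun s : ℂ => g * NormedSpace.exp (s • f))
      (g * (f * NormedSpace.exp (s • f))) s := h.const_mul g
  exact l.hasFDerivAt.comp_hasDerivAt s h2

theorem isUnit_exp_of_complex (x : A) : IsUnit (NormedSpace.exp x) :=
  let := NormedAlgebra.restrictScalars ℚ ℂ A
  NormedSpace.isUnit_exp x

theorem apply_one_of_mem_spectrum {L : A → ℂ} (hL : ∀ x, L x ∈ spectrum ℂ x) (c : ℂ) :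
    L (c • 1) = c := by
  have : Nontrivial A := NormOneClass.nontrivial
  have h := hL (c • 1)
  rw [← Algebra.algebraMap_eq_smul_one, spectrum.scalar_eq] at h
  rw [← Algebra.algebraMap_eq_smul_one]
  exact h

theorem conjPart_eq_zero (L : A →ₗ[ℝ] ℂ) (hL : ∀ x, L x ∈ spectrum ℂ x) (f : A) :
    conjPart L hL f = 0 := by
  have h1 : L 1 = 1 := by simpa using apply_one_of_mem_spectrum hL 1
  have h2 : L (Complex.I • 1) = Complex.I := apply_one_of_mem_spectrum hL Complex.I
  have ha : complexPart L hL 1 = 1 := by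
    rw [complexPart_apply, h1, h2, Complex.I_mul_I]; norm_num
  have hb : conjPart L hL 1 = 0 := by
    rw [conjPart_apply, h1, h2, Complex.I_mul_I]; norm_num
  let F : ℂ → ℂ := fun s => complexPart L hL (1 * NormedSpace.exp (s • f))
  let G : ℂ → ℂ := fun s => conjPart L hL (1 * NormedSpace.exp (s • f))
  have hF : Differentiable ℂ F := fun s =>
    (hasDerivAt_clm_mul_exp_smul (complexPart L hL) 1 f s).differentiableAt
  have hG : Differentiable ℂ G := fun s =>
    (hasDerivAt_clm_mul_exp_smul (conjPart L hL) 1 f s).differentiableAt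
  have hF0 : F 0 = 1 := by simp only [F, zero_smul, NormedSpace.exp_zero, mul_one, ha]
  have hG0 : G 0 = 0 := by simp only [G, zero_smul, NormedSpace.exp_zero, mul_one, hb]
  have hlt : ∀ s, ‖G s‖ < ‖F s‖ := by
    intro s
    by_contra hs
    have hc : Continuous fun s => ‖F s‖ - ‖G s‖ := hF.continuous.norm.sub hG.continuous.norm
    obtain ⟨t, ht⟩ := mem_range_of_exists_le_of_exists_ge (c := 0) hc
      ⟨s, by linarith⟩ ⟨0, by simp [hF0, hG0]⟩
    refine norm_complexPart_ne_norm_conjPart L hL (x := 1 * NormedSpace.exp (t • f)) ?_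
      (sub_eq_zero.1 ht)
    rw [one_mul]
    exact isUnit_exp_of_complex (t • f)
  have hne : ∀ s, F s ≠ 0 := fun s hs => by
    have := hlt s
    rw [hs, norm_zero] at this
    exact (norm_nonneg _).not_gt this
  have hq : Differentiable ℂ fun s => G s / F s := hG.div hF hne
  have hbd : Bornology.IsBounded (range fun s => G s / F s) := by
    refine (Metric.isBounded_closedBall (x := (0 : ℂ)) (r := 1)).subset ?_
    rintro _ ⟨s, rfl⟩
    rw [mem_closedBall_zero_iff, norm_div]
    exact (div_le_one (norm_pos_iff.2 (hne s))).2 (hlt s).le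
  have hG' : G = fun _ => 0 := by
    funext s
    have := hq.apply_eq_apply_of_bounded hbd s 0
    simp only [hG0, zero_div, div_eq_zero_iff, hne s, or_false] at this
    exact this
  have hd := hasDerivAt_clm_mul_exp_smul (conjPart L hL) 1 f 0
  have hd2 : HasDerivAt G 0 0 := by rw [hG']; exact hasDerivAt_const _ _
  have := hd.unique hd2
  simpa using this

theorem map_I_smul_of_mem_spectrum (L : A →ₗ[ℝ] ℂ) (hL : ∀ x, L x ∈ spectrum ℂ x) (f : A) :
    L (Complex.I • f) = Complex.I * L f := by
  have h := conjPart_eq_zero L hL f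
  rw [conjPart_apply, map_eq_zero, div_eq_zero_iff] at h
  have h' := h.resolve_right two_ne_zero
  linear_combination (-Complex.I) * h' + L (Complex.I • f) * Complex.I_mul_I

/-- A linear functional with values in the spectrum preserves squares
(Gleason–Kahane–Żelazko). -/
theorem map_mul_self_of_mem_spectrum (L : A →ₗ[ℝ] ℂ) (hL : ∀ x, L x ∈ spectrum ℂ x) (f : A) :
    L (f * f) = L f * L f := by
  let l := complexPart L hL
  have hl : ∀ x, l x = L x := fun x => by
    rw [complexPart_add_conj_conjPart L hL x, conjPart_eq_zero, map_zero, add_zero]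
  have h1 : l 1 = 1 := by rw [hl]; simpa using apply_one_of_mem_spectrum hL 1
  let F : ℂ → ℂ := fun s => l (1 * NormedSpace.exp (s • f))
  let F' : ℂ → ℂ := fun s => l (f * NormedSpace.exp (s • f))
  have hF : ∀ s, HasDerivAt F (F' s) s := fun s => by
    have h := hasDerivAt_clm_mul_exp_smul l 1 f s
    rwa [one_mul] at h
  have hF' : ∀ s, HasDerivAt F' (l (f * (f * NormedSpace.exp (s • f)))) s := fun s =>
    hasDerivAt_clm_mul_exp_smul l f f s
  have hne : ∀ s, F s ≠ 0 := fun s => by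
    change l _ ≠ 0
    rw [hl, one_mul]
    exact ne_zero_of_isUnit_of_mem_spectrum (isUnit_exp_of_complex (s • f)) (hL _)
  have hb : ∀ s, ‖F' s / F s‖ ≤ ‖f‖ := by
    intro s
    by_contra! hs
    set c := F' s / F s with hc
    have hcu : IsUnit (f - algebraMap ℂ A c) := by
      have : c ∉ spectrum ℂ f := fun h => (spectrum.norm_le_norm_of_mem h).not_gt hs
      rw [spectrum.notMem_iff] at this
      simpa using this.neg
    have hu := hcu.mul (isUnit_exp_of_complex (s • f))
    refine ne_zero_of_isUnit_of_mem_spectrum hu (hL _) ?_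
    rw [← hl, sub_mul, map_sub, ← Algebra.smul_def, map_smul, smul_eq_mul]
    have : F s = l (NormedSpace.exp (s • f)) := by simp only [F, one_mul]
    rw [← this, hc, div_mul_cancel₀ _ (hne s)]
    exact sub_self _
  have hq : Differentiable ℂ fun s => F' s / F s :=
    Differentiable.div (fun s => (hF' s).differentiableAt) (fun s => (hF s).differentiableAt) hne
  have hbd : Bornology.IsBounded (range fun s => F' s / F s) := by
    refine (Metric.isBounded_closedBall (x := (0 : ℂ)) (r := ‖f‖)).subset ?_
    rintro _ ⟨s, rfl⟩
    rw [mem_closedBall_zero_iff]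
    exact hb s
  have hF0 : F 0 = 1 := by simp only [F, zero_smul, NormedSpace.exp_zero, mul_one, h1]
  have hF'0 : F' 0 = l f := by simp only [F', zero_smul, NormedSpace.exp_zero, mul_one]
  have heq : F' = fun s => l f * F s := by
    funext s
    have := hq.apply_eq_apply_of_bounded hbd s 0
    simp only [hF0, hF'0, div_one] at this
    rw [← this, div_mul_cancel₀ _ (hne s)]
  have h2 : HasDerivAt F' (l f * F' 0) 0 := by
    conv => arg 1; rw [heq]
    exact (hF 0).const_mul _
  have := (hF' 0).unique h2
  simp only [zero_smul, NormedSpace.exp_zero, mul_one, hF'0] at this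
  rw [← hl, ← hl, this]

end SpectralFunctionals

/-! ### Approximately holomorphic functions -/

theorem Complex.differentiable_of_forall_exists_approx {h : ℂ → ℂ} (hc : Continuous h)
    (H : ∀ ε > (0 : ℝ), ∃ k : ℂ → ℂ, Differentiable ℝ k ∧ (∀ z, ‖h z - k z‖ ≤ ε) ∧
      ∀ z, ‖fderiv ℝ k z Complex.I - Complex.I * fderiv ℝ k z 1‖ ≤ ε) :
    Differentiable ℂ h := by
  rw [← differentiableOn_univ, ← Complex.isConservativeOn_and_continuousOn_iff_isDifferentiableOn
    isOpen_univ]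
  refine ⟨fun z w _ => ?_, hc.continuousOn⟩
  rw [← add_eq_zero_iff_eq_neg, Complex.wedgeIntegral_add_wedgeIntegral_eq]
  set a : ℝ := |w.re - z.re| with ha
  set b : ℝ := |w.im - z.im| with hb
  set E : (ℂ → ℂ) → ℂ := fun f => (∫ x : ℝ in z.re..w.re, f (x + z.im * Complex.I)) -
      (∫ x : ℝ in z.re..w.re, f (x + w.im * Complex.I)) +
      Complex.I • (∫ y : ℝ in z.im..w.im, f (w.re + y * Complex.I)) -
      Complex.I • (∫ y : ℝ in z.im..w.im, f (z.re + y * Complex.I)) with hE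
  change E h = 0
  have hbound : ∀ ε > (0 : ℝ), ‖E h‖ ≤ (2 * a + 2 * b + a * b) * ε := by
    intro ε hε
    obtain ⟨k, hk, hkh, hd⟩ := H ε hε
    have hkc := hk.continuous
    have e1 : E h - E k = E (fun z => h z - k z) := by
      simp only [hE]
      rw [intervalIntegral.integral_sub, intervalIntegral.integral_sub,
        intervalIntegral.integral_sub, intervalIntegral.integral_sub]
      · simp only [smul_eq_mul]; ring
      all_goals apply Continuous.intervalIntegrable; fun_prop
    have e2 : ‖E (fun z => h z - k z)‖ ≤ ε * a + ε * a + ε * b + ε * b := by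
      refine (norm_sub_le _ _).trans (add_le_add ((norm_add_le _ _).trans (add_le_add
        ((norm_sub_le _ _).trans (add_le_add ?_ ?_)) ?_)) ?_)
      · exact intervalIntegral.norm_integral_le_of_norm_le_const fun x _ => hkh _
      · exact intervalIntegral.norm_integral_le_of_norm_le_const fun x _ => hkh _
      · rw [norm_smul, Complex.norm_I, one_mul]
        exact intervalIntegral.norm_integral_le_of_norm_le_const fun x _ => hkh _
      · rw [norm_smul, Complex.norm_I, one_mul]
        exact intervalIntegral.norm_integral_le_of_norm_le_const fun x _ => hkh _
    have hd' : ∀ z, ‖Complex.I • fderiv ℝ k z 1 - fderiv ℝ k z Complex.I‖ ≤ ε := fun z => by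
      rw [norm_sub_rev, smul_eq_mul]; exact hd z
    have hint : IntegrableOn (fun z => Complex.I • fderiv ℝ k z 1 - fderiv ℝ k z Complex.I)
        (uIcc z.re w.re ×ℂ uIcc z.im w.im) := by
      refine Measure.integrableOn_of_bounded (M := ε) ?_ ?_ (Filter.Eventually.of_forall hd')
      · exact (isCompact_uIcc.reProdIm isCompact_uIcc).measure_lt_top.ne
      · exact (((measurable_fderiv_apply_const ℝ k 1).const_smul Complex.I).sub
          (measurable_fderiv_apply_const ℝ k Complex.I)).aestronglyMeasurable
    have e3 : ‖E k‖ ≤ ε * b * a := by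
      have := Complex.integral_boundary_rect_of_continuousOn_of_hasFDerivAt_real k (fderiv ℝ k) z w
        hkc.continuousOn (fun x _ => (hk x).hasFDerivAt) hint
      simp only [hE]
      rw [this]
      refine intervalIntegral.norm_integral_le_of_norm_le_const fun x _ => ?_
      exact intervalIntegral.norm_integral_le_of_norm_le_const fun y _ => hd' _
    have e4 : ‖E h‖ ≤ ‖E h - E k‖ + ‖E k‖ := by
      have := norm_add_le (E h - E k) (E k)
      rwa [sub_add_cancel] at this
    rw [e1] at e4
    linarith
  have ha0 : 0 ≤ a := abs_nonneg _
  have hb0 : 0 ≤ b := abs_nonneg _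
  have hab := mul_nonneg ha0 hb0
  rw [← norm_le_zero_iff]
  refine le_of_forall_pos_le_add fun η hη => ?_
  have h1 := hbound (η / (2 * a + 2 * b + a * b + 1)) (by positivity)
  refine h1.trans ?_
  rw [zero_add, mul_div_assoc', div_le_iff₀ (by positivity)]
  nlinarith

theorem LipschitzWith.exists_differentiable_approx {W : Type*} [NormedAddCommGroup W]
    [NormedSpace ℝ W] [FiniteDimensional ℝ W] {g : W → ℂ} {C : NNReal} (hg : LipschitzWith C g)
    (u v : W) {δ : ℝ}
    (hδ : ∀ x, DifferentiableAt ℝ g x → ‖fderiv ℝ g x v - Complex.I * fderiv ℝ g x u‖ ≤ δ)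
    {ε : ℝ} (hε : 0 < ε) :
    ∃ k : W → ℂ, Differentiable ℝ k ∧ (∀ x, ‖g x - k x‖ ≤ ε) ∧
      ∀ x, ‖fderiv ℝ k x v - Complex.I * fderiv ℝ k x u‖ ≤ δ := by
  borelize W
  let μ : Measure W := Measure.addHaar
  obtain ⟨r, hr, hrC⟩ : ∃ r > (0 : ℝ), C * r ≤ ε := by
    refine ⟨ε / (C + 1), by positivity, ?_⟩
    rw [mul_div_assoc', div_le_iff₀ (by positivity)]
    nlinarith [C.2]
  let B : Set W := Metric.ball 0 r
  let ν : Measure W := ProbabilityTheory.cond μ B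
  have hB0 : μ B ≠ 0 := (Metric.measure_ball_pos μ 0 hr).ne'
  have hBt : μ B ≠ ∞ := Metric.isBounded_ball.measure_lt_top.ne
  have hν : IsProbabilityMeasure ν := ProbabilityTheory.cond_isProbabilityMeasure_of_finite hB0 hBt
  have hνμ : ν ≪ μ := ProbabilityTheory.cond_absolutelyContinuous
  have hνB : ∀ᵐ y ∂ν, y ∈ B := ProbabilityTheory.ae_cond_mem Metric.isOpen_ball.measurableSet
  have hgc := hg.continuous
  have hclose : ∀ x, ∀ᵐ y ∂ν, ‖g (x + y) - g x‖ ≤ ε := fun x => by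
    filter_upwards [hνB] with y hy
    refine (hg.norm_sub_le _ _).trans ?_
    rw [add_sub_cancel_left]
    have : ‖y‖ < r := mem_ball_zero_iff.1 hy
    exact (mul_le_mul_of_nonneg_left this.le C.2).trans hrC
  have hmeas : ∀ x, AEStronglyMeasurable (fun y => g (x + y)) ν := fun x =>
    (hgc.comp (continuous_const.add continuous_id)).aestronglyMeasurable
  have hint : ∀ x, Integrable (fun y => g (x + y)) ν := fun x =>
    integrable_of_norm_sub_le (hmeas x) (integrable_const (g x)) (integrable_const ε) <| by
      filter_upwards [hclose x] with y hy
      rwa [norm_sub_rev]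
  have hdiff : ∀ x, ∀ᵐ y ∂ν, DifferentiableAt ℝ g (x + y) := fun x =>
    hνμ.ae_le ((measurePreserving_add_left μ x).quasiMeasurePreserving.ae
      (hg.ae_differentiableAt (μ := μ)))
  have key : ∀ x, Integrable (fun y => fderiv ℝ g (x + y)) ν ∧
      HasFDerivAt (fun x => ∫ y, g (x + y) ∂ν) (∫ y, fderiv ℝ g (x + y) ∂ν) x := fun x => by
    refine hasFDerivAt_integral_of_dominated_loc_of_lip (bound := fun _ => (C : ℝ)) univ_mem
      (Filter.Eventually.of_forall hmeas) (hint x) ?_ ?_ (integrable_const _) ?_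
    · exact ((measurable_fderiv ℝ g).comp (measurable_const_add x)).aestronglyMeasurable
    · refine Filter.Eventually.of_forall fun y => ?_
      have : Real.nnabs (C : ℝ) = C := by ext; simp
      rw [this]
      refine LipschitzWith.lipschitzOnWith (LipschitzWith.of_dist_le_mul fun a b => ?_)
      simpa using hg.dist_le_mul (a + y) (b + y)
    · filter_upwards [hdiff x] with y hy
      have h1 : HasFDerivAt (fun x => x + y) (ContinuousLinearMap.id ℝ W) x :=
        (hasFDerivAt_id x).add_const y
      simpa using! hy.hasFDerivAt.comp x h1
  refine ⟨fun x => ∫ y, g (x + y) ∂ν, fun x => (key x).2.differentiableAt, fun x => ?_, fun x => ?_⟩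
  · have h1 : g x - ∫ y, g (x + y) ∂ν = -∫ y, (g (x + y) - g x) ∂ν := by
      rw [integral_sub (hint x) (integrable_const _)]
      simp
    rw [h1, norm_neg]
    simpa using norm_integral_le_of_norm_le_const (hclose x)
  · rw [(key x).2.fderiv, ContinuousLinearMap.integral_apply (key x).1,
      ContinuousLinearMap.integral_apply (key x).1, ← integral_const_mul, ← integral_sub]
    · have : ∀ᵐ y ∂ν, ‖fderiv ℝ g (x + y) v - Complex.I * fderiv ℝ g (x + y) u‖ ≤ δ := by
        filter_upwards [hdiff x] with y hy using hδ _ hy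
      simpa using norm_integral_le_of_norm_le_const this
    · exact (key x).1.apply_continuousLinearMap v
    · exact ((key x).1.apply_continuousLinearMap u).const_mul _

/-! ### The Kowalski–Słodkowski theorem -/

section KowalskiSlodkowski

set_option linter.unusedSectionVars false

variable {A : Type*} [NormedCommRing A] [NormedAlgebra ℂ A] [CompleteSpace A] [NormOneClass A]

theorem real_smul_mem_spectrum_smul {x : A} {c : ℂ} {t : ℝ} (ht : t ≠ 0)
    (hc : c ∈ spectrum ℂ (t • x)) : t⁻¹ • c ∈ spectrum ℂ x := by
  have htc : (t : ℂ) ≠ 0 := Complex.ofReal_ne_zero.2 ht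
  have h := (spectrum.smul_mem_smul_iff (r := (Units.mk0 (t : ℂ) htc)⁻¹)).2 hc
  have h2 : (Units.mk0 (t : ℂ) htc)⁻¹ • t • x = x := by
    rw [← Complex.coe_smul t x, Units.smul_def, smul_smul]
    simp [htc]
  rw [h2, Units.smul_def] at h
  have h3 : t⁻¹ • c = ((Units.mk0 (t : ℂ) htc)⁻¹ : ℂˣ).val • c := by
    simp
  rwa [h3]

theorem fderiv_apply_mem_spectrum {lam : A → ℂ} (hlam : ∀ x y, lam x - lam y ∈ spectrum ℂ (x - y))
    (W : Submodule ℂ A) {x : W} (hx : DifferentiableAt ℝ (fun y : W => lam y) x) (y : W) :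
    fderiv ℝ (fun y : W => lam y) x y ∈ spectrum ℂ (y : A) := by
  have h := hx.hasFDerivAt.hasLineDerivAt y
  have h2 := hasDerivAt_iff_tendsto_slope_zero.1 h
  refine (spectrum.isClosed (𝕜 := ℂ) (y : A)).mem_of_tendsto h2 ?_
  filter_upwards [self_mem_nhdsWithin] with t ht
  refine real_smul_mem_spectrum_smul ht ?_
  have h3 := hlam ((x + (0 + t) • y : W) : A) ((x + (0 : ℝ) • y : W) : A)
  have h4 : ((x + (0 + t) • y : W) : A) - ((x + (0 : ℝ) • y : W) : A) = t • (y : A) := by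
    simp
  rwa [h4] at h3

theorem exists_finset_map_I_smul_approx (R : A) {ε : ℝ} (hε : 0 < ε) :
    ∃ S : Finset A, ∀ S' : Finset A, S ⊆ S' → ∀ L : A →ₗ[ℝ] ℂ,
      (∀ x ∈ Submodule.span ℂ (S' : Set A), L x ∈ spectrum ℂ x) →
        ‖L (Complex.I • R) - Complex.I * L R‖ ≤ ε := by
  classical
  by_contra! H
  choose S' hS' L hL hLR using H
  let U : Ultrafilter (Finset A) := Ultrafilter.of atTop
  have hU : (U : Filter (Finset A)) ≤ atTop := Ultrafilter.of_le atTop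
  have hev : ∀ x : A, ∀ᶠ S in (U : Filter (Finset A)), L S x ∈ spectrum ℂ x := fun x =>
    hU <| (eventually_ge_atTop {x}).mono fun S hS =>
      hL S x (Submodule.subset_span (hS' S (hS (Finset.mem_singleton_self x))))
  have hlim : ∀ x : A, ∃ a ∈ spectrum ℂ x, Tendsto (fun S => L S x) U (𝓝 a) := fun x => by
    have := (spectrum.isCompact (𝕜 := ℂ) x).ultrafilter_le_nhds (U.map fun S => L S x)
      (le_principal_iff.2 (hev x))
    exact this
  choose l hl hlt using hlim
  let M : A →ₗ[ℝ] ℂ :=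
    { toFun := l
      map_add' := fun x y => tendsto_nhds_unique (hlt (x + y)) <| by
        simpa only [map_add] using (hlt x).add (hlt y)
      map_smul' := fun r x => tendsto_nhds_unique (hlt (r • x)) <| by
        simpa only [map_smul, RingHom.id_apply] using (hlt x).const_smul r }
  have hM := map_I_smul_of_mem_spectrum M hl R
  have h1 : Tendsto (fun S => ‖L S (Complex.I • R) - Complex.I * L S R‖) U
      (𝓝 ‖l (Complex.I • R) - Complex.I * l R‖) :=
    ((hlt _).sub ((hlt R).const_mul _)).norm
  have h2 := ge_of_tendsto' h1 fun S => (hLR S).le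
  have h3 : l (Complex.I • R) = Complex.I * l R := hM
  rw [h3, sub_self, norm_zero] at h2
  exact h2.not_gt hε

theorem lipschitzWith_of_sub_mem_spectrum {lam : A → ℂ}
    (hlam : ∀ x y, lam x - lam y ∈ spectrum ℂ (x - y)) : LipschitzWith 1 lam :=
  LipschitzWith.of_dist_le_mul fun x y => by
    rw [NNReal.coe_one, one_mul, dist_eq_norm, dist_eq_norm]
    exact spectrum.norm_le_norm_of_mem (hlam x y)

theorem differentiable_line_of_sub_mem_spectrum {lam : A → ℂ}
    (hlam : ∀ x y, lam x - lam y ∈ spectrum ℂ (x - y)) (P R : A) :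
    Differentiable ℂ fun c : ℂ => lam (P + c • R) := by
  classical
  have hlip := lipschitzWith_of_sub_mem_spectrum hlam
  refine Complex.differentiable_of_forall_exists_approx
    (hlip.continuous.comp (by fun_prop)) fun ε hε => ?_
  obtain ⟨S, hS⟩ := exists_finset_map_I_smul_approx R hε
  let S' : Finset A := S ∪ {P, R}
  let W : Submodule ℂ A := Submodule.span ℂ (S' : Set A)
  have : FiniteDimensional ℂ W := FiniteDimensional.span_finset ℂ S'
  have : FiniteDimensional ℝ W := FiniteDimensional.complexToReal W
  have hP : P ∈ W := Submodule.subset_span (by simp [S'])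
  have hR : R ∈ W := Submodule.subset_span (by simp [S'])
  let p : W := ⟨P, hP⟩
  let u : W := ⟨R, hR⟩
  have hg : LipschitzWith 1 fun y : W => lam y := 
    LipschitzWith.of_dist_le_mul fun a b => hlip.dist_le_mul a b
  obtain ⟨k, hk, hkg, hkd⟩ := hg.exists_differentiable_approx u (Complex.I • u) (δ := ε)
    (fun x hx => by
      obtain ⟨L, hL⟩ := LinearMap.exists_extend (p := W.restrictScalars ℝ)
        ((fderiv ℝ (fun y : W => lam y) x : W →L[ℝ] ℂ) : W →ₗ[ℝ] ℂ)
      have hLx : ∀ y : W, L y = fderiv ℝ (fun y : W => lam y) x y := fun y =>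
        DFunLike.congr_fun hL y
      have := hS S' Finset.subset_union_left L fun y hy => by
        rw [hLx ⟨y, hy⟩]
        exact fderiv_apply_mem_spectrum hlam W hx ⟨y, hy⟩
      rw [← hLx, ← hLx]
      exact this) hε
  have hline : ∀ z : ℂ, HasFDerivAt (fun c : ℂ => p + c • u)
      ((ContinuousLinearMap.id ℝ ℂ).smulRight u) z := fun z =>
    ((ContinuousLinearMap.id ℝ ℂ).hasFDerivAt.smul_const u).const_add p
  have hd : ∀ z : ℂ, HasFDerivAt (fun c : ℂ => k (p + c • u))
      ((fderiv ℝ k (p + z • u)).comp ((ContinuousLinearMap.id ℝ ℂ).smulRight u)) z := fun z =>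
    (hk (p + z • u)).hasFDerivAt.comp z (hline z)
  refine ⟨fun c => k (p + c • u), fun z => (hd z).differentiableAt, fun z => hkg (p + z • u),
    fun z => ?_⟩
  rw [(hd z).fderiv]
  simpa using hkd (p + z • u)

theorem Complex.eq_add_mul_of_differentiable_of_lipschitz {h : ℂ → ℂ} (hd : Differentiable ℂ h)
    {C : NNReal} (hl : LipschitzWith C h) : ∃ d : ℂ, ∀ c, h c = h 0 + c * d := by
  have hd' : Differentiable ℂ (deriv h) := fun z =>
    (hd.analyticAt z).deriv.differentiableAt
  have hb : Bornology.IsBounded (range (deriv h)) := by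
    refine (Metric.isBounded_closedBall (x := (0 : ℂ)) (r := C)).subset ?_
    rintro _ ⟨s, rfl⟩
    rw [mem_closedBall_zero_iff]
    exact norm_deriv_le_of_lipschitz hl
  refine ⟨deriv h 0, fun c => ?_⟩
  have h1 : ∀ z, HasDerivAt (fun z => h z - z * deriv h 0) 0 z := fun z => by
    have := (hd z).hasDerivAt.sub ((hasDerivAt_id z).mul_const (deriv h 0))
    rwa [one_mul, hd'.apply_eq_apply_of_bounded hb z 0, sub_self] at this
  have h2 := is_const_of_deriv_eq_zero (fun z => (h1 z).differentiableAt) (fun z => (h1 z).deriv) c 0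
  simp only [zero_mul, sub_zero] at h2
  rw [← h2]; ring

/-- The **Kowalski–Słodkowski theorem**. -/
theorem exists_algHom_of_sub_mem_spectrum {lam : A → ℂ} (h0 : lam 0 = 0)
    (hlam : ∀ x y, lam x - lam y ∈ spectrum ℂ (x - y)) : ∃ χ : A →ₐ[ℂ] ℂ, ∀ x, χ x = lam x := by
  have hlip := lipschitzWith_of_sub_mem_spectrum hlam
  have hline : ∀ P R : A, ∃ d : ℂ, ∀ c : ℂ, lam (P + c • R) = lam P + c * d := fun P R => by
    have hl : LipschitzWith ‖R‖₊ fun c : ℂ => lam (P + c • R) :=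
      LipschitzWith.of_dist_le_mul fun a b => by
        refine (hlip.dist_le_mul _ _).trans ?_
        rw [NNReal.coe_one, one_mul, dist_add_left, dist_eq_norm, ← sub_smul, norm_smul,
          coe_nnnorm, mul_comm, dist_eq_norm]
    simpa using Complex.eq_add_mul_of_differentiable_of_lipschitz
      (differentiable_line_of_sub_mem_spectrum hlam P R) hl
  choose D hD using hline
  have hD0 : ∀ P R, D P R = D 0 R := fun P R => by
    by_contra hne
    have h1 : ∀ c : ℂ, ‖lam P + c * (D P R - D 0 R)‖ ≤ ‖P‖ := fun c => by
      have h2 := hlip.dist_le_mul (P + c • R) (0 + c • R)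
      rw [NNReal.coe_one, one_mul, dist_add_right, dist_zero_right, dist_eq_norm, hD P R, hD 0 R,
        h0] at h2
      rwa [show lam P + c * (D P R - D 0 R) = lam P + c * D P R - (0 + c * D 0 R) by ring]
    have h2 := h1 ((‖P‖ + 1 - lam P) / (D P R - D 0 R))
    rw [div_mul_cancel₀ _ (sub_ne_zero.2 hne), add_sub_cancel] at h2
    have h3 : ‖((‖P‖ : ℂ) + 1)‖ = ‖P‖ + 1 := by
      rw [← Complex.ofReal_one, ← Complex.ofReal_add, Complex.norm_real, Real.norm_of_nonneg]
      positivity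
    rw [h3] at h2
    linarith
  have hD1 : ∀ R, D 0 R = lam R := fun R => by
    have := hD 0 R 1
    rw [one_smul, zero_add, h0, zero_add, one_mul] at this
    exact this.symm
  have hadd : ∀ x y, lam (x + y) = lam x + lam y := fun x y => by
    have := hD x y 1
    rwa [one_smul, one_mul, hD0, hD1] at this
  have hsmul : ∀ (c : ℂ) x, lam (c • x) = c * lam x := fun c x => by
    have := hD 0 x c
    rwa [zero_add, h0, zero_add, hD1] at this
  let L : A →ₗ[ℝ] ℂ :=
    { toFun := lam
      map_add' := hadd
      map_smul' := fun r x => by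
        rw [← Complex.coe_smul r x, hsmul]; simp }
  have hL : ∀ x, lam x ∈ spectrum ℂ x := fun x => by simpa [h0] using hlam x 0
  have hsq : ∀ x, lam (x * x) = lam x * lam x := map_mul_self_of_mem_spectrum L hL
  have hmul : ∀ x y, lam (x * y) = lam x * lam y := fun x y => by
    have h1 := hsq (x + y)
    have h2 : (x + y) * (x + y) = x * x + ((2 : ℂ) • (x * y) + y * y) := by
      rw [two_smul]; ring
    rw [h2, hadd, hadd, hsmul, hadd, hsq, hsq] at h1
    linear_combination h1 / 2
  have hone : ∀ c : ℂ, lam (algebraMap ℂ A c) = c := fun c => by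
    rw [Algebra.algebraMap_eq_smul_one]
    exact apply_one_of_mem_spectrum hL c
  exact ⟨{ toFun := lam
           map_one' := by simpa using hone 1
           map_mul' := hmul
           map_zero' := h0
           map_add' := hadd
           commutes' := hone }, fun x => rfl⟩

end KowalskiSlodkowski

/-! ### Point evaluations on polynomials -/

section PointEvaluation

/-- The closed unit polydisc. -/
abbrev closedPolydisc (n : ℕ) : Set (Fin n → ℂ) := Set.pi univ fun _ => Metric.closedBall 0 1

instance compactSpace_closedPolydisc (n : ℕ) : CompactSpace (closedPolydisc n) :=
  isCompact_iff_compactSpace.1 (isCompact_univ_pi fun _ => isCompact_closedBall 0 1)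

instance nonempty_closedPolydisc (n : ℕ) : Nonempty (closedPolydisc n) :=
  ⟨⟨0, fun _ _ => by simp⟩⟩

theorem polydisc_subset_closedPolydisc (n : ℕ) : polydisc n ⊆ closedPolydisc n :=
  fun z hz i _ => by simpa using (hz i).le

/-- Polynomials as continuous functions on the closed polydisc. -/
noncomputable def polynomialOnPolydisc (n : ℕ) :
    MvPolynomial (Fin n) ℂ →ₐ[ℂ] C(closedPolydisc n, ℂ) :=
  MvPolynomial.aeval fun i => ⟨fun z => z.1 i,
    (continuous_apply i).comp continuous_subtype_val⟩

theorem polynomialOnPolydisc_apply {n : ℕ} (P : MvPolynomial (Fin n) ℂ) (z : closedPolydisc n) :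
    polynomialOnPolydisc n P z = MvPolynomial.eval z.1 P := by
  have h : (ContinuousMap.evalAlgHom ℂ ℂ z).comp (polynomialOnPolydisc n) =
      MvPolynomial.aeval z.1 := by
    ext i
    simp [polynomialOnPolydisc, ContinuousMap.evalAlgHom]
    rfl
  have h2 := DFunLike.congr_fun h P
  rwa [MvPolynomial.aeval_eq_eval] at h2

/-- The polydisc algebra: the uniform closure of the polynomials on the closed polydisc. -/
noncomputable abbrev polydiscAlgebra (n : ℕ) : Subalgebra ℂ C(closedPolydisc n, ℂ) :=
  (polynomialOnPolydisc n).range.topologicalClosure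

instance completeSpace_polydiscAlgebra (n : ℕ) : CompleteSpace (polydiscAlgebra n) :=
  (Subalgebra.isClosed_topologicalClosure _).completeSpace_coe

instance normOneClass_polydiscAlgebra (n : ℕ) : NormOneClass (polydiscAlgebra n) :=
  ⟨(norm_one : ‖(1 : C(closedPolydisc n, ℂ))‖ = 1)⟩

/-- Polynomials as elements of the polydisc algebra. -/
noncomputable def toPolydiscAlgebra (n : ℕ) : MvPolynomial (Fin n) ℂ →ₐ[ℂ] polydiscAlgebra n :=
  (polynomialOnPolydisc n).codRestrict _ fun P =>
    Subalgebra.le_topologicalClosure _ ⟨P, rfl⟩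

theorem denseRange_toPolydiscAlgebra (n : ℕ) : DenseRange (toPolydiscAlgebra n) := by
  intro x
  rw [Metric.mem_closure_iff]
  intro ε hε
  have hx : (x : C(closedPolydisc n, ℂ)) ∈
      closure ((polynomialOnPolydisc n).range : Set C(closedPolydisc n, ℂ)) := x.2
  obtain ⟨_, ⟨P, rfl⟩, hP⟩ := Metric.mem_closure_iff.1 hx ε hε
  exact ⟨toPolydiscAlgebra n P, ⟨P, rfl⟩, hP⟩

theorem exists_eq_eval_of_sub_eq_eval_sub {n : ℕ} {lam : MvPolynomial (Fin n) ℂ → ℂ}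
    (h0 : lam 0 = 0)
    (h : ∀ P Q, ∃ z ∈ polydisc n, lam P - lam Q = MvPolynomial.eval z (P - Q)) :
    ∃ a ∈ polydisc n, ∀ P, lam P = MvPolynomial.eval a P := by
  set ρ := toPolydiscAlgebra n with hρ
  have hval : ∀ (P : MvPolynomial (Fin n) ℂ) (z : closedPolydisc n),
      (ρ P : C(closedPolydisc n, ℂ)) z = MvPolynomial.eval z.1 P := polynomialOnPolydisc_apply
  have hz : ∀ P Q, ∃ z : closedPolydisc n,
      lam P - lam Q = ((ρ P - ρ Q : polydiscAlgebra n) : C(closedPolydisc n, ℂ)) z := by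
    intro P Q
    obtain ⟨z, hz, e⟩ := h P Q
    refine ⟨⟨z, polydisc_subset_closedPolydisc n hz⟩, ?_⟩
    rw [e, ← map_sub ρ, hval]
  have hle : ∀ P Q, ‖lam P - lam Q‖ ≤ ‖ρ P - ρ Q‖ := fun P Q => by
    obtain ⟨z, e⟩ := hz P Q
    rw [e]
    exact ContinuousMap.norm_coe_le_norm _ z
  have hfac : lam.FactorsThrough ρ := fun P Q e => by
    have := hle P Q
    rw [e, sub_self, norm_zero, norm_le_zero_iff, sub_eq_zero] at this
    exact this
  have hlip : LipschitzOnWith 1 (Function.extend ρ lam 0) (range ρ) := by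
    refine LipschitzOnWith.of_dist_le_mul ?_
    rintro _ ⟨P, rfl⟩ _ ⟨Q, rfl⟩
    rw [hfac.extend_apply, hfac.extend_apply, NNReal.coe_one, one_mul, dist_eq_norm, dist_eq_norm]
    exact hle P Q
  obtain ⟨g, hg, hgρ⟩ := hlip.extend_finite_dimension
  have hgc := hg.continuous
  have hgP : ∀ P, g (ρ P) = lam P := fun P => by
    rw [← hgρ ⟨P, rfl⟩, hfac.extend_apply]
  have hclosed : IsClosed {p : polydiscAlgebra n × polydiscAlgebra n |
      ∃ z : closedPolydisc n, g p.1 - g p.2 = ((p.1 - p.2 : polydiscAlgebra n) :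
        C(closedPolydisc n, ℂ)) z} := by
    have h1 : IsClosed {q : (polydiscAlgebra n × polydiscAlgebra n) × closedPolydisc n |
        g q.1.1 - g q.1.2 = ((q.1.1 : C(closedPolydisc n, ℂ)) - (q.1.2 : C(closedPolydisc n, ℂ)))
          q.2} := by
      refine isClosed_eq (by fun_prop) ?_
      exact Continuous.eval (by fun_prop) (by fun_prop)
    have h2 := isClosedMap_fst_of_compactSpace _ h1
    convert h2 using 1
    ext p
    constructor
    · rintro ⟨z, hz⟩
      exact ⟨(p, z), hz, rfl⟩
    · rintro ⟨⟨p', z⟩, hz, rfl⟩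
      exact ⟨z, hz⟩
  have hdense := (denseRange_toPolydiscAlgebra n).prodMap (denseRange_toPolydiscAlgebra n)
  have hall : ∀ x y : polydiscAlgebra n, ∃ z : closedPolydisc n,
      g x - g y = ((x - y : polydiscAlgebra n) : C(closedPolydisc n, ℂ)) z := by
    intro x y
    have : (x, y) ∈ closure (range (Prod.map (toPolydiscAlgebra n) (toPolydiscAlgebra n))) :=
      hdense (x, y)
    refine closure_minimal ?_ hclosed this
    rintro _ ⟨⟨P, Q⟩, rfl⟩
    obtain ⟨z, e⟩ := hz P Q
    refine ⟨z, ?_⟩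
    simpa only [Prod.map_apply, ← hρ, hgP] using e
  obtain ⟨χ, hχ⟩ := exists_algHom_of_sub_mem_spectrum (A := polydiscAlgebra n) (lam := g)
    (by rw [← map_zero ρ, hgP, h0]) fun x y => by
      obtain ⟨z, e⟩ := hall x y
      rw [e]
      exact AlgHom.apply_mem_spectrum
        ((ContinuousMap.evalAlgHom ℂ ℂ z).comp (polydiscAlgebra n).val) (x - y)
  refine ⟨fun i => lam (MvPolynomial.X i), fun i => ?_, fun P => ?_⟩
  · obtain ⟨z, hz, e⟩ := h (MvPolynomial.X i) 0
    rw [h0, sub_zero, sub_zero, MvPolynomial.eval_X] at e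
    exact (congrArg norm e).trans_lt (hz i)
  · rw [← hgP P, ← hχ, ← MvPolynomial.aeval_eq_eval]
    change (χ.comp ρ) P = _
    congr 1
    ext i
    simp [hχ, hgP]

end PointEvaluation

/-! ### Polynomial approximation on polydiscs -/

section PolynomialApproximation

theorem mem_polydisc_iff_norm_lt {n : ℕ} {z : Fin n → ℂ} : z ∈ polydisc n ↔ ‖z‖ < 1 :=
  (pi_norm_lt_iff one_pos).symm

theorem exists_eval_eq_multilinear_diagonal {n k : ℕ}
    (q : ContinuousMultilinearMap ℂ (fun _ : Fin k => Fin n → ℂ) ℂ) :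
    ∃ Q : MvPolynomial (Fin n) ℂ, ∀ z, MvPolynomial.eval z Q = q fun _ => z := by
  refine ⟨∑ r : Fin k → Fin n, MvPolynomial.C (q fun j => Pi.single (r j) 1) *
    ∏ j, MvPolynomial.X (r j), fun z => ?_⟩
  have hz : z = ∑ i, z i • (Pi.single i 1 : Fin n → ℂ) := pi_eq_sum_univ' z
  conv_rhs => rw [hz]
  have h := q.toMultilinearMap.map_sum (fun _ i => z i • (Pi.single i 1 : Fin n → ℂ))
  refine Eq.trans ?_ h.symm
  rw [map_sum]
  refine Finset.sum_congr rfl fun r _ => ?_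
  rw [MultilinearMap.map_smul_univ, map_mul, map_prod, MvPolynomial.eval_C, smul_eq_mul, mul_comm]
  simp

theorem norm_cauchyPowerSeries_le_of_forall_norm_le {g : ℂ → ℂ} {s M : ℝ} (hs : 0 < s)
    (hM : ∀ z, ‖z‖ ≤ s → ‖g z‖ ≤ M) (k : ℕ) :
    ‖cauchyPowerSeries g 0 s k‖ ≤ M * s⁻¹ ^ k := by
  refine (norm_cauchyPowerSeries_le g 0 s k).trans ?_
  rw [abs_of_pos hs]
  refine mul_le_mul_of_nonneg_right ?_ (by positivity)
  have h1 : ‖∫ θ : ℝ in (0 : ℝ)..2 * Real.pi, ‖g (circleMap 0 s θ)‖‖ ≤ M * |2 * Real.pi - 0| := by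
    refine intervalIntegral.norm_integral_le_of_norm_le_const fun θ _ => ?_
    rw [norm_norm]
    refine hM _ ?_
    rw [circleMap_zero, norm_mul, Complex.norm_real, Complex.norm_exp_ofReal_mul_I, mul_one,
      Real.norm_of_nonneg hs.le]
  rw [sub_zero, abs_of_pos Real.two_pi_pos] at h1
  have h2 := (le_abs_self _).trans h1
  rw [inv_mul_le_iff₀ Real.two_pi_pos]
  linarith

theorem exists_polynomial_norm_sub_le {n : ℕ} {f : (Fin n → ℂ) → ℂ}
    (hf : AnalyticOnNhd ℂ f (polydisc n)) {ρ : ℝ} (hρ0 : 0 < ρ) (hρ : ρ < 1) {ε : ℝ} (hε : 0 < ε) :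
    ∃ P : MvPolynomial (Fin n) ℂ, ∀ z, ‖z‖ ≤ ρ → ‖f z - MvPolynomial.eval z P‖ ≤ ε := by
  obtain ⟨s, hs1, hsρ⟩ : ∃ s : ℝ, 1 < s ∧ s * ρ < 1 := by
    refine ⟨(1 + ρ⁻¹) / 2, ?_, ?_⟩
    · have := (one_lt_inv₀ hρ0).2 hρ
      linarith
    · have : ρ⁻¹ * ρ = 1 := inv_mul_cancel₀ hρ0.ne'
      nlinarith
  have hs0 : 0 < s := one_pos.trans hs1
  obtain ⟨M, hM⟩ := (isCompact_closedBall (0 : Fin n → ℂ) (s * ρ)).exists_bound_of_continuousOn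
    (hf.continuousOn.mono fun z hz => mem_polydisc_iff_norm_lt.2
      ((mem_closedBall_zero_iff.1 hz).trans_lt hsρ))
  have hM0 : 0 ≤ M := (norm_nonneg _).trans (hM 0 (Metric.mem_closedBall_self (by positivity)))
  obtain ⟨p, hp⟩ := hf 0 (mem_polydisc_iff_norm_lt.2 (by simp))
  choose Q hQ using fun k => exists_eval_eq_multilinear_diagonal (p k)
  have hinv : s⁻¹ < 1 := inv_lt_one_of_one_lt₀ hs1
  have key : ∀ z : Fin n → ℂ, ‖z‖ ≤ ρ → ∀ N : ℕ,
      ‖(∑ k ∈ Finset.range N, MvPolynomial.eval z (Q k)) - f z‖ ≤ M * s⁻¹ ^ N / (1 - s⁻¹) := by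
    intro z hz N
    set g : ℂ → ℂ := fun c => f (c • z) with hg
    have hmem : ∀ c : ℂ, ‖c‖ ≤ s → ‖c • z‖ ≤ s * ρ := fun c hc => by
      rw [norm_smul]
      gcongr
    have hgM : ∀ c : ℂ, ‖c‖ ≤ s → ‖g c‖ ≤ M := fun c hc =>
      hM _ (mem_closedBall_zero_iff.2 (hmem c hc))
    have hgd : DifferentiableOn ℂ g (Metric.closedBall 0 s) := fun c hc => by
      have h1 : DifferentiableAt ℂ f (c • z) := (hf _ (mem_polydisc_iff_norm_lt.2
        ((hmem c (mem_closedBall_zero_iff.1 hc)).trans_lt hsρ))).differentiableAt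
      have h2 : DifferentiableAt ℂ (fun c : ℂ => c • z) c := by fun_prop
      exact (h1.comp c h2).differentiableWithinAt
    have hps := hgd.hasFPowerSeriesOnBall (R := ⟨s, hs0.le⟩) (NNReal.coe_pos.1 hs0)
    have hp2 : HasFPowerSeriesAt g
        (p.compContinuousLinearMap ((ContinuousLinearMap.id ℂ ℂ).smulRight z)) 0 := by
      have hp' : HasFPowerSeriesAt f p (((ContinuousLinearMap.id ℂ ℂ).smulRight z) 0) := by
        simpa using hp
      obtain ⟨r, hr⟩ := hp'
      exact ⟨_, hr.compContinuousLinearMap⟩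
    have heq := hps.hasFPowerSeriesAt.eq_formalMultilinearSeries hp2
    have hcoef : ∀ k, cauchyPowerSeries g 0 s k (fun _ => 1) = MvPolynomial.eval z (Q k) := by
      intro k
      have h1 : cauchyPowerSeries g 0 s = _ := heq
      rw [h1, hQ, FormalMultilinearSeries.compContinuousLinearMap_apply]
      congr 1
      funext j
      simp
    have hsum := hps.hasSum (y := 1) (by
      rw [Metric.mem_eball, edist_zero_right, enorm_one]
      exact ENNReal.one_lt_coe_iff.2 (NNReal.coe_lt_coe.1 hs1))
    have hg1 : g (0 + 1) = f z := by simp [hg]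
    rw [hg1] at hsum
    refine norm_sub_le_of_geometric_bound_of_hasSum hinv (fun k => ?_)
      (hsum.congr_fun fun k => (hcoef k).symm) N
    rw [← hcoef k]
    refine (ContinuousMultilinearMap.le_opNorm _ _).trans ?_
    simpa using norm_cauchyPowerSeries_le_of_forall_norm_le hs0 hgM k
  have hlim : Tendsto (fun N : ℕ => M * s⁻¹ ^ N / (1 - s⁻¹)) atTop (𝓝 0) := by
    have := ((tendsto_pow_atTop_nhds_zero_of_lt_one (inv_nonneg.2 hs0.le) hinv).const_mul
      M).div_const (1 - s⁻¹)
    simpa using this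
  obtain ⟨N, hN⟩ := (hlim.eventually (ge_mem_nhds hε)).exists
  refine ⟨∑ k ∈ Finset.range N, Q k, fun z hz => ?_⟩
  rw [norm_sub_rev, map_sum]
  exact (key z hz N).trans hN

end PolynomialApproximation

section CauchyFormula

theorem volume_unitAddCircle_eq_haar :
    (volume : Measure UnitAddCircle) = AddCircle.haarAddCircle := by
  rw [AddCircle.volume_eq_smul_haarAddCircle, ENNReal.ofReal_one, one_smul]

instance isProbabilityMeasure_volume_unitAddCircle :
    IsProbabilityMeasure (volume : Measure UnitAddCircle) :=
  ⟨UnitAddCircle.measure_univ⟩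

instance isProbabilityMeasure_volume_unitAddTorus (n : ℕ) :
    IsProbabilityMeasure (volume : Measure (UnitAddTorus (Fin n))) :=
  inferInstanceAs (IsProbabilityMeasure (Measure.pi fun _ : Fin n => (volume : Measure UnitAddCircle)))

theorem continuous_toCircle_coe : Continuous fun t : UnitAddCircle => (t.toCircle : ℂ) :=
  continuous_subtype_val.comp AddCircle.continuous_toCircle

theorem fourier_natCast_eq (j : ℕ) (t : UnitAddCircle) :
    fourier (j : ℤ) t = (t.toCircle : ℂ) ^ j := by
  rw [fourier_apply, natCast_zsmul, AddCircle.toCircle_nsmul, Circle.coe_pow]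

theorem integral_fourier_unitAddCircle (n : ℤ) :
    ∫ t : UnitAddCircle, fourier n t = if n = 0 then 1 else 0 := by
  have h := congrFun (fourierCoeff_fourier (T := 1) n) 0
  rw [fourierCoeff, volume_unitAddCircle_eq_haar.symm] at h
  simpa [Pi.single_apply, eq_comm] using h

theorem norm_toCircle_coe (t : UnitAddCircle) : ‖(t.toCircle : ℂ)‖ = 1 := Circle.norm_coe _

/-- The Cauchy kernel of the disc in the boundary parameter. -/
noncomputable def cauchyKernel (w : ℂ) (t : UnitAddCircle) : ℂ :=
  (1 - w * starRingEnd ℂ (t.toCircle : ℂ))⁻¹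

theorem norm_mul_conj_toCircle (w : ℂ) (t : UnitAddCircle) :
    ‖w * starRingEnd ℂ (t.toCircle : ℂ)‖ = ‖w‖ := by
  rw [norm_mul, RCLike.norm_conj, norm_toCircle_coe, mul_one]

theorem continuous_cauchyKernel {w : ℂ} (hw : ‖w‖ < 1) : Continuous (cauchyKernel w) := by
  have := continuous_toCircle_coe
  have h2 : Continuous (starRingEnd ℂ) := Complex.continuous_conj
  refine Continuous.inv₀ (by fun_prop) fun t h => ?_
  have h1 : w * starRingEnd ℂ (t.toCircle : ℂ) = 1 := (sub_eq_zero.1 h).symm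
  have := norm_mul_conj_toCircle w t
  rw [h1, norm_one] at this
  linarith

theorem integral_pow_mul_cauchyKernel {w : ℂ} (hw : ‖w‖ < 1) (j : ℕ) :
    ∫ t : UnitAddCircle, (t.toCircle : ℂ) ^ j * cauchyKernel w t = w ^ j := by
  have hterm : ∀ (k : ℕ) (t : UnitAddCircle), (t.toCircle : ℂ) ^ j *
      (w * starRingEnd ℂ (t.toCircle : ℂ)) ^ k = w ^ k * fourier ((j : ℤ) - k) t := fun k t => by
    rw [sub_eq_add_neg, fourier_add, fourier_neg, fourier_natCast_eq, fourier_natCast_eq, map_pow]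
    ring
  have hs : ∀ t : UnitAddCircle, HasSum (fun k : ℕ => w ^ k * fourier ((j : ℤ) - k) t)
      ((t.toCircle : ℂ) ^ j * cauchyKernel w t) := fun t => by
    have h := (hasSum_geometric_of_norm_lt_one (ξ := w * starRingEnd ℂ (t.toCircle : ℂ))
      (by rwa [norm_mul_conj_toCircle])).mul_left ((t.toCircle : ℂ) ^ j)
    exact h.congr_fun fun k => (hterm k t).symm
  have hnorm : ∀ (k : ℕ) (t : UnitAddCircle), ‖w ^ k * fourier ((j : ℤ) - k) t‖ = ‖w‖ ^ k :=
    fun k t => by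
      rw [norm_mul, norm_pow, fourier_apply, Circle.norm_coe, mul_one]
  have hsum := hasSum_integral_of_summable_integral_norm (μ := (volume : Measure UnitAddCircle))
    (F := fun (k : ℕ) (t : UnitAddCircle) => w ^ k * fourier ((j : ℤ) - k) t)
    (fun k => (continuous_const.mul (map_continuous _)).integrable_of_hasCompactSupport
      (HasCompactSupport.of_compactSpace _))
    (by
      simp only [hnorm, integral_const, probReal_univ, one_smul]
      exact summable_geometric_of_lt_one (norm_nonneg w) hw)
  have h1 : ∀ k : ℕ, ∫ t : UnitAddCircle, w ^ k * fourier ((j : ℤ) - k) t =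
      if k = j then w ^ j else 0 := fun k => by
    rw [integral_const_mul, integral_fourier_unitAddCircle]
    by_cases h : k = j
    · simp [h]
    · have : (j : ℤ) - k ≠ 0 := by omega
      simp [h, this]
  simp only [h1] at hsum
  have h2 := (hasSum_ite_eq j (w ^ j)).unique hsum
  rw [h2]
  exact integral_congr_ae (Filter.Eventually.of_forall fun t => (hs t).tsum_eq.symm)

/-- The Cauchy kernel of the polydisc in the boundary parameter. -/
noncomputable def polydiscKernel {n : ℕ} (w : Fin n → ℂ) (θ : UnitAddTorus (Fin n)) : ℂ :=
  ∏ i, cauchyKernel (w i) (θ i)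

theorem continuous_polydiscKernel {n : ℕ} {w : Fin n → ℂ} (hw : w ∈ polydisc n) :
    Continuous (polydiscKernel w) :=
  continuous_finsetProd _ fun i _ => (continuous_cauchyKernel (hw i)).comp (continuous_apply i)

theorem continuous_torusPoint (n : ℕ) (r : ℝ) : Continuous (torusPoint n r) :=
  continuous_pi fun i => continuous_const.mul (continuous_toCircle_coe.comp (continuous_apply i))

theorem norm_torusPoint_le (n : ℕ) {r : ℝ} (hr : 0 ≤ r) (θ : UnitAddTorus (Fin n)) :
    ‖torusPoint n r θ‖ ≤ r :=
  (pi_norm_le_iff_of_nonneg hr).2 fun i => by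
    rw [torusPoint, norm_mul, Circle.norm_coe, mul_one, Complex.norm_real, Real.norm_of_nonneg hr]

theorem integrable_of_continuous_unitAddTorus {n : ℕ} {g : UnitAddTorus (Fin n) → ℂ}
    (hg : Continuous g) : Integrable g volume :=
  hg.integrable_of_hasCompactSupport (HasCompactSupport.of_compactSpace _)

theorem continuous_comp_torusPoint {n : ℕ} {f : (Fin n → ℂ) → ℂ}
    (hf : ContinuousOn f (polydisc n)) {r : ℝ} (hr : r ∈ Ico (0 : ℝ) 1) :
    Continuous fun θ => f (torusPoint n r θ) :=
  hf.comp_continuous (continuous_torusPoint n r) (torusPoint_mem n hr)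

theorem integral_polynomial_mul_polydiscKernel {n : ℕ} (P : MvPolynomial (Fin n) ℂ) (r : ℝ)
    {w : Fin n → ℂ} (hw : w ∈ polydisc n) :
    ∫ θ, MvPolynomial.eval (torusPoint n r θ) P * polydiscKernel w θ =
      MvPolynomial.eval ((r : ℂ) • w) P := by
  have hk := continuous_polydiscKernel hw
  have hint : ∀ P : MvPolynomial (Fin n) ℂ,
      Integrable fun θ => MvPolynomial.eval (torusPoint n r θ) P * polydiscKernel w θ := fun P =>
    integrable_of_continuous_unitAddTorus
      (((MvPolynomial.continuous_eval P).comp (continuous_torusPoint n r)).mul hk)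
  induction P using MvPolynomial.induction_on' with
  | monomial u a =>
    have h1 : ∀ θ : UnitAddTorus (Fin n),
        MvPolynomial.eval (torusPoint n r θ) (MvPolynomial.monomial u a) * polydiscKernel w θ =
        a * ∏ i, ((r : ℂ) ^ u i * (((θ i).toCircle : ℂ) ^ u i * cauchyKernel (w i) (θ i))) :=
      fun θ => by
        rw [MvPolynomial.eval_monomial, Finsupp.prod_fintype _ _ (by simp), polydiscKernel,
          mul_assoc, ← Finset.prod_mul_distrib]
        congr 1
        refine Finset.prod_congr rfl fun i _ => ?_
        rw [torusPoint]; ring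
    simp only [h1]
    rw [integral_const_mul]
    have h2 := integral_fintype_prod_eq_prod (μ := fun _ : Fin n => (volume : Measure UnitAddCircle))
      (fun (i : Fin n) (t : UnitAddCircle) =>
        (r : ℂ) ^ u i * ((t.toCircle : ℂ) ^ u i * cauchyKernel (w i) t))
    rw [volume_pi, h2, MvPolynomial.eval_monomial, Finsupp.prod_fintype _ _ (by simp)]
    congr 1
    refine Finset.prod_congr rfl fun i _ => ?_
    rw [integral_const_mul, integral_pow_mul_cauchyKernel (hw i), Pi.smul_apply, smul_eq_mul,
      mul_pow]
  | add p q hp hq =>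
    simp only [map_add, add_mul]
    rw [integral_add (hint p) (hint q), hp, hq]

theorem integral_mul_polydiscKernel {n : ℕ} {f : (Fin n → ℂ) → ℂ}
    (hf : AnalyticOnNhd ℂ f (polydisc n)) {r : ℝ} (hr : r ∈ Ico (0 : ℝ) 1)
    {w : Fin n → ℂ} (hw : w ∈ polydisc n) :
    ∫ θ, f (torusPoint n r θ) * polydiscKernel w θ = f ((r : ℂ) • w) := by
  have hk := continuous_polydiscKernel hw
  obtain ⟨B, hB⟩ := isCompact_univ.exists_bound_of_continuousOn hk.continuousOn
  have hB0 : 0 ≤ B := (norm_nonneg _).trans (hB 0 (mem_univ _))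
  have hfc : Continuous fun θ => f (torusPoint n r θ) * polydiscKernel w θ :=
    (continuous_comp_torusPoint hf.continuousOn hr).mul hk
  obtain ⟨ρ, hrρ, hρ⟩ := exists_between hr.2
  rw [← sub_eq_zero, ← norm_le_zero_iff]
  refine le_of_forall_pos_le_add fun η hη => ?_
  obtain ⟨P, hP⟩ := exists_polynomial_norm_sub_le hf (hr.1.trans_lt hrρ) hρ
    (ε := η / (B + 1)) (by positivity)
  have hPc : Continuous fun θ =>
      MvPolynomial.eval (torusPoint n r θ) P * polydiscKernel w θ := ((MvPolynomial.continuous_eval P).comp (continuous_torusPoint n r)).mul hk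
  have h1 := integral_polynomial_mul_polydiscKernel P r hw
  have h2 : (∫ θ, f (torusPoint n r θ) * polydiscKernel w θ) - f ((r : ℂ) • w) =
      (∫ θ, (f (torusPoint n r θ) - MvPolynomial.eval (torusPoint n r θ) P) * polydiscKernel w θ) -
      (f ((r : ℂ) • w) - MvPolynomial.eval ((r : ℂ) • w) P) := by
    rw [← h1]
    simp only [sub_mul]
    rw [integral_sub (integrable_of_continuous_unitAddTorus hfc)
      (integrable_of_continuous_unitAddTorus hPc)]
    ring
  rw [h2, zero_add]
  refine (norm_sub_le _ _).trans ?_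
  have h3 : ‖∫ θ, (f (torusPoint n r θ) - MvPolynomial.eval (torusPoint n r θ) P) *
      polydiscKernel w θ‖ ≤ η / (B + 1) * B := by
    have := norm_integral_le_of_norm_le_const (μ := (volume : Measure (UnitAddTorus (Fin n))))
      (f := fun θ => (f (torusPoint n r θ) - MvPolynomial.eval (torusPoint n r θ) P) *
        polydiscKernel w θ) (C := η / (B + 1) * B) (Filter.Eventually.of_forall fun θ => by
        rw [norm_mul]
        exact mul_le_mul (hP _ ((norm_torusPoint_le n hr.1 θ).trans hrρ.le)) (hB θ (mem_univ _))
          (norm_nonneg _) (by positivity))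
    simpa using this
  have h4 : ‖f ((r : ℂ) • w) - MvPolynomial.eval ((r : ℂ) • w) P‖ ≤ η / (B + 1) := by
    refine hP _ ?_
    rw [norm_smul, Complex.norm_real, Real.norm_of_nonneg hr.1]
    have := (mem_polydisc_iff_norm_lt.1 hw).le
    nlinarith [hr.1, norm_nonneg w]
  calc _ ≤ η / (B + 1) * B + η / (B + 1) := add_le_add h3 h4
    _ = η := by field_simp

end CauchyFormula

/-! ### Square-summable power series on the disc -/

section SquareSummable

theorem orthonormal_fourierLp_nat :
    Orthonormal ℂ fun k : ℕ => fourierLp (T := 1) 2 (k : ℤ) :=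
  (orthonormal_fourier (T := 1)).comp _ Nat.cast_injective

/-- The boundary function of a power series with square-summable coefficients. -/
noncomputable def boundaryValue : lp (fun _ : ℕ => ℂ) 2 →ₗᵢ[ℂ]
    Lp ℂ 2 (AddCircle.haarAddCircle (T := 1)) :=
  orthonormal_fourierLp_nat.orthogonalFamily.linearIsometry

theorem boundaryValue_coeFn_of_summable (c : lp (fun _ : ℕ => ℂ) 2)
    (hc : Summable fun k => ‖c k‖) :
    boundaryValue c =ᵐ[volume] fun t : UnitAddCircle => ∑' k, c k * (t.toCircle : ℂ) ^ k := by
  rw [volume_unitAddCircle_eq_haar]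
  have h1 : Summable fun k : ℕ => c k • (fourier (k : ℤ) : C(AddCircle (1 : ℝ), ℂ)) := by
    refine Summable.of_norm ?_
    simp only [norm_smul, fourier_norm, mul_one]
    exact hc
  have h2 := h1.hasSum.map (ContinuousMap.toLp 2 (AddCircle.haarAddCircle (T := 1)) ℂ)
    (ContinuousLinearMap.continuous _)
  have h3 := orthonormal_fourierLp_nat.orthogonalFamily.hasSum_linearIsometry c
  have h4 : boundaryValue c = ContinuousMap.toLp 2 (AddCircle.haarAddCircle (T := 1)) ℂ
      (∑' k : ℕ, c k • (fourier (k : ℤ) : C(AddCircle (1 : ℝ), ℂ))) := by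
    refine h3.unique (h2.congr_fun fun k => ?_)
    rw [Function.comp_apply, map_smul]
    rfl
  rw [h4]
  filter_upwards [ContinuousMap.coeFn_toLp (p := 2) (𝕜 := ℂ) (AddCircle.haarAddCircle (T := 1))
    (∑' k : ℕ, c k • (fourier (k : ℤ) : C(AddCircle (1 : ℝ), ℂ)))] with t ht
  rw [ht]
  have h5 := h1.hasSum.map (ContinuousMap.evalCLM ℂ t) (ContinuousLinearMap.continuous _)
  refine (h5.tsum_eq.symm.trans (tsum_congr fun k => ?_))
  rw [Function.comp_apply, map_smul, smul_eq_mul, ContinuousMap.evalCLM_apply, fourier_natCast_eq]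

theorem lintegral_enorm_sq_Lp (f : Lp ℂ 2 (AddCircle.haarAddCircle (T := 1))) :
    ∫⁻ t : UnitAddCircle, ‖f t‖ₑ ^ (2 : ℝ) = ‖f‖ₑ ^ (2 : ℝ) := by
  rw [volume_unitAddCircle_eq_haar, Lp.enorm_def, eLpNorm_eq_lintegral_rpow_enorm_toReal two_ne_zero
    ENNReal.ofNat_ne_top]
  rw [← ENNReal.rpow_mul]
  simp

theorem lintegral_boundaryValue (c : lp (fun _ : ℕ => ℂ) 2) :
    ∫⁻ t : UnitAddCircle, ‖boundaryValue c t‖ₑ ^ (2 : ℝ) = ‖c‖ₑ ^ (2 : ℝ) := by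
  rw [lintegral_enorm_sq_Lp, boundaryValue.enorm_map]

theorem lintegral_boundaryValue_sub (c d : lp (fun _ : ℕ => ℂ) 2) :
    ∫⁻ t : UnitAddCircle, ‖boundaryValue c t - boundaryValue d t‖ₑ ^ (2 : ℝ) =
      ‖c - d‖ₑ ^ (2 : ℝ) := by
  rw [← lintegral_boundaryValue, map_sub]
  refine lintegral_congr_ae ?_
  rw [volume_unitAddCircle_eq_haar]
  filter_upwards [Lp.coeFn_sub (boundaryValue c) (boundaryValue d)] with t ht
  rw [ht, Pi.sub_apply]

/-- The coefficients of the dilated power series. -/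
noncomputable def dilate (c : lp (fun _ : ℕ => ℂ) 2) (r : Icc (0 : ℝ) 1) :
    lp (fun _ : ℕ => ℂ) 2 :=
  ⟨fun k => ((r : ℝ) : ℂ) ^ k * c k, (lp.memℓp c).mono' fun k => by
    rw [norm_mul, norm_pow, Complex.norm_real, Real.norm_of_nonneg r.2.1]
    exact mul_le_of_le_one_left (norm_nonneg _) (pow_le_one₀ r.2.1 r.2.2)⟩

theorem dilate_apply (c : lp (fun _ : ℕ => ℂ) 2) (r : Icc (0 : ℝ) 1) (k : ℕ) :
    dilate c r k = ((r : ℝ) : ℂ) ^ k * c k := rfl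

theorem norm_dilate_le (c : lp (fun _ : ℕ => ℂ) 2) (r : Icc (0 : ℝ) 1) : ‖dilate c r‖ ≤ ‖c‖ :=
  lp.norm_mono (by norm_num) fun k => by
    rw [dilate_apply, norm_mul, norm_pow, Complex.norm_real, Real.norm_of_nonneg r.2.1]
    exact mul_le_of_le_one_left (norm_nonneg _) (pow_le_one₀ r.2.1 r.2.2)

theorem two_toReal_pos : 0 < (2 : ℝ≥0∞).toReal := by norm_num

theorem tendsto_dilate (c : lp (fun _ : ℕ => ℂ) 2) {ι : Type*} {l : Filter ι}
    {r : ι → Icc (0 : ℝ) 1} (hr : Tendsto (fun i => (r i : ℝ)) l (𝓝 1)) :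
    Tendsto (fun i => dilate c (r i)) l (𝓝 c) := by
  rw [tendsto_iff_norm_sub_tendsto_zero]
  have hsum := (lp.memℓp c).summable two_toReal_pos
  have hle : ∀ i k, ‖(1 - ((r i : ℝ) : ℂ) ^ k) * c k‖ ≤ ‖c k‖ := fun i k => by
    rw [norm_mul]
    refine mul_le_of_le_one_left (norm_nonneg _) ?_
    rw [← Complex.ofReal_pow, ← Complex.ofReal_one, ← Complex.ofReal_sub, Complex.norm_real,
      Real.norm_eq_abs, abs_le]
    have h1 := pow_nonneg (r i).2.1 k
    have h2 := pow_le_one₀ (n := k) (r i).2.1 (r i).2.2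
    constructor <;> linarith
  have h1 : Tendsto (fun i => ∑' k, ‖(1 - ((r i : ℝ) : ℂ) ^ k) * c k‖ ^ (2 : ℝ≥0∞).toReal) l
      (𝓝 (∑' k : ℕ, (0 : ℝ))) := by
    refine tendsto_tsum_of_dominated_convergence hsum (fun k => ?_)
      (Filter.Eventually.of_forall fun i k => ?_)
    · have h2 : Tendsto (fun i => ‖(1 - ((r i : ℝ) : ℂ) ^ k) * c k‖) l
          (𝓝 ‖(1 - ((1 : ℝ) : ℂ) ^ k) * c k‖) := by
        have : Tendsto (fun i => ((r i : ℝ) : ℂ)) l (𝓝 ((1 : ℝ) : ℂ)) :=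
          (Complex.continuous_ofReal.tendsto 1).comp hr
        exact ((tendsto_const_nhds.sub (this.pow k)).mul_const _).norm
      rw [Complex.ofReal_one, one_pow, sub_self, zero_mul, norm_zero] at h2
      have h3 := h2.rpow_const (p := (2 : ℝ≥0∞).toReal) (Or.inr two_toReal_pos.le)
      rwa [Real.zero_rpow two_toReal_pos.ne'] at h3
    · rw [Real.norm_of_nonneg (by positivity)]
      exact Real.rpow_le_rpow (norm_nonneg _) (hle i k) two_toReal_pos.le
  rw [tsum_zero] at h1
  have h2 : ∀ i, ‖dilate c (r i) - c‖ =
      (∑' k, ‖(1 - ((r i : ℝ) : ℂ) ^ k) * c k‖ ^ (2 : ℝ≥0∞).toReal) ^ (1 / (2 : ℝ≥0∞).toReal) :=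
    fun i => by
      rw [norm_sub_rev, lp.norm_eq_tsum_rpow two_toReal_pos]
      congr 1
      refine tsum_congr fun k => ?_
      rw [lp.coeFn_sub, Pi.sub_apply, dilate_apply, sub_mul, one_mul]
  simp only [h2]
  have h3 := h1.rpow_const (p := 1 / (2 : ℝ≥0∞).toReal) (Or.inr (by positivity))
  rwa [Real.zero_rpow (by norm_num)] at h3

theorem norm_lp_apply_le (c : lp (fun _ : ℕ => ℂ) 2) (k : ℕ) : ‖c k‖ ≤ ‖c‖ :=
  lp.norm_apply_le_norm two_ne_zero c k

theorem summable_norm_mul_pow (c : lp (fun _ : ℕ => ℂ) 2) {r : ℝ} (hr0 : 0 ≤ r) (hr : r < 1) :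
    Summable fun k => ‖c k‖ * r ^ k :=
  Summable.of_nonneg_of_le (fun k => by positivity)
    (fun k => mul_le_mul_of_nonneg_right (norm_lp_apply_le c k) (by positivity))
    ((summable_geometric_of_lt_one hr0 hr).mul_left ‖c‖)

/-- The sum of the power series with coefficients `c`. -/
noncomputable def powerSum (c : lp (fun _ : ℕ => ℂ) 2) (z : ℂ) : ℂ := ∑' k, c k * z ^ k

theorem boundaryValue_dilate (c : lp (fun _ : ℕ => ℂ) 2) (r : Icc (0 : ℝ) 1) (hr : (r : ℝ) < 1) :
    boundaryValue (dilate c r) =ᵐ[volume]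
      fun t : UnitAddCircle => powerSum c ((r : ℝ) * (t.toCircle : ℂ)) := by
  have h : Summable fun k => ‖dilate c r k‖ := by
    refine (summable_norm_mul_pow c r.2.1 hr).congr fun k => ?_
    rw [dilate_apply, norm_mul, norm_pow, Complex.norm_real, Real.norm_of_nonneg r.2.1, mul_comm]
  refine (boundaryValue_coeFn_of_summable _ h).trans (Filter.Eventually.of_forall fun t => ?_)
  refine tsum_congr fun k => ?_
  rw [dilate_apply, mul_pow]
  ring

/-- The Taylor coefficients of a function holomorphic on a neighbourhood of the closed disc. -/
theorem exists_coeff_of_differentiableOn {h : ℂ → ℂ} {R : ℝ} (hR : 1 < R)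
    (hd : DifferentiableOn ℂ h (Metric.ball 0 R)) :
    ∃ c : lp (fun _ : ℕ => ℂ) 2, (∀ z, ‖z‖ ≤ 1 → h z = powerSum c z) ∧
      ∫⁻ t : UnitAddCircle, ‖h (t.toCircle : ℂ)‖ₑ ^ (2 : ℝ) = ‖c‖ₑ ^ (2 : ℝ) := by
  obtain ⟨s, hs1, hsR⟩ := exists_between hR
  have hs0 : 0 < s := one_pos.trans hs1
  have hsub : Metric.closedBall (0 : ℂ) s ⊆ Metric.ball 0 R := Metric.closedBall_subset_ball hsR
  obtain ⟨M, hM⟩ := (isCompact_closedBall (0 : ℂ) s).exists_bound_of_continuousOn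
    (hd.continuousOn.mono hsub)
  have hps := (hd.mono hsub).hasFPowerSeriesOnBall (R := ⟨s, hs0.le⟩) (NNReal.coe_pos.1 hs0)
  let c : ℕ → ℂ := fun k => cauchyPowerSeries h 0 s k fun _ => 1
  have hc : ∀ k, ‖c k‖ ≤ M * s⁻¹ ^ k := fun k => by
    refine (ContinuousMultilinearMap.le_opNorm _ _).trans ?_
    simpa using norm_cauchyPowerSeries_le_of_forall_norm_le hs0
      (fun z hz => hM z (mem_closedBall_zero_iff.2 hz)) k
  have hsum : Summable fun k => ‖c k‖ :=
    Summable.of_nonneg_of_le (fun k => norm_nonneg _) hc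
      ((summable_geometric_of_lt_one (inv_nonneg.2 hs0.le) (inv_lt_one_of_one_lt₀ hs1)).mul_left M)
  have hmem1 : Memℓp c 1 := memℓp_gen (by simpa using hsum)
  have hmem : Memℓp c 2 := hmem1.of_exponent_ge (by norm_num)
  have hval : ∀ z, ‖z‖ ≤ 1 → h z = powerSum ⟨c, hmem⟩ z := fun z hz => by
    have h1 := hps.hasSum (y := z) (by
      rw [Metric.mem_eball, edist_zero_right]
      exact (ENNReal.coe_lt_coe (r := ‖z‖₊) (q := (⟨s, hs0.le⟩ : NNReal))).2
        (NNReal.coe_lt_coe.1 (hz.trans_lt hs1)))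
    rw [zero_add] at h1
    rw [← h1.tsum_eq]
    refine tsum_congr fun k => ?_
    rw [FormalMultilinearSeries.apply_eq_pow_smul_coeff, smul_eq_mul, mul_comm]
    rfl
  refine ⟨⟨c, hmem⟩, hval, ?_⟩
  rw [← lintegral_boundaryValue]
  refine lintegral_congr_ae ?_
  filter_upwards [boundaryValue_coeFn_of_summable ⟨c, hmem⟩ hsum] with t ht
  rw [ht, hval _ (norm_toCircle_coe t).le]
  rfl

/-- Functions bounded in mean square have a limit along every ultrafilter. -/
theorem exists_tendsto_powerSum {ι : Type*} (U : Ultrafilter ι) {h : ι → ℂ → ℂ} {R : ι → ℝ}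
    (hR : ∀ i, 1 < R i) (hd : ∀ i, DifferentiableOn ℂ (h i) (Metric.ball 0 (R i))) {B : ℝ}
    (hB0 : 0 ≤ B)
    (hB : ∀ i, ∫⁻ t : UnitAddCircle, ‖h i (t.toCircle : ℂ)‖ₑ ^ (2 : ℝ) ≤ ENNReal.ofReal (B ^ 2)) :
    ∃ c : lp (fun _ : ℕ => ℂ) 2, ∀ z, ‖z‖ < 1 →
      Tendsto (fun i => h i z) U (𝓝 (powerSum c z)) := by
  choose c hcz hc using fun i => exists_coeff_of_differentiableOn (hR i) (hd i)
  have hcB : ∀ i, ‖c i‖ ≤ B := fun i => by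
    have := hB i
    rw [hc i, ENNReal.rpow_ofNat, ← ofReal_norm, ← ENNReal.ofReal_pow (norm_nonneg _),
      ENNReal.ofReal_le_ofReal_iff (by positivity)] at this
    exact (pow_le_pow_iff_left₀ (norm_nonneg _) hB0 two_ne_zero).1 this
  have hlim : ∀ k : ℕ, ∃ a : ℂ, Tendsto (fun i => c i k) U (𝓝 a) := fun k => by
    obtain ⟨a, -, ha⟩ := (isCompact_closedBall (0 : ℂ) B).ultrafilter_le_nhds (U.map fun i => c i k)
      (le_principal_iff.2 (Filter.Eventually.of_forall (f := (U : Filter ι)) fun i =>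
        mem_closedBall_zero_iff.2 ((norm_lp_apply_le (c i) k).trans (hcB i))))
    exact ⟨a, ha⟩
  choose a ha using hlim
  have hmem : Memℓp a 2 := lp.memℓp_of_tendsto (l := (U : Filter ι)) (F := c)
    ((Metric.isBounded_closedBall (x := 0) (r := B)).subset (by
      rintro _ ⟨i, rfl⟩
      exact mem_closedBall_zero_iff.2 (hcB i))) (tendsto_pi_nhds.2 ha)
  refine ⟨⟨a, hmem⟩, fun z hz => ?_⟩
  simp only [fun i => hcz i z hz.le]
  refine tendsto_tsum_of_dominated_convergence
    ((summable_geometric_of_lt_one (norm_nonneg z) hz).mul_left B)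
    (fun k => (ha k).mul_const _) (Filter.Eventually.of_forall fun i k => ?_)
  rw [norm_mul, norm_pow]
  exact mul_le_mul_of_nonneg_right ((norm_lp_apply_le (c i) k).trans (hcB i)) (by positivity)

end SquareSummable

/-! ### Outer majorants on the disc -/

section OuterMajorant

theorem exists_polynomial_re_approx (φ : C(UnitAddCircle, ℝ)) {δ : ℝ} (hδ : 0 < δ) :
    ∃ Q : Polynomial ℂ, ∀ t : UnitAddCircle, |(Q.eval (t.toCircle : ℂ)).re - φ t| ≤ δ := by
  let Φ : C(AddCircle (1 : ℝ), ℂ) := ⟨fun t => (φ t : ℂ), by fun_prop⟩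
  have hΦ : Φ ∈ closure (Submodule.span ℂ (range (@fourier 1)) : Set C(AddCircle (1 : ℝ), ℂ)) := by
    rw [← Submodule.topologicalClosure_coe, span_fourier_closure_eq_top]
    trivial
  obtain ⟨f, hf, hfΦ⟩ := Metric.mem_closure_iff.1 hΦ δ hδ
  have key : ∀ c : ℂ, ∃ Q : Polynomial ℂ, ∀ t : UnitAddCircle,
      (Q.eval (t.toCircle : ℂ)).re = (c * f t).re := by
    refine Submodule.span_induction (p := fun f _ => ∀ c : ℂ, ∃ Q : Polynomial ℂ,
      ∀ t : UnitAddCircle, (Q.eval (t.toCircle : ℂ)).re = (c * f t).re) ?_ ?_ ?_ ?_ hf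
    · rintro _ ⟨n, rfl⟩ c
      obtain ⟨k, rfl | rfl⟩ := n.eq_nat_or_neg
      · refine ⟨Polynomial.C c * Polynomial.X ^ k, fun t => ?_⟩
        rw [fourier_natCast_eq]
        simp
      · refine ⟨Polynomial.C (starRingEnd ℂ c) * Polynomial.X ^ k, fun t => ?_⟩
        rw [fourier_neg, fourier_natCast_eq, ← Complex.conj_re (c * _)]
        simp
    · exact fun c => ⟨0, fun t => by simp⟩
    · intro f g _ _ hf hg c
      obtain ⟨Q, hQ⟩ := hf c
      obtain ⟨R, hR⟩ := hg c
      refine ⟨Q + R, fun t => ?_⟩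
      rw [Polynomial.eval_add, Complex.add_re, hQ, hR, ContinuousMap.add_apply, mul_add,
        Complex.add_re]
    · intro a f _ hf c
      obtain ⟨Q, hQ⟩ := hf (c * a)
      refine ⟨Q, fun t => ?_⟩
      rw [hQ, ContinuousMap.smul_apply, smul_eq_mul, mul_assoc]
  obtain ⟨Q, hQ⟩ := key 1
  refine ⟨Q, fun t => ?_⟩
  rw [hQ, one_mul]
  have h1 : ‖f t - Φ t‖ ≤ δ := by
    rw [← dist_eq_norm, dist_comm]
    exact (ContinuousMap.dist_apply_le_dist t).trans hfΦ.le
  have h2 := (Complex.abs_re_le_norm _).trans h1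
  rwa [Complex.sub_re] at h2

theorem exists_toCircle_eq {z : ℂ} (hz : ‖z‖ = 1) : ∃ t : UnitAddCircle, (t.toCircle : ℂ) = z := by
  obtain ⟨t, ht⟩ := (AddCircle.homeomorphCircle (T := 1) one_ne_zero).surjective
    ⟨z, mem_sphere_zero_iff_norm.2 hz⟩
  refine ⟨t, ?_⟩
  rw [AddCircle.homeomorphCircle_apply] at ht
  rw [ht]

theorem differentiable_cexp_polynomial (Q : Polynomial ℂ) (a b : ℂ) :
    Differentiable ℂ fun z => Complex.exp (a * Q.eval z + b) :=
  ((Q.differentiable.const_mul a).add_const b).cexp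

/-- A function holomorphic near the closed disc has a zero-free majorant which on the circle is
only slightly larger. -/
theorem exists_outer_majorant {g : ℂ → ℂ} {R : ℝ} (hR : 1 < R)
    (hg : DifferentiableOn ℂ g (Metric.ball 0 R)) {δ : ℝ} (hδ : 0 < δ) :
    ∃ Q : Polynomial ℂ,
      (∀ z, ‖z‖ ≤ 1 → ‖g z * Complex.exp (-Q.eval z)‖ ≤ Real.exp δ) ∧
      ∀ t : UnitAddCircle, Real.exp (Q.eval (t.toCircle : ℂ)).re ≤
        Real.exp δ * (‖g (t.toCircle : ℂ)‖ + δ) := by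
  have hmem : ∀ z : ℂ, ‖z‖ ≤ 1 → z ∈ Metric.ball (0 : ℂ) R := fun z hz =>
    mem_ball_zero_iff.2 (hz.trans_lt hR)
  have hgc : Continuous fun t : UnitAddCircle => g (t.toCircle : ℂ) :=
    hg.continuousOn.comp_continuous continuous_toCircle_coe fun t =>
      hmem _ (norm_toCircle_coe t).le
  have hpos : ∀ t : UnitAddCircle, 0 < ‖g (t.toCircle : ℂ)‖ + δ := fun t => by positivity
  obtain ⟨Q, hQ⟩ := exists_polynomial_re_approx
    ⟨fun t => Real.log (‖g (t.toCircle : ℂ)‖ + δ),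
      (hgc.norm.add continuous_const).log fun t => (hpos t).ne'⟩ hδ
  refine ⟨Q, fun z hz => ?_, fun t => ?_⟩
  · refine Complex.norm_le_of_forall_mem_frontier_norm_le (U := Metric.ball 0 1)
      Metric.isBounded_ball (f := fun z => g z * Complex.exp (-Q.eval z)) ?_ ?_ ?_
    · refine DifferentiableOn.diffContOnCl (DifferentiableOn.mono (t := Metric.ball 0 R) ?_ ?_)
      · exact hg.mul Q.differentiable.neg.cexp.differentiableOn
      · rw [closure_ball _ one_ne_zero]
        exact fun z hz => hmem z (mem_closedBall_zero_iff.1 hz)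
    · intro z hz
      rw [frontier_ball _ one_ne_zero, mem_sphere_zero_iff_norm] at hz
      obtain ⟨t, rfl⟩ := exists_toCircle_eq hz
      have h1 := (abs_le.1 (hQ t)).1
      simp only [ContinuousMap.coe_mk] at h1
      rw [norm_mul, Complex.norm_exp, Complex.neg_re]
      calc ‖g (t.toCircle : ℂ)‖ * Real.exp (-(Q.eval (t.toCircle : ℂ)).re)
          ≤ (‖g (t.toCircle : ℂ)‖ + δ) * Real.exp (δ - Real.log (‖g (t.toCircle : ℂ)‖ + δ)) := by
            gcongr
            · linarith
            · linarith
        _ = Real.exp δ := by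
            rw [Real.exp_sub, Real.exp_log (hpos t)]
            field_simp
    · rw [closure_ball _ one_ne_zero]
      exact mem_closedBall_zero_iff.2 hz
  · have h1 := (abs_le.1 (hQ t)).2
    simp only [ContinuousMap.coe_mk] at h1
    calc Real.exp (Q.eval (t.toCircle : ℂ)).re
        ≤ Real.exp (δ + Real.log (‖g (t.toCircle : ℂ)‖ + δ)) := Real.exp_le_exp.2 (by linarith)
      _ = _ := by rw [Real.exp_add, Real.exp_log (hpos t)]

/-- The integral mean of order `p` over the circle of radius `r`. -/
noncomputable def circleMean (p : ℝ) (g : ℂ → ℂ) (r : ℝ) : ℝ≥0∞ :=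
  ∫⁻ t : UnitAddCircle, ‖g ((r : ℂ) * (t.toCircle : ℂ))‖ₑ ^ p

theorem continuous_comp_circle {g : ℂ → ℂ} (hg : DifferentiableOn ℂ g (Metric.ball 0 1)) {r : ℝ}
    (hr : r ∈ Ico (0 : ℝ) 1) : Continuous fun t : UnitAddCircle => g ((r : ℂ) * t.toCircle) :=
  hg.continuousOn.comp_continuous (continuous_const.mul continuous_toCircle_coe) fun t => by
    rw [mem_ball_zero_iff, norm_mul, norm_toCircle_coe, mul_one, Complex.norm_real,
      Real.norm_of_nonneg hr.1]
    exact hr.2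

theorem differentiableOn_comp_mul {g : ℂ → ℂ} (hg : DifferentiableOn ℂ g (Metric.ball 0 1)) {s : ℝ}
    (hs : 0 < s) : DifferentiableOn ℂ (fun z => g ((s : ℂ) * z)) (Metric.ball 0 s⁻¹) := by
  refine hg.comp (by fun_prop) fun z hz => ?_
  rw [mem_ball_zero_iff] at hz ⊢
  rw [norm_mul, Complex.norm_real, Real.norm_of_nonneg hs.le]
  have := mul_lt_mul_of_pos_left hz hs
  rwa [mul_inv_cancel₀ hs.ne'] at this

theorem enorm_eq_ofReal_exp (z : ℂ) : ‖Complex.exp z‖ₑ = ENNReal.ofReal (Real.exp z.re) := by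
  rw [← ofReal_norm, Complex.norm_exp]

theorem ofReal_exp_rpow (x p : ℝ) :
    ENNReal.ofReal (Real.exp x) ^ p = ENNReal.ofReal (Real.exp (x * p)) := by
  rw [ENNReal.ofReal_rpow_of_pos (Real.exp_pos x), Real.exp_mul]

/-- A square-summable majorant of `|g| ^ p` on the disc. -/
theorem exists_square_majorant {g : ℂ → ℂ} {R : ℝ} (hR : 1 < R)
    (hg : DifferentiableOn ℂ g (Metric.ball 0 R)) {p δ : ℝ} (hp : 0 < p) (hδ : 0 < δ) :
    ∃ Q : Polynomial ℂ,
      (∀ z, ‖z‖ ≤ 1 → ‖g z * Complex.exp (-Q.eval z)‖ ≤ Real.exp δ) ∧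
      (∀ z, ‖z‖ ≤ 1 → ‖g z‖ₑ ^ p ≤
        ‖Complex.exp ((p / 2 : ℝ) * Q.eval z + (p / 2 * δ : ℝ))‖ₑ ^ (2 : ℝ)) ∧
      ∀ t : UnitAddCircle,
        ‖Complex.exp ((p / 2 : ℝ) * Q.eval (t.toCircle : ℂ) + (p / 2 * δ : ℝ))‖ₑ ^ (2 : ℝ) ≤
          ENNReal.ofReal (Real.exp (2 * p * δ)) * (‖g (t.toCircle : ℂ)‖ₑ + ENNReal.ofReal δ) ^ p := by
  obtain ⟨Q, hQ1, hQ2⟩ := exists_outer_majorant hR hg hδ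
  have hexp : ∀ z : ℂ, ‖Complex.exp ((p / 2 : ℝ) * Q.eval z + (p / 2 * δ : ℝ))‖ₑ ^ (2 : ℝ) =
      ENNReal.ofReal (Real.exp ((Q.eval z).re + δ)) ^ p := fun z => by
    rw [enorm_eq_ofReal_exp, ofReal_exp_rpow, ofReal_exp_rpow, Complex.add_re,
      Complex.re_ofReal_mul, Complex.ofReal_re]
    congr 2
    ring
  refine ⟨Q, hQ1, fun z hz => ?_, fun t => ?_⟩
  · rw [hexp]
    refine ENNReal.rpow_le_rpow ?_ hp.le
    rw [← ofReal_norm]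
    refine ENNReal.ofReal_le_ofReal ?_
    have := hQ1 z hz
    rw [norm_mul, Complex.norm_exp, Complex.neg_re, Real.exp_neg, ← div_eq_mul_inv,
      div_le_iff₀ (Real.exp_pos _)] at this
    rw [Real.exp_add, mul_comm]
    exact this
  · rw [hexp]
    have h1 : ENNReal.ofReal (Real.exp ((Q.eval (t.toCircle : ℂ)).re + δ)) ≤
        ENNReal.ofReal (Real.exp (2 * δ)) * (‖g (t.toCircle : ℂ)‖ₑ + ENNReal.ofReal δ) := by
      rw [← ofReal_norm, ← ENNReal.ofReal_add (norm_nonneg _) hδ.le,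
        ← ENNReal.ofReal_mul (Real.exp_pos _).le]
      refine ENNReal.ofReal_le_ofReal ?_
      rw [Real.exp_add, two_mul, Real.exp_add]
      have := mul_le_mul_of_nonneg_right (hQ2 t) (Real.exp_pos δ).le
      linarith
    refine (ENNReal.rpow_le_rpow h1 hp.le).trans_eq ?_
    rw [ENNReal.mul_rpow_of_nonneg _ _ hp.le, ofReal_exp_rpow]
    congr 3
    ring

theorem differentiable_square_majorant (Q : Polynomial ℂ) (a b : ℝ) :
    DifferentiableOn ℂ (fun z => Complex.exp ((a : ℂ) * Q.eval z + (b : ℂ))) (Metric.ball 0 2) :=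
  (differentiable_cexp_polynomial Q a b).differentiableOn

theorem lintegral_powerSum_le (c : lp (fun _ : ℕ => ℂ) 2) {r : ℝ} (hr : r ∈ Ico (0 : ℝ) 1) :
    ∫⁻ t : UnitAddCircle, ‖powerSum c ((r : ℂ) * (t.toCircle : ℂ))‖ₑ ^ (2 : ℝ) ≤
      ‖c‖ₑ ^ (2 : ℝ) := by
  let r' : Icc (0 : ℝ) 1 := ⟨r, hr.1, hr.2.le⟩
  have h := boundaryValue_dilate c r' hr.2
  calc _ = ∫⁻ t : UnitAddCircle, ‖boundaryValue (dilate c r') t‖ₑ ^ (2 : ℝ) := by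
        refine lintegral_congr_ae ?_
        filter_upwards [h] with t ht
        rw [ht]
    _ = ‖dilate c r'‖ₑ ^ (2 : ℝ) := lintegral_boundaryValue _
    _ ≤ _ := by
        refine ENNReal.rpow_le_rpow ?_ (by norm_num)
        rw [← ofReal_norm, ← ofReal_norm]
        exact ENNReal.ofReal_le_ofReal (norm_dilate_le c r')

/-- The integral means of a holomorphic function are increasing (Hardy). -/
theorem circleMean_mono {g : ℂ → ℂ} (hg : DifferentiableOn ℂ g (Metric.ball 0 1)) {p : ℝ}
    (hp : 0 < p) {r s : ℝ} (hr : 0 ≤ r) (hrs : r ≤ s) (hs : s < 1) :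
    circleMean p g r ≤ circleMean p g s := by
  rcases hrs.eq_or_lt with rfl | hlt
  · exact le_rfl
  have hs0 : 0 < s := hr.trans_lt hlt
  have hR : 1 < s⁻¹ := (one_lt_inv₀ hs0).2 hs
  have hgs := differentiableOn_comp_mul hg hs0
  have hgc : Continuous fun t : UnitAddCircle => g ((s : ℂ) * t.toCircle) :=
    continuous_comp_circle hg ⟨hs0.le, hs⟩
  have hrs' : r / s ∈ Ico (0 : ℝ) 1 := ⟨by positivity, (div_lt_one hs0).2 hlt⟩
  have key : ∀ δ > (0 : ℝ), circleMean p g r ≤ ENNReal.ofReal (Real.exp (2 * p * δ)) *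
      ∫⁻ t : UnitAddCircle, (‖g ((s : ℂ) * t.toCircle)‖ₑ + ENNReal.ofReal δ) ^ p := by
    intro δ hδ
    obtain ⟨Q, -, hQ1, hQ2⟩ := exists_square_majorant hR hgs hp hδ
    obtain ⟨c, hc1, hc2⟩ := exists_coeff_of_differentiableOn one_lt_two
      (differentiable_square_majorant Q (p / 2) (p / 2 * δ))
    have hnorm : ∀ t : UnitAddCircle, ‖((r / s : ℝ) : ℂ) * (t.toCircle : ℂ)‖ ≤ 1 := fun t => by
      rw [norm_mul, norm_toCircle_coe, mul_one, Complex.norm_real, Real.norm_of_nonneg hrs'.1]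
      exact hrs'.2.le
    calc circleMean p g r
        ≤ ∫⁻ t : UnitAddCircle,
            ‖powerSum c (((r / s : ℝ) : ℂ) * (t.toCircle : ℂ))‖ₑ ^ (2 : ℝ) := by
          refine lintegral_mono fun t => ?_
          have h1 := hQ1 _ (hnorm t)
          rw [hc1 _ (hnorm t)] at h1
          have h2 : (s : ℂ) * (((r / s : ℝ) : ℂ) * (t.toCircle : ℂ)) = (r : ℂ) * t.toCircle := by
            rw [← mul_assoc, ← Complex.ofReal_mul, mul_div_cancel₀ _ hs0.ne']
          simp only [h2] at h1
          exact h1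
      _ ≤ ‖c‖ₑ ^ (2 : ℝ) := lintegral_powerSum_le c hrs'
      _ ≤ ∫⁻ t : UnitAddCircle, ENNReal.ofReal (Real.exp (2 * p * δ)) *
          (‖g ((s : ℂ) * t.toCircle)‖ₑ + ENNReal.ofReal δ) ^ p := by
          rw [← hc2]
          exact lintegral_mono fun t => hQ2 t
      _ = _ := lintegral_const_mul' _ _ ENNReal.ofReal_ne_top
  obtain ⟨B, hB⟩ := isCompact_univ.exists_bound_of_continuousOn hgc.continuousOn
  have hlim : Tendsto (fun δ : ℝ => ENNReal.ofReal (Real.exp (2 * p * δ)) *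
      ∫⁻ t : UnitAddCircle, (‖g ((s : ℂ) * t.toCircle)‖ₑ + ENNReal.ofReal δ) ^ p) (𝓝[>] 0)
      (𝓝 (1 * circleMean p g s)) := by
    refine ENNReal.Tendsto.mul ?_ (Or.inl one_ne_zero) ?_ (Or.inr ENNReal.one_ne_top)
    · have : Continuous fun δ : ℝ => ENNReal.ofReal (Real.exp (2 * p * δ)) :=
        ENNReal.continuous_ofReal.comp (by fun_prop)
      have h := this.tendsto 0
      simp only [mul_zero, Real.exp_zero, ENNReal.ofReal_one] at h
      exact h.mono_left nhdsWithin_le_nhds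
    · refine tendsto_lintegral_filter_of_dominated_convergence
        (fun _ => (ENNReal.ofReal B + 1) ^ p) ?_ ?_ ?_ ?_
      · refine Filter.Eventually.of_forall fun δ => ?_
        exact (hgc.measurable.enorm.add_const _).pow_const p
      · filter_upwards [Ioc_mem_nhdsGT (show (0 : ℝ) < 1 by norm_num)] with δ hδ
        refine Filter.Eventually.of_forall fun t => ENNReal.rpow_le_rpow (add_le_add ?_ ?_) hp.le
        · rw [← ofReal_norm]
          exact ENNReal.ofReal_le_ofReal (hB t (mem_univ _))
        · rw [← ENNReal.ofReal_one]
          exact ENNReal.ofReal_le_ofReal hδ.2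
      · rw [lintegral_const, measure_univ, mul_one]
        exact ENNReal.rpow_ne_top_of_nonneg hp.le (by simp)
      · refine Filter.Eventually.of_forall fun t => ?_
        have : Continuous fun δ : ℝ => (‖g ((s : ℂ) * t.toCircle)‖ₑ + ENNReal.ofReal δ) ^ p :=
          ENNReal.continuous_rpow_const.comp (continuous_const.add ENNReal.continuous_ofReal)
        have h := this.tendsto 0
        rw [ENNReal.ofReal_zero, add_zero] at h
        exact h.mono_left nhdsWithin_le_nhds
  rw [one_mul] at hlim
  exact ge_of_tendsto hlim (by filter_upwards [self_mem_nhdsWithin] with δ hδ using key δ hδ)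

end OuterMajorant

/-! ### Radial limits of Hardy functions on the disc -/

section RadialLimits

theorem ENNReal.add_rpow_le_two_rpow_mul (x y : ℝ≥0∞) {p : ℝ} (hp : 0 ≤ p) :
    (x + y) ^ p ≤ 2 ^ p * (x ^ p + y ^ p) := by
  rcases le_total x y with h | h
  · calc (x + y) ^ p ≤ (2 * y) ^ p := ENNReal.rpow_le_rpow (by rw [two_mul]; gcongr) hp
      _ = 2 ^ p * y ^ p := ENNReal.mul_rpow_of_nonneg _ _ hp
      _ ≤ _ := by gcongr; exact le_add_self
  · calc (x + y) ^ p ≤ (2 * x) ^ p := ENNReal.rpow_le_rpow (by rw [two_mul]; gcongr) hp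
      _ = 2 ^ p * x ^ p := ENNReal.mul_rpow_of_nonneg _ _ hp
      _ ≤ _ := by gcongr; exact le_self_add

theorem enorm_sub_rpow_le (a b : ℂ) {p : ℝ} (hp : 0 ≤ p) :
    ‖a - b‖ₑ ^ p ≤ 2 ^ p * (‖a‖ₑ ^ p + ‖b‖ₑ ^ p) :=
  (ENNReal.rpow_le_rpow (enorm_sub_le) hp).trans (ENNReal.add_rpow_le_two_rpow_mul _ _ hp)

theorem two_rpow_ne_top (p : ℝ) : (2 : ℝ≥0∞) ^ p ≠ ∞ :=
  ENNReal.rpow_ne_top_of_ne_zero two_ne_zero ENNReal.ofNat_ne_top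

theorem exists_factorization {g : ℂ → ℂ} (hg : DifferentiableOn ℂ g (Metric.ball 0 1)) {p : ℝ}
    (hp : 0 < p) {K : ℝ≥0∞} (hK : K ≠ ∞) (hgK : ∀ r ∈ Ico (0 : ℝ) 1, circleMean p g r ≤ K) :
    ∃ (N : ℕ) (a j k : lp (fun _ : ℕ => ℂ) 2),
      (∀ z, ‖z‖ < 1 → g z = powerSum a z * powerSum j z ^ N) ∧
      ∀ z, ‖z‖ < 1 → ‖g z‖ₑ ^ p ≤ ‖powerSum k z‖ₑ ^ (2 : ℝ) := by
  obtain ⟨N, hN⟩ := exists_nat_gt (2 / p)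
  have hN0 : (0 : ℝ) < N := (by positivity : (0 : ℝ) < 2 / p).trans hN
  have hNp : 2 / N ≤ p := by
    rw [div_lt_iff₀ hp] at hN
    rw [div_le_iff₀ hN0]
    linarith
  let s : ℕ → ℝ := fun n => 1 - 1 / ((n : ℝ) + 2)
  have hs1 : ∀ n, s n < 1 := fun n => sub_lt_self _ (by positivity)
  have hs0 : ∀ n, 0 < s n := fun n => sub_pos.2 ((div_lt_one (by positivity)).2 (by
    have : (0 : ℝ) ≤ n := n.cast_nonneg
    linarith))
  have hslim : Tendsto s atTop (𝓝 1) := by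
    have h1 : Tendsto (fun n : ℕ => 1 / ((n : ℝ) + 2)) atTop (𝓝 0) :=
      tendsto_const_nhds.div_atTop (tendsto_natCast_atTop_atTop.atTop_add tendsto_const_nhds)
    have h2 := h1.const_sub 1
    rwa [sub_zero] at h2
  have hR : ∀ n, 1 < (s n)⁻¹ := fun n => (one_lt_inv₀ (hs0 n)).2 (hs1 n)
  have hgs := fun n => differentiableOn_comp_mul hg (hs0 n)
  choose Q hQ1 hQ2 hQ3 using fun n => exists_square_majorant (hR n) (hgs n) hp one_pos
  let L : ℝ≥0∞ := ENNReal.ofReal (Real.exp (2 * p * 1)) * (2 ^ p * (K + 1))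
  have hL : L ≠ ∞ := ENNReal.mul_ne_top ENNReal.ofReal_ne_top
    (ENNReal.mul_ne_top (two_rpow_ne_top p) (by simp [hK]))
  have hKint : ∀ n, ∫⁻ t : UnitAddCircle, ‖Complex.exp ((p / 2 : ℝ) *
      (Q n).eval (t.toCircle : ℂ) + (p / 2 * 1 : ℝ))‖ₑ ^ (2 : ℝ) ≤ L := fun n => by
    calc _ ≤ ∫⁻ t : UnitAddCircle, ENNReal.ofReal (Real.exp (2 * p * 1)) *
          (2 ^ p * (‖g ((s n : ℂ) * t.toCircle)‖ₑ ^ p + 1)) := by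
          refine lintegral_mono fun t => (hQ3 n t).trans ?_
          gcongr
          refine (ENNReal.add_rpow_le_two_rpow_mul _ _ hp.le).trans_eq ?_
          rw [ENNReal.ofReal_one, ENNReal.one_rpow]
      _ = ENNReal.ofReal (Real.exp (2 * p * 1)) * (2 ^ p * (circleMean p g (s n) + 1)) := by
          rw [lintegral_const_mul' _ _ ENNReal.ofReal_ne_top,
            lintegral_const_mul' _ _ (two_rpow_ne_top p), lintegral_add_right _ measurable_const]
          simp [circleMean]
      _ ≤ L := by
          simp only [L]
          gcongr
          exact hgK _ ⟨(hs0 n).le, hs1 n⟩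
  let U : Ultrafilter ℕ := hyperfilter ℕ
  have hU : (U : Filter ℕ) ≤ atTop := Nat.hyperfilter_le_atTop
  have hsqrt : ∀ x : ℝ≥0∞, x ≠ ∞ → ENNReal.ofReal ((√x.toReal) ^ 2) = x := fun x hx => by
    rw [Real.sq_sqrt ENNReal.toReal_nonneg, ENNReal.ofReal_toReal hx]
  obtain ⟨a, ha⟩ := exists_tendsto_powerSum U
    (h := fun n z => g ((s n : ℂ) * z) * Complex.exp (-(Q n).eval z)) hR
    (fun n => (hgs n).mul (Q n).differentiable.neg.cexp.differentiableOn)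
    (Real.exp_pos 1).le fun n => by
      refine (lintegral_mono (g := fun _ => ENNReal.ofReal (Real.exp 1 ^ 2)) fun t => ?_).trans
        (by simp)
      have h1 := hQ1 n _ (norm_toCircle_coe t).le
      rw [← ofReal_norm, ENNReal.rpow_ofNat, ← ENNReal.ofReal_pow (norm_nonneg _)]
      exact ENNReal.ofReal_le_ofReal (pow_le_pow_left₀ (norm_nonneg _) h1 2)
  obtain ⟨k, hk⟩ := exists_tendsto_powerSum U
    (h := fun n z => Complex.exp ((p / 2 : ℝ) * (Q n).eval z + (p / 2 * 1 : ℝ)))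
    (fun _ => one_lt_two) (fun n => differentiable_square_majorant (Q n) (p / 2) (p / 2 * 1))
    (Real.sqrt_nonneg L.toReal) fun n => (hKint n).trans_eq (hsqrt L hL).symm
  obtain ⟨j, hj⟩ := exists_tendsto_powerSum U
    (h := fun n z => Complex.exp ((1 / N : ℝ) * (Q n).eval z + (0 : ℝ)))
    (fun _ => one_lt_two) (fun n => differentiable_square_majorant (Q n) (1 / N) 0)
    (Real.sqrt_nonneg (1 + L).toReal) fun n => by
      rw [hsqrt _ (by simp [hL])]
      calc _ ≤ ∫⁻ t : UnitAddCircle, (1 + ‖Complex.exp ((p / 2 : ℝ) *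
            (Q n).eval (t.toCircle : ℂ) + (p / 2 * 1 : ℝ))‖ₑ ^ (2 : ℝ)) := by
            refine lintegral_mono fun t => ?_
            rw [enorm_eq_ofReal_exp, ofReal_exp_rpow, enorm_eq_ofReal_exp, ofReal_exp_rpow,
              Complex.add_re, Complex.re_ofReal_mul, Complex.ofReal_re, Complex.add_re,
              Complex.re_ofReal_mul, Complex.ofReal_re]
            set x := ((Q n).eval (t.toCircle : ℂ)).re
            rcases le_total x 0 with hx | hx
            · refine le_add_right ?_
              rw [← ENNReal.ofReal_one]
              refine ENNReal.ofReal_le_ofReal (Real.exp_le_one_iff.2 ?_)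
              have : 1 / (N : ℝ) * x ≤ 0 := mul_nonpos_of_nonneg_of_nonpos (by positivity) hx
              linarith
            · refine le_add_left (ENNReal.ofReal_le_ofReal (Real.exp_le_exp.2 ?_))
              have h1 : 2 / (N : ℝ) * x ≤ p * x := mul_le_mul_of_nonneg_right hNp hx
              have h2 : (1 / (N : ℝ) * x + 0) * 2 = 2 / (N : ℝ) * x := by ring
              rw [h2]
              linarith
        _ = 1 + ∫⁻ t : UnitAddCircle, ‖Complex.exp ((p / 2 : ℝ) *
            (Q n).eval (t.toCircle : ℂ) + (p / 2 * 1 : ℝ))‖ₑ ^ (2 : ℝ) := by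
            rw [lintegral_add_left measurable_const]
            simp
        _ ≤ 1 + L := by gcongr; exact hKint n
  have hglim : ∀ z, ‖z‖ < 1 → Tendsto (fun n => g ((s n : ℂ) * z)) U (𝓝 (g z)) := fun z hz => by
    have h1 : ContinuousAt g z := (hg.differentiableAt
      (Metric.isOpen_ball.mem_nhds (mem_ball_zero_iff.2 hz))).continuousAt
    have h2 : Tendsto (fun n => (s n : ℂ) * z) U (𝓝 z) := by
      have := ((Complex.continuous_ofReal.tendsto 1).comp (hslim.mono_left hU)).mul_const z
      simpa using this
    exact h1.tendsto.comp h2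
  refine ⟨N, a, j, k, fun z hz => ?_, fun z hz => ?_⟩
  · refine tendsto_nhds_unique (hglim z hz) (((ha z hz).mul ((hj z hz).pow N)).congr fun n => ?_)
    rw [← Complex.exp_nat_mul, mul_assoc, ← Complex.exp_add]
    have hNc : (N : ℂ) ≠ 0 := by
      rintro h
      rw [Nat.cast_eq_zero] at h
      simp [h] at hN0
    have : -(Q n).eval z + N * (((1 / N : ℝ) : ℂ) * (Q n).eval z + (0 : ℝ)) = 0 := by
      push_cast
      field_simp
      ring
    rw [this, Complex.exp_zero, mul_one]
  · refine le_of_tendsto_of_tendsto' (((ENNReal.continuous_rpow_const.comp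
      continuous_enorm).tendsto _).comp (hglim z hz)) (((ENNReal.continuous_rpow_const.comp
      continuous_enorm).tendsto _).comp (hk z hz)) fun n => ?_
    exact hQ2 n z hz.le

theorem exists_subseq_tendsto_boundaryValue (c : lp (fun _ : ℕ => ℂ) 2) {r : ℕ → ℝ}
    (hr : ∀ n, r n ∈ Ico (0 : ℝ) 1) (hlim : Tendsto r atTop (𝓝 1)) :
    ∃ ms : ℕ → ℕ, StrictMono ms ∧ ∀ᵐ t : UnitAddCircle,
      Tendsto (fun n => powerSum c ((r (ms n) : ℂ) * (t.toCircle : ℂ))) atTop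
        (𝓝 (boundaryValue c t)) := by
  let r' : ℕ → Icc (0 : ℝ) 1 := fun n => ⟨r n, (hr n).1, (hr n).2.le⟩
  have h1 : Tendsto (fun n => boundaryValue (dilate c (r' n))) atTop (𝓝 (boundaryValue c)) :=
    (boundaryValue.continuous.tendsto c).comp (tendsto_dilate c hlim)
  obtain ⟨ms, hms, h⟩ := (tendstoInMeasure_of_tendsto_Lp h1).exists_seq_tendsto_ae
  refine ⟨ms, hms, ?_⟩
  have h2 : ∀ᵐ t : UnitAddCircle, ∀ n, boundaryValue (dilate c (r' n)) t =
      powerSum c ((r n : ℂ) * (t.toCircle : ℂ)) :=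
    ae_all_iff.2 fun n => boundaryValue_dilate c (r' n) (hr n).2
  rw [volume_unitAddCircle_eq_haar] at h2 ⊢
  filter_upwards [h, h2] with t ht ht2
  exact ht.congr fun n => ht2 (ms n)

theorem tendsto_lintegral_powerSum_sub (c : lp (fun _ : ℕ => ℂ) 2) {r : ℕ → ℝ}
    (hr : ∀ n, r n ∈ Ico (0 : ℝ) 1) (hlim : Tendsto r atTop (𝓝 1)) :
    Tendsto (fun n => ∫⁻ t : UnitAddCircle,
      ‖powerSum c ((r n : ℂ) * (t.toCircle : ℂ)) - boundaryValue c t‖ₑ ^ (2 : ℝ)) atTop (𝓝 0) := by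
  let r' : ℕ → Icc (0 : ℝ) 1 := fun n => ⟨r n, (hr n).1, (hr n).2.le⟩
  have h1 : ∀ n, ∫⁻ t : UnitAddCircle,
      ‖powerSum c ((r n : ℂ) * (t.toCircle : ℂ)) - boundaryValue c t‖ₑ ^ (2 : ℝ) =
      ‖dilate c (r' n) - c‖ₑ ^ (2 : ℝ) := fun n => by
    rw [← lintegral_boundaryValue_sub]
    refine lintegral_congr_ae ?_
    filter_upwards [boundaryValue_dilate c (r' n) (hr n).2] with t ht
    rw [ht]
  simp only [h1]
  have h2 := (tendsto_dilate c (r := r') hlim).sub_const c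
  rw [sub_self] at h2
  have h3 := ((ENNReal.continuous_rpow_const (y := 2)).comp
    (continuous_enorm (E := lp (fun _ : ℕ => ℂ) 2))).tendsto 0 |>.comp h2
  simpa [Function.comp_def] using h3

theorem aestronglyMeasurable_boundaryValue (c : lp (fun _ : ℕ => ℂ) 2) :
    AEStronglyMeasurable (boundaryValue c : UnitAddCircle → ℂ) volume := by
  rw [volume_unitAddCircle_eq_haar]
  exact Lp.aestronglyMeasurable (boundaryValue c)

/-- Convergence of a sequence dominated by a convergent one, up to an error vanishing in mean. -/
theorem tendsto_lintegral_zero_of_le_add {α : Type*} [MeasurableSpace α] {μ : Measure α}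
    {f E : ℕ → α → ℝ≥0∞} {D : α → ℝ≥0∞} (hf : ∀ n, AEMeasurable (f n) μ) (hD : AEMeasurable D μ)
    (hle : ∀ n, ∀ᵐ x ∂μ, f n x ≤ D x + E n x) (hDint : ∫⁻ x, D x ∂μ ≠ ∞)
    (hElim : Tendsto (fun n => ∫⁻ x, E n x ∂μ) atTop (𝓝 0))
    (hlim : ∀ᵐ x ∂μ, Tendsto (fun n => f n x) atTop (𝓝 0)) :
    Tendsto (fun n => ∫⁻ x, f n x ∂μ) atTop (𝓝 0) := by
  have h1 : Tendsto (fun n => ∫⁻ x, min (f n x) (D x) ∂μ) atTop (𝓝 (∫⁻ _, 0 ∂μ)) := by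
    refine tendsto_lintegral_of_dominated_convergence' D (fun n => (hf n).min hD)
      (fun n => Filter.Eventually.of_forall fun x => min_le_right _ _) hDint ?_
    filter_upwards [hlim] with x hx
    exact tendsto_of_tendsto_of_tendsto_of_le_of_le tendsto_const_nhds hx (fun _ => zero_le)
      fun n => min_le_left _ _
  rw [lintegral_zero] at h1
  have h2 := h1.add hElim
  rw [add_zero] at h2
  refine tendsto_of_tendsto_of_tendsto_of_le_of_le tendsto_const_nhds h2 (fun _ => zero_le)
    fun n => ?_
  dsimp only
  rw [← lintegral_add_left' ((hf n).min hD)]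
  refine lintegral_mono_ae ?_
  filter_upwards [hle n] with x hx
  rcases le_total (f n x) (D x) with h | h
  · rw [min_eq_left h]; exact le_self_add
  · rw [min_eq_right h]; exact hx

/-- Functions in the Hardy space of the disc converge radially in mean. -/
theorem exists_radialLimit {g : ℂ → ℂ} (hg : DifferentiableOn ℂ g (Metric.ball 0 1)) {p : ℝ}
    (hp : 0 < p) {K : ℝ≥0∞} (hK : K ≠ ∞) (hgK : ∀ r ∈ Ico (0 : ℝ) 1, circleMean p g r ≤ K) :
    ∃ G : UnitAddCircle → ℂ, AEStronglyMeasurable G volume ∧ ∀ r : ℕ → ℝ,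
      (∀ n, r n ∈ Ico (0 : ℝ) 1) → Tendsto r atTop (𝓝 1) →
      Tendsto (fun n => ∫⁻ t : UnitAddCircle,
        ‖g ((r n : ℂ) * (t.toCircle : ℂ)) - G t‖ₑ ^ p) atTop (𝓝 0) := by
  obtain ⟨N, a, j, k, hfac, hmaj⟩ := exists_factorization hg hp hK hgK
  have hma := aestronglyMeasurable_boundaryValue a
  have hmj := aestronglyMeasurable_boundaryValue j
  have hmk := aestronglyMeasurable_boundaryValue k
  refine ⟨fun t => boundaryValue a t * boundaryValue j t ^ N, hma.mul (hmj.pow N),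
    fun r hr hlim => tendsto_of_subseq_tendsto fun ns hns => ?_⟩
  obtain ⟨m1, hm1, h1⟩ := exists_subseq_tendsto_boundaryValue a (r := r ∘ ns) (fun n => hr _)
    (hlim.comp hns)
  obtain ⟨m2, hm2, h2⟩ := exists_subseq_tendsto_boundaryValue j (r := r ∘ ns ∘ m1) (fun n => hr _)
    (hlim.comp (hns.comp hm1.tendsto_atTop))
  obtain ⟨m3, hm3, h3⟩ := exists_subseq_tendsto_boundaryValue k (r := r ∘ ns ∘ m1 ∘ m2)
    (fun n => hr _) (hlim.comp (hns.comp (hm1.tendsto_atTop.comp hm2.tendsto_atTop)))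
  refine ⟨m1 ∘ m2 ∘ m3, ?_⟩
  set ρ : ℕ → ℝ := fun n => r (ns (m1 (m2 (m3 n)))) with hρdef
  have hρ : ∀ n, ρ n ∈ Ico (0 : ℝ) 1 := fun n => hr _
  have hρlim : Tendsto ρ atTop (𝓝 1) := hlim.comp (hns.comp (hm1.tendsto_atTop.comp
    (hm2.tendsto_atTop.comp hm3.tendsto_atTop)))
  have hnorm : ∀ n (t : UnitAddCircle), ‖(ρ n : ℂ) * (t.toCircle : ℂ)‖ < 1 := fun n t => by
    rw [norm_mul, norm_toCircle_coe, mul_one, Complex.norm_real, Real.norm_of_nonneg (hρ n).1]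
    exact (hρ n).2
  have hgm : ∀ n, AEStronglyMeasurable (fun t : UnitAddCircle => g ((ρ n : ℂ) * t.toCircle))
      volume := fun n => (continuous_comp_circle hg (hρ n)).aestronglyMeasurable
  have hconv : ∀ᵐ t : UnitAddCircle, Tendsto (fun n => g ((ρ n : ℂ) * (t.toCircle : ℂ))) atTop
      (𝓝 (boundaryValue a t * boundaryValue j t ^ N)) ∧
      Tendsto (fun n => powerSum k ((ρ n : ℂ) * (t.toCircle : ℂ))) atTop
        (𝓝 (boundaryValue k t)) := by
    filter_upwards [h1, h2, h3] with t ht1 ht2 ht3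
    refine ⟨?_, ht3⟩
    have e1 := ht1.comp (hm2.tendsto_atTop.comp hm3.tendsto_atTop)
    have e2 := (ht2.comp hm3.tendsto_atTop).pow N
    exact (e1.mul e2).congr fun n => (hfac _ (hnorm n t)).symm
  have hGk : ∀ᵐ t : UnitAddCircle, ‖boundaryValue a t * boundaryValue j t ^ N‖ₑ ^ p ≤
      ‖boundaryValue k t‖ₑ ^ (2 : ℝ) := by
    filter_upwards [hconv] with t ht
    refine le_of_tendsto_of_tendsto' (((ENNReal.continuous_rpow_const.comp
      continuous_enorm).tendsto _).comp ht.1) (((ENNReal.continuous_rpow_const.comp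
      continuous_enorm).tendsto _).comp ht.2) fun n => hmaj _ (hnorm n t)
  refine tendsto_lintegral_zero_of_le_add
    (D := fun t => 2 ^ p * (2 ^ (2 : ℝ) + 1) * ‖boundaryValue k t‖ₑ ^ (2 : ℝ))
    (E := fun n t => 2 ^ p * 2 ^ (2 : ℝ) *
      ‖powerSum k ((ρ n : ℂ) * (t.toCircle : ℂ)) - boundaryValue k t‖ₑ ^ (2 : ℝ))
    (fun n => ((hgm n).sub (hma.mul (hmj.pow N))).enorm.pow_const p)
    ((hmk.enorm.pow_const _).const_mul _)
    (fun n => ?_) ?_ ?_ ?_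
  · filter_upwards [hGk] with t ht
    refine (enorm_sub_rpow_le _ _ hp.le).trans ?_
    have e1 := hmaj _ (hnorm n t)
    have e2 : ‖powerSum k ((ρ n : ℂ) * (t.toCircle : ℂ))‖ₑ ^ (2 : ℝ) ≤ 2 ^ (2 : ℝ) *
        (‖powerSum k ((ρ n : ℂ) * (t.toCircle : ℂ)) - boundaryValue k t‖ₑ ^ (2 : ℝ) +
          ‖boundaryValue k t‖ₑ ^ (2 : ℝ)) := by
      refine le_trans (ENNReal.rpow_le_rpow ?_ zero_le_two)
        (ENNReal.add_rpow_le_two_rpow_mul _ _ zero_le_two)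
      have := enorm_add_le (powerSum k ((ρ n : ℂ) * (t.toCircle : ℂ)) - boundaryValue k t)
        (boundaryValue k t)
      rwa [sub_add_cancel] at this
    calc _ ≤ 2 ^ p * (2 ^ (2 : ℝ) *
        (‖powerSum k ((ρ n : ℂ) * (t.toCircle : ℂ)) - boundaryValue k t‖ₑ ^ (2 : ℝ) +
          ‖boundaryValue k t‖ₑ ^ (2 : ℝ)) + ‖boundaryValue k t‖ₑ ^ (2 : ℝ)) := by
          gcongr
          exact e1.trans e2
      _ = _ := by ring
  · rw [lintegral_const_mul'' _ (hmk.enorm.pow_const _), lintegral_boundaryValue]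
    refine ENNReal.mul_ne_top (ENNReal.mul_ne_top (two_rpow_ne_top p) ?_) ?_
    · exact ENNReal.add_ne_top.2 ⟨two_rpow_ne_top 2, ENNReal.one_ne_top⟩
    · exact ENNReal.rpow_ne_top_of_nonneg zero_le_two enorm_ne_top
  · have h4 := tendsto_lintegral_powerSum_sub k hρ hρlim
    have hc : (2 : ℝ≥0∞) ^ p * 2 ^ (2 : ℝ) ≠ ∞ :=
      ENNReal.mul_ne_top (two_rpow_ne_top p) (two_rpow_ne_top 2)
    have h5 := ENNReal.Tendsto.const_mul h4 (Or.inr hc)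
    rw [mul_zero] at h5
    exact h5.congr fun n => (lintegral_const_mul' _ _ hc).symm
  · filter_upwards [hconv] with t ht
    have e1 := ht.1.sub_const (boundaryValue a t * boundaryValue j t ^ N)
    rw [sub_self] at e1
    have e2 := ((ENNReal.continuous_rpow_const (y := p)).comp
      (continuous_enorm (E := ℂ))).tendsto 0 |>.comp e1
    simpa [Function.comp_def, hp] using e2

theorem tendsto_lintegral_circle_sub {g : ℂ → ℂ} (hg : DifferentiableOn ℂ g (Metric.ball 0 1))
    {p : ℝ} (hp : 0 < p) {K : ℝ≥0∞} (hK : K ≠ ∞)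
    (hgK : ∀ r ∈ Ico (0 : ℝ) 1, circleMean p g r ≤ K) {r s : ℕ → ℝ}
    (hr : ∀ n, r n ∈ Ico (0 : ℝ) 1) (hs : ∀ n, s n ∈ Ico (0 : ℝ) 1)
    (hr1 : Tendsto r atTop (𝓝 1)) (hs1 : Tendsto s atTop (𝓝 1)) :
    Tendsto (fun n => ∫⁻ t : UnitAddCircle,
      ‖g ((r n : ℂ) * (t.toCircle : ℂ)) - g ((s n : ℂ) * (t.toCircle : ℂ))‖ₑ ^ p)
      atTop (𝓝 0) := by
  obtain ⟨G, hG, h⟩ := exists_radialLimit hg hp hK hgK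
  have h1 := ENNReal.Tendsto.const_mul ((h r hr hr1).add (h s hs hs1))
    (Or.inr (two_rpow_ne_top p))
  rw [add_zero, mul_zero] at h1
  refine tendsto_of_tendsto_of_tendsto_of_le_of_le tendsto_const_nhds h1 (fun _ => zero_le)
    fun n => ?_
  have hm : AEMeasurable (fun t : UnitAddCircle =>
      ‖g ((r n : ℂ) * (t.toCircle : ℂ)) - G t‖ₑ ^ p) volume :=
    ((continuous_comp_circle hg (hr n)).aestronglyMeasurable.sub hG).enorm.pow_const p
  dsimp only
  rw [← lintegral_add_left' hm, ← lintegral_const_mul' _ _ (two_rpow_ne_top p)]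
  refine lintegral_mono fun t => ?_
  have := enorm_sub_rpow_le (g ((r n : ℂ) * (t.toCircle : ℂ)) - G t)
    (g ((s n : ℂ) * (t.toCircle : ℂ)) - G t) hp.le
  rwa [sub_sub_sub_cancel_right] at this

end RadialLimits

/-! ### Mean convergence on polydiscs by slicing -/

section Slicing

theorem lintegral_rotate {n : ℕ} {F : UnitAddTorus (Fin n) → ℝ≥0∞} (hF : Measurable F) :
    ∫⁻ θ, ∫⁻ t : UnitAddCircle, F (θ + fun _ => t) = ∫⁻ θ, F θ := by
  have hm : Measurable fun q : UnitAddTorus (Fin n) × UnitAddCircle => F (q.1 + fun _ => q.2) :=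
    hF.comp (measurable_fst.add (measurable_pi_lambda _ fun _ => measurable_snd))
  rw [lintegral_lintegral_swap hm.aemeasurable]
  have h : ∀ t : UnitAddCircle, ∫⁻ θ : UnitAddTorus (Fin n), F (θ + fun _ => t) = ∫⁻ θ, F θ :=
    fun t => lintegral_add_right_eq_self F _
  simp [h]

/-- The restriction of `f` to the disc through the origin and a point of the torus. -/
noncomputable def torusSlice {n : ℕ} (f : (Fin n → ℂ) → ℂ) (θ : UnitAddTorus (Fin n)) (z : ℂ) : ℂ :=
  f fun i => z * ((θ i).toCircle : ℂ)

theorem torusSlice_circle {n : ℕ} (f : (Fin n → ℂ) → ℂ) (θ : UnitAddTorus (Fin n)) (r : ℝ)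
    (t : UnitAddCircle) :
    torusSlice f θ ((r : ℂ) * (t.toCircle : ℂ)) = f (torusPoint n r (θ + fun _ => t)) := by
  unfold torusSlice torusPoint
  congr 1
  funext i
  rw [Pi.add_apply, AddCircle.toCircle_add, Circle.coe_mul]
  ring

theorem differentiableOn_torusSlice {n : ℕ} {f : (Fin n → ℂ) → ℂ}
    (hf : AnalyticOnNhd ℂ f (polydisc n)) (θ : UnitAddTorus (Fin n)) :
    DifferentiableOn ℂ (torusSlice f θ) (Metric.ball 0 1) := by
  have h1 : DifferentiableOn ℂ (fun (z : ℂ) (i : Fin n) => z * ((θ i).toCircle : ℂ))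
      (Metric.ball 0 1) := by fun_prop
  refine hf.differentiableOn.comp h1 fun z hz i => ?_
  rw [norm_mul, norm_toCircle_coe, mul_one]
  exact mem_ball_zero_iff.1 hz

theorem measurable_enorm_torus_rpow {n : ℕ} {f : (Fin n → ℂ) → ℂ}
    (hf : AnalyticOnNhd ℂ f (polydisc n)) {r : ℝ} (hr : r ∈ Ico (0 : ℝ) 1) (p : ℝ) :
    Measurable fun θ => ‖f (torusPoint n r θ)‖ₑ ^ p :=
  (continuous_comp_torusPoint hf.continuousOn hr).measurable.enorm.pow_const p

theorem measurable_lintegral_rotate {n : ℕ} {F : UnitAddTorus (Fin n) → ℝ≥0∞}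
    (hF : Measurable F) : Measurable fun θ => ∫⁻ t : UnitAddCircle, F (θ + fun _ => t) :=
  Measurable.lintegral_prod_right' (f := fun q : UnitAddTorus (Fin n) × UnitAddCircle =>
    F (q.1 + fun _ => q.2))
    (hF.comp (measurable_fst.add (measurable_pi_lambda _ fun _ => measurable_snd)))

theorem exists_radii_tendsto_one : ∃ ρ : ℕ → ℝ, (∀ k, ρ k ∈ Ioo (0 : ℝ) 1) ∧ Monotone ρ ∧
    Tendsto ρ atTop (𝓝 1) := by
  obtain ⟨u, hu, hu1, hlim⟩ := exists_seq_strictMono_tendsto' (show (0 : ℝ) < 1 by norm_num)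
  exact ⟨u, hu1, hu.monotone, hlim⟩

theorem tendsto_lintegral_torus_sub {n : ℕ} {f : (Fin n → ℂ) → ℂ}
    (hf : AnalyticOnNhd ℂ f (polydisc n)) {p : ℝ} (hp : 0 < p) {K : ℝ≥0∞} (hK : K ≠ ∞)
    (hfK : ∀ r ∈ Ico (0 : ℝ) 1, ∫⁻ θ, ‖f (torusPoint n r θ)‖ₑ ^ p ≤ K) {r s : ℕ → ℝ}
    (hr : ∀ k, r k ∈ Ico (0 : ℝ) 1) (hs : ∀ k, s k ∈ Ico (0 : ℝ) 1)
    (hr1 : Tendsto r atTop (𝓝 1)) (hs1 : Tendsto s atTop (𝓝 1)) :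
    Tendsto (fun k => ∫⁻ θ, ‖f (torusPoint n (r k) θ) - f (torusPoint n (s k) θ)‖ₑ ^ p)
      atTop (𝓝 0) := by
  have hmean : ∀ r θ, circleMean p (torusSlice f θ) r =
      ∫⁻ t : UnitAddCircle, ‖f (torusPoint n r (θ + fun _ => t))‖ₑ ^ p := fun r θ => by
    simp only [circleMean, torusSlice_circle]
  obtain ⟨ρ, hρ, hρm, hρ1⟩ := exists_radii_tendsto_one
  have hρ' : ∀ k, ρ k ∈ Ico (0 : ℝ) 1 := fun k => ⟨(hρ k).1.le, (hρ k).2⟩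
  let S : UnitAddTorus (Fin n) → ℝ≥0∞ := fun θ => ⨆ k, circleMean p (torusSlice f θ) (ρ k)
  have hmm : ∀ k, Measurable fun θ => circleMean p (torusSlice f θ) (ρ k) := fun k => by
    simp only [hmean]
    exact measurable_lintegral_rotate (measurable_enorm_torus_rpow hf (hρ' k) p)
  have hSm : Measurable S := Measurable.iSup hmm
  have hS : ∫⁻ θ, S θ ≤ K := by
    rw [lintegral_iSup hmm fun i j hij θ => circleMean_mono (differentiableOn_torusSlice hf θ) hp
      (hρ i).1.le (hρm hij) (hρ j).2]
    refine iSup_le fun k => ?_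
    simp only [hmean]
    rw [lintegral_rotate (measurable_enorm_torus_rpow hf (hρ' k) p)]
    exact hfK _ (hρ' k)
  have hle : ∀ θ, ∀ x ∈ Ico (0 : ℝ) 1, circleMean p (torusSlice f θ) x ≤ S θ := fun θ x hx => by
    obtain ⟨k, hk⟩ := (hρ1.eventually (lt_mem_nhds hx.2)).exists
    exact (circleMean_mono (differentiableOn_torusSlice hf θ) hp hx.1 hk.le (hρ k).2).trans
      (le_iSup (fun k => circleMean p (torusSlice f θ) (ρ k)) k)
  have hSK : ∫⁻ θ, S θ ≠ ∞ := ne_top_of_le_ne_top hK hS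
  have hFm : ∀ k, Measurable fun θ =>
      ‖f (torusPoint n (r k) θ) - f (torusPoint n (s k) θ)‖ₑ ^ p := fun k =>
    ((continuous_comp_torusPoint hf.continuousOn (hr k)).sub
      (continuous_comp_torusPoint hf.continuousOn (hs k))).measurable.enorm.pow_const p
  have hmain : Tendsto (fun k => ∫⁻ θ, ∫⁻ t : UnitAddCircle,
      ‖f (torusPoint n (r k) (θ + fun _ => t)) - f (torusPoint n (s k) (θ + fun _ => t))‖ₑ ^ p)
      atTop (𝓝 (∫⁻ _ : UnitAddTorus (Fin n), 0)) := by
    refine tendsto_lintegral_of_dominated_convergence (fun θ => 2 ^ p * (S θ + S θ))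
      (fun k => measurable_lintegral_rotate (hFm k)) (fun k => Filter.Eventually.of_forall
        fun θ => ?_) ?_ ?_
    · calc _ ≤ ∫⁻ t : UnitAddCircle, 2 ^ p *
            (‖f (torusPoint n (r k) (θ + fun _ => t))‖ₑ ^ p +
              ‖f (torusPoint n (s k) (θ + fun _ => t))‖ₑ ^ p) :=
            lintegral_mono fun t => enorm_sub_rpow_le _ _ hp.le
        _ = 2 ^ p * (circleMean p (torusSlice f θ) (r k) +
              circleMean p (torusSlice f θ) (s k)) := by
            rw [lintegral_const_mul' _ _ (two_rpow_ne_top p), hmean, hmean, lintegral_add_left]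
            exact (measurable_enorm_torus_rpow hf (hr k) p).comp
              (measurable_const.add (measurable_pi_lambda _ fun _ => measurable_id))
        _ ≤ _ := mul_le_mul' le_rfl (add_le_add (hle θ _ (hr k)) (hle θ _ (hs k)))
    · rw [lintegral_const_mul' _ _ (two_rpow_ne_top p), lintegral_add_left hSm]
      exact ENNReal.mul_ne_top (two_rpow_ne_top p) (ENNReal.add_ne_top.2 ⟨hSK, hSK⟩)
    · filter_upwards [ae_lt_top hSm hSK] with θ hθ
      have h := tendsto_lintegral_circle_sub (differentiableOn_torusSlice hf θ) hp hθ.ne (hle θ)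
        hr hs hr1 hs1
      simpa only [torusSlice_circle] using h
  rw [lintegral_zero] at hmain
  exact hmain.congr fun k => lintegral_rotate (hFm k)

theorem smul_torusPoint {n : ℕ} (a r : ℝ) (θ : UnitAddTorus (Fin n)) :
    (a : ℂ) • torusPoint n r θ = torusPoint n (a * r) θ := by
  funext i
  rw [Pi.smul_apply, torusPoint, torusPoint, smul_eq_mul, Complex.ofReal_mul, mul_assoc]

theorem mul_mem_Ico {a r : ℝ} (ha : a ∈ Ioo (0 : ℝ) 1) (hr : r ∈ Ico (0 : ℝ) 1) :
    a * r ∈ Ico (0 : ℝ) 1 :=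
  ⟨mul_nonneg ha.1.le hr.1, by nlinarith [ha.1, ha.2, hr.1, hr.2]⟩

theorem tendsto_lintegral_torus_dilate {n : ℕ} {f : (Fin n → ℂ) → ℂ}
    (hf : AnalyticOnNhd ℂ f (polydisc n)) {p : ℝ} (hp : 0 < p) {K : ℝ≥0∞} (hK : K ≠ ∞)
    (hfK : ∀ r ∈ Ico (0 : ℝ) 1, ∫⁻ θ, ‖f (torusPoint n r θ)‖ₑ ^ p ≤ K) {ρ r : ℕ → ℝ}
    (hρ : ∀ k, ρ k ∈ Ioo (0 : ℝ) 1) (hρ1 : Tendsto ρ atTop (𝓝 1))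
    (hr : ∀ k, r k ∈ Ico (0 : ℝ) 1) :
    Tendsto (fun k => ∫⁻ θ, ‖f (torusPoint n (r k) θ) - f (torusPoint n (ρ k * r k) θ)‖ₑ ^ p)
      atTop (𝓝 0) := by
  refine tendsto_of_subseq_tendsto fun ns hns => ?_
  obtain ⟨x, hx, ms, hms, hlim⟩ := isCompact_Icc.tendsto_subseq (x := fun k => r (ns k))
    (fun k => (⟨(hr _).1, (hr _).2.le⟩ : r (ns k) ∈ Icc (0 : ℝ) 1))
  refine ⟨ms, ?_⟩
  have hρ2 : Tendsto (fun k => ρ (ns (ms k))) atTop (𝓝 1) :=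
    hρ1.comp (hns.comp hms.tendsto_atTop)
  have hprod : Tendsto (fun k => ρ (ns (ms k)) * r (ns (ms k))) atTop (𝓝 x) := by
    simpa using hρ2.mul hlim
  rcases hx.2.eq_or_lt with rfl | hx1
  · exact tendsto_lintegral_torus_sub hf hp hK hfK (fun k => hr _)
      (fun k => mul_mem_Ico (hρ _) (hr _)) hlim hprod
  · obtain ⟨y, hxy, hy⟩ := exists_between hx1
    have hy0 : 0 ≤ y := hx.1.trans hxy.le
    obtain ⟨M, hM⟩ := (isCompact_closedBall (0 : Fin n → ℂ) y).exists_bound_of_continuousOn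
      (hf.continuousOn.mono fun z hz => mem_polydisc_iff_norm_lt.2
        ((mem_closedBall_zero_iff.1 hz).trans_lt hy))
    have hbd : ∀ q ∈ Icc (0 : ℝ) y, ∀ θ, ‖f (torusPoint n q θ)‖ₑ ≤ ENNReal.ofReal M :=
      fun q hq θ => by
        rw [← ofReal_norm]
        exact ENNReal.ofReal_le_ofReal (hM _ (mem_closedBall_zero_iff.2
          ((norm_torusPoint_le n hq.1 θ).trans hq.2)))
    have hcont : ∀ θ, ContinuousAt (fun q : ℝ => f (torusPoint n q θ)) x := fun θ => by
      have h1 : ContinuousAt f (torusPoint n x θ) :=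
        (hf _ (torusPoint_mem n ⟨hx.1, hx1⟩ θ)).continuousAt
      have h2 : Continuous fun q : ℝ => torusPoint n q θ :=
        continuous_pi fun i => Complex.continuous_ofReal.mul continuous_const
      exact h1.comp (f := fun q : ℝ => torusPoint n q θ) h2.continuousAt
    have hev := hlim.eventually (gt_mem_nhds hxy)
    rw [← lintegral_zero (μ := (volume : Measure (UnitAddTorus (Fin n))))]
    refine tendsto_lintegral_filter_of_dominated_convergence
      (fun _ => 2 ^ p * (ENNReal.ofReal M ^ p + ENNReal.ofReal M ^ p)) ?_ ?_ ?_ ?_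
    · exact Filter.Eventually.of_forall fun k =>
        ((continuous_comp_torusPoint hf.continuousOn (hr _)).sub (continuous_comp_torusPoint
          hf.continuousOn (mul_mem_Ico (hρ _) (hr _)))).measurable.enorm.pow_const p
    · filter_upwards [hev] with k hk
      refine Filter.Eventually.of_forall fun θ => (enorm_sub_rpow_le _ _ hp.le).trans ?_
      have h1 := hr (ns (ms k))
      have h2 := hρ (ns (ms k))
      gcongr
      · exact hbd _ ⟨h1.1, le_of_lt hk⟩ θ
      · refine hbd _ ⟨mul_nonneg h2.1.le h1.1, ?_⟩ θ
        exact (mul_le_of_le_one_left h1.1 h2.2.le).trans (le_of_lt hk)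
    · rw [lintegral_const, measure_univ, mul_one]
      have : ENNReal.ofReal M ^ p ≠ ∞ :=
        ENNReal.rpow_ne_top_of_nonneg hp.le ENNReal.ofReal_ne_top
      exact ENNReal.mul_ne_top (two_rpow_ne_top p) (ENNReal.add_ne_top.2 ⟨this, this⟩)
    · refine Filter.Eventually.of_forall fun θ => ?_
      have h1 := ((hcont θ).tendsto.comp hlim).sub ((hcont θ).tendsto.comp hprod)
      rw [sub_self] at h1
      have h2 := ((ENNReal.continuous_rpow_const (y := p)).comp
        (continuous_enorm (E := ℂ))).tendsto 0 |>.comp h1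
      simpa [Function.comp_def, hp] using h2

theorem eventually_lintegral_torus_dilate_le {n : ℕ} {f : (Fin n → ℂ) → ℂ}
    (hf : AnalyticOnNhd ℂ f (polydisc n)) {p : ℝ} (hp : 0 < p) {K : ℝ≥0∞} (hK : K ≠ ∞)
    (hfK : ∀ r ∈ Ico (0 : ℝ) 1, ∫⁻ θ, ‖f (torusPoint n r θ)‖ₑ ^ p ≤ K) {ρ : ℕ → ℝ}
    (hρ : ∀ k, ρ k ∈ Ioo (0 : ℝ) 1) (hρ1 : Tendsto ρ atTop (𝓝 1)) {ε : ℝ≥0∞} (hε : 0 < ε) :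
    ∀ᶠ k in atTop, ∀ r ∈ Ico (0 : ℝ) 1,
      ∫⁻ θ, ‖f (torusPoint n r θ) - f (torusPoint n (ρ k * r) θ)‖ₑ ^ p ≤ ε := by
  classical
  by_contra H
  let r : ℕ → ℝ := fun k => if h : ∃ x ∈ Ico (0 : ℝ) 1,
    ε < ∫⁻ θ, ‖f (torusPoint n x θ) - f (torusPoint n (ρ k * x) θ)‖ₑ ^ p then h.choose else 0
  have hr : ∀ k, r k ∈ Ico (0 : ℝ) 1 := fun k => by
    by_cases h : ∃ x ∈ Ico (0 : ℝ) 1,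
      ε < ∫⁻ θ, ‖f (torusPoint n x θ) - f (torusPoint n (ρ k * x) θ)‖ₑ ^ p
    · simp only [r, dif_pos h]; exact h.choose_spec.1
    · simp only [r, dif_neg h]; exact ⟨le_rfl, one_pos⟩
  have hlim := tendsto_lintegral_torus_dilate hf hp hK hfK hρ hρ1 hr
  refine H ((hlim.eventually (ge_mem_nhds hε)).mono fun k hk x hx => ?_)
  by_contra! hlt
  have h : ∃ x ∈ Ico (0 : ℝ) 1,
    ε < ∫⁻ θ, ‖f (torusPoint n x θ) - f (torusPoint n (ρ k * x) θ)‖ₑ ^ p := ⟨x, hx, hlt⟩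
  have hrk : r k = h.choose := dif_pos h
  rw [hrk] at hk
  exact h.choose_spec.2.not_ge hk

end Slicing

/-! ### Density of the polynomials -/

section Density

theorem exists_polynomial_norm_dilate_sub_le {n : ℕ} {f : (Fin n → ℂ) → ℂ}
    (hf : AnalyticOnNhd ℂ f (polydisc n)) {ρ : ℝ} (hρ : ρ ∈ Ioo (0 : ℝ) 1) {ε : ℝ} (hε : 0 < ε) :
    ∃ P : MvPolynomial (Fin n) ℂ, ∀ z ∈ polydisc n,
      ‖f ((ρ : ℂ) • z) - MvPolynomial.eval z P‖ ≤ ε := by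
  obtain ⟨Q, hQ⟩ := exists_polynomial_norm_sub_le hf hρ.1 hρ.2 hε
  refine ⟨MvPolynomial.bind₁ (fun i => MvPolynomial.C (ρ : ℂ) * MvPolynomial.X i) Q,
    fun z hz => ?_⟩
  have h : MvPolynomial.eval z
      (MvPolynomial.bind₁ (fun i => MvPolynomial.C (ρ : ℂ) * MvPolynomial.X i) Q) =
      MvPolynomial.eval ((ρ : ℂ) • z) Q := by
    have h1 := MvPolynomial.eval₂Hom_bind₁ (RingHom.id ℂ) z
      (fun i => MvPolynomial.C (ρ : ℂ) * MvPolynomial.X i) Q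
    simp only [MvPolynomial.coe_eval₂Hom, MvPolynomial.eval₂_mul, MvPolynomial.eval₂_C,
      MvPolynomial.eval₂_X, RingHom.id_apply] at h1
    exact h1
  rw [h]
  refine hQ _ ?_
  rw [norm_smul, Complex.norm_real, Real.norm_of_nonneg hρ.1.le]
  exact mul_le_of_le_one_right hρ.1.le (mem_polydisc_iff_norm_lt.1 hz).le

theorem HardySpace.ofPolynomial_apply {n : ℕ} (p : ℝ≥0∞) (P : MvPolynomial (Fin n) ℂ)
    {z : Fin n → ℂ} (hz : z ∈ polydisc n) :
    HardySpace.ofPolynomial p P z = MvPolynomial.eval z P :=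
  indicator_of_mem hz fun z => MvPolynomial.eval z P

theorem eLpNorm_torus_le_hardyNorm {n : ℕ} {p : ℝ≥0∞} (hp : p ≠ ∞) (f : (Fin n → ℂ) → ℂ) {r : ℝ}
    (hr : r ∈ Ico (0 : ℝ) 1) : eLpNorm (fun θ => f (torusPoint n r θ)) p volume ≤ hardyNorm n p f := by
  rw [hardyNorm, if_neg hp]
  exact le_iSup₂ (f := fun r (_ : r ∈ Ico (0 : ℝ) 1) =>
    eLpNorm (fun θ : UnitAddTorus (Fin n) => f (torusPoint n r θ)) p volume) r hr

theorem lintegral_torus_rpow_le_hardyNorm {n : ℕ} {p : ℝ≥0∞} (hp0 : p ≠ 0) (hp : p ≠ ∞)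
    (f : (Fin n → ℂ) → ℂ) {r : ℝ} (hr : r ∈ Ico (0 : ℝ) 1) :
    ∫⁻ θ, ‖f (torusPoint n r θ)‖ₑ ^ p.toReal ≤ hardyNorm n p f ^ p.toReal := by
  have h := eLpNorm_torus_le_hardyNorm hp f hr
  rw [eLpNorm_eq_lintegral_rpow_enorm_toReal hp0 hp, one_div] at h
  exact (ENNReal.rpow_inv_le_iff (ENNReal.toReal_pos hp0 hp)).1 h

theorem hardyNorm_le_of_lintegral_torus_rpow_le {n : ℕ} {p : ℝ≥0∞} (hp0 : p ≠ 0) (hp : p ≠ ∞)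
    {f : (Fin n → ℂ) → ℂ} {K : ℝ≥0∞}
    (h : ∀ r ∈ Ico (0 : ℝ) 1, ∫⁻ θ, ‖f (torusPoint n r θ)‖ₑ ^ p.toReal ≤ K ^ p.toReal) :
    hardyNorm n p f ≤ K := by
  rw [hardyNorm, if_neg hp]
  refine iSup₂_le fun r hr => ?_
  rw [eLpNorm_eq_lintegral_rpow_enorm_toReal hp0 hp, one_div]
  exact (ENNReal.rpow_inv_le_iff (ENNReal.toReal_pos hp0 hp)).2 (h r hr)

theorem tendsto_hardyNormTopology {n : ℕ} {p : ℝ≥0∞} {f : HardySpace n p}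
    {F : ℕ → HardySpace n p}
    (h : Tendsto (fun k => hardyNorm n p fun z => F k z - f z) atTop (𝓝 0)) :
    Tendsto F atTop (@nhds _ (hardyNormTopology n p) f) := by
  let _ := hardyNormTopology n p
  refine tendsto_nhds.2 fun U hU hfU => ?_
  obtain ⟨ε, hε, hball⟩ := hU f hfU
  exact (h.eventually (gt_mem_nhds hε)).mono fun k hk => hball _ hk

theorem tendsto_hardyNorm_dilate_approx {n : ℕ} {p : ℝ≥0∞} (hp0 : p ≠ 0) (hp : p ≠ ∞)
    (f : HardySpace n p) {ρ : ℕ → ℝ} (hρ : ∀ k, ρ k ∈ Ioo (0 : ℝ) 1)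
    (hρ1 : Tendsto ρ atTop (𝓝 1)) {P : ℕ → MvPolynomial (Fin n) ℂ}
    (hP : ∀ k, ∀ z ∈ polydisc n,
      ‖f ((ρ k : ℂ) • z) - MvPolynomial.eval z (P k)‖ ≤ 1 / ((k : ℝ) + 1)) :
    Tendsto (fun k => hardyNorm n p fun z => HardySpace.ofPolynomial p (P k) z - f z)
      atTop (𝓝 0) := by
  have hpp := ENNReal.toReal_pos hp0 hp
  set s := p.toReal with hs
  have hK : hardyNorm n p f ^ s ≠ ∞ := ENNReal.rpow_ne_top_of_nonneg hpp.le f.norm_lt_top'.ne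
  have hδ : Tendsto (fun k : ℕ => ENNReal.ofReal (1 / ((k : ℝ) + 1)) ^ s) atTop (𝓝 0) := by
    have h1 := ENNReal.tendsto_ofReal (tendsto_one_div_add_atTop_nhds_zero_nat (𝕜 := ℝ))
    have h2 := ((ENNReal.continuous_rpow_const (y := s)).tendsto _).comp h1
    simpa [hpp, Function.comp_def] using h2
  rw [ENNReal.tendsto_nhds_zero]
  intro ε hε
  rcases eq_or_ne ε ∞ with rfl | hε'
  · exact Filter.Eventually.of_forall fun _ => le_top
  have hεs : 0 < ε ^ s := ENNReal.rpow_pos hε hε'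
  obtain ⟨η, hη0, hη⟩ : ∃ η > (0 : ℝ≥0∞), 2 ^ s * (η + η) ≤ ε ^ s := by
    have h2 : (2 : ℝ≥0∞) ^ s ≠ 0 := (ENNReal.rpow_pos (by norm_num) (by norm_num)).ne'
    refine ⟨ε ^ s / 2 ^ s / 2, ENNReal.half_pos (ENNReal.div_pos hεs.ne' (two_rpow_ne_top s)).ne',
      ?_⟩
    rw [ENNReal.add_halves, ENNReal.mul_div_cancel h2 (two_rpow_ne_top s)]
  filter_upwards [eventually_lintegral_torus_dilate_le f.analytic' hpp hK
    (fun r hr => lintegral_torus_rpow_le_hardyNorm hp0 hp f hr) hρ hρ1 hη0,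
    hδ.eventually (ge_mem_nhds hη0)] with k hk hk'
  refine hardyNorm_le_of_lintegral_torus_rpow_le hp0 hp fun r hr => ?_
  have hρr := mul_mem_Ico (hρ k) hr
  calc ∫⁻ θ, ‖HardySpace.ofPolynomial p (P k) (torusPoint n r θ) - f (torusPoint n r θ)‖ₑ ^ s
      ≤ ∫⁻ θ, 2 ^ s * (η + ‖f (torusPoint n r θ) - f (torusPoint n (ρ k * r) θ)‖ₑ ^ s) := by
        refine lintegral_mono fun θ => ?_
        rw [HardySpace.ofPolynomial_apply p _ (torusPoint_mem n hr θ)]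
        have h1 : MvPolynomial.eval (torusPoint n r θ) (P k) - f (torusPoint n r θ) =
            (MvPolynomial.eval (torusPoint n r θ) (P k) - f (torusPoint n (ρ k * r) θ)) -
              (f (torusPoint n r θ) - f (torusPoint n (ρ k * r) θ)) := by ring
        rw [h1]
        refine (enorm_sub_rpow_le _ _ hpp.le).trans (mul_le_mul' le_rfl (add_le_add ?_ le_rfl))
        refine le_trans (ENNReal.rpow_le_rpow ?_ hpp.le) hk'
        rw [← ofReal_norm, norm_sub_rev, ← smul_torusPoint]
        exact ENNReal.ofReal_le_ofReal (hP k _ (torusPoint_mem n hr θ))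
    _ = 2 ^ s * (η + ∫⁻ θ, ‖f (torusPoint n r θ) - f (torusPoint n (ρ k * r) θ)‖ₑ ^ s) := by
        rw [lintegral_const_mul' _ _ (two_rpow_ne_top s), lintegral_add_left measurable_const,
          lintegral_const, measure_univ, mul_one]
    _ ≤ ε ^ s := (mul_le_mul' le_rfl (add_le_add le_rfl (hk r hr))).trans hη

theorem tendsto_eval_dilate_approx {n : ℕ} {f : (Fin n → ℂ) → ℂ}
    (hf : AnalyticOnNhd ℂ f (polydisc n)) {ρ : ℕ → ℝ} (hρ1 : Tendsto ρ atTop (𝓝 1))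
    {P : ℕ → MvPolynomial (Fin n) ℂ}
    (hP : ∀ k, ∀ z ∈ polydisc n,
      ‖f ((ρ k : ℂ) • z) - MvPolynomial.eval z (P k)‖ ≤ 1 / ((k : ℝ) + 1)) {z : Fin n → ℂ}
    (hz : z ∈ polydisc n) :
    Tendsto (fun k => MvPolynomial.eval z (P k)) atTop (𝓝 (f z)) := by
  have h1 : Tendsto (fun k => (ρ k : ℂ) • z) atTop (𝓝 z) := by
    simpa using ((Complex.continuous_ofReal.tendsto 1).comp hρ1).smul_const z
  have h2 := (hf z hz).continuousAt.tendsto.comp h1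
  have h3 := squeeze_zero_norm (fun k => hP k z hz)
    (tendsto_one_div_add_atTop_nhds_zero_nat (𝕜 := ℝ))
  simpa using h2.sub h3

end Density

section WeakStar

theorem integrable_torus_mul {n : ℕ} {f : (Fin n → ℂ) → ℂ} {M : ℝ}
    (hf : AnalyticOnNhd ℂ f (polydisc n)) (hM : ∀ z ∈ polydisc n, ‖f z‖ ≤ M)
    {g : UnitAddTorus (Fin n) → ℂ} (hg : Integrable g) {r : ℝ} (hr : r ∈ Ico (0 : ℝ) 1) :
    Integrable fun θ => f (torusPoint n r θ) * g θ :=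
  hg.bdd_mul (continuous_comp_torusPoint hf.continuousOn hr).aestronglyMeasurable
    (Filter.Eventually.of_forall fun θ => hM _ (torusPoint_mem n hr θ))

theorem tendsto_integral_torus_sub_mul {n : ℕ} {f : (Fin n → ℂ) → ℂ} {M : ℝ}
    (hf : AnalyticOnNhd ℂ f (polydisc n)) (hM : ∀ z ∈ polydisc n, ‖f z‖ ≤ M)
    {g : UnitAddTorus (Fin n) → ℂ} (hg : Integrable g) {r s : ℕ → ℝ}
    (hr : ∀ k, r k ∈ Ico (0 : ℝ) 1) (hs : ∀ k, s k ∈ Ico (0 : ℝ) 1)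
    (hr1 : Tendsto r atTop (𝓝 1)) (hs1 : Tendsto s atTop (𝓝 1)) :
    Tendsto (fun k => ∫ θ, (f (torusPoint n (r k) θ) - f (torusPoint n (s k) θ)) * g θ)
      atTop (𝓝 0) := by
  have hmeas : ∀ k, AEStronglyMeasurable
      (fun θ => f (torusPoint n (r k) θ) - f (torusPoint n (s k) θ)) volume := fun k =>
    ((continuous_comp_torusPoint hf.continuousOn (hr k)).sub
      (continuous_comp_torusPoint hf.continuousOn (hs k))).aestronglyMeasurable
  have h1 := tendsto_lintegral_torus_sub hf one_pos (ENNReal.ofReal_ne_top (r := M))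
    (fun q hq => by
      calc ∫⁻ θ, ‖f (torusPoint n q θ)‖ₑ ^ (1 : ℝ)
          ≤ ∫⁻ _ : UnitAddTorus (Fin n), ENNReal.ofReal M := lintegral_mono fun θ => by
            rw [ENNReal.rpow_one, ← ofReal_norm]
            exact ENNReal.ofReal_le_ofReal (hM _ (torusPoint_mem n hq θ))
        _ = ENNReal.ofReal M := by rw [lintegral_const, measure_univ, mul_one]) hr hs hr1 hs1
  have h2 : TendstoInMeasure volume
      (fun k θ => f (torusPoint n (r k) θ) - f (torusPoint n (s k) θ)) atTop fun _ => 0 := by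
    refine tendstoInMeasure_of_tendsto_eLpNorm one_ne_zero hmeas aestronglyMeasurable_const ?_
    refine h1.congr fun k => ?_
    simp [eLpNorm_one_eq_lintegral_enorm]
  refine tendsto_of_subseq_tendsto fun ns hns => ?_
  obtain ⟨ms, -, hae⟩ := (show TendstoInMeasure volume
    (fun k θ => f (torusPoint n (r (ns k)) θ) - f (torusPoint n (s (ns k)) θ)) atTop fun _ => 0
    from fun ε hε => (h2 ε hε).comp hns).exists_seq_tendsto_ae
  refine ⟨ms, ?_⟩
  rw [← integral_zero (UnitAddTorus (Fin n)) ℂ (μ := volume)]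
  refine tendsto_integral_of_dominated_convergence (fun θ => (M + M) * ‖g θ‖)
    (fun k => (hmeas _).mul hg.aestronglyMeasurable) (hg.norm.const_mul _)
    (fun k => Filter.Eventually.of_forall fun θ => ?_) ?_
  · rw [norm_mul]
    gcongr
    exact (norm_sub_le _ _).trans (add_le_add (hM _ (torusPoint_mem n (hr _) θ))
      (hM _ (torusPoint_mem n (hs _) θ)))
  · filter_upwards [hae] with θ hθ
    simpa using hθ.mul_const (g θ)

theorem norm_integral_torus_mul_le {n : ℕ} {F g : UnitAddTorus (Fin n) → ℂ} {M : ℝ}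
    (hM : ∀ θ, ‖F θ‖ ≤ M) (hg : Integrable g) : ‖∫ θ, F θ * g θ‖ ≤ M * ∫ θ, ‖g θ‖ := by
  rw [← integral_const_mul]
  refine norm_integral_le_of_norm_le (hg.norm.const_mul _) (Filter.Eventually.of_forall fun θ => ?_)
  rw [norm_mul]
  gcongr
  exact hM θ

theorem tendsto_boundaryPairing {n : ℕ} {f : (Fin n → ℂ) → ℂ} {M : ℝ}
    (hf : AnalyticOnNhd ℂ f (polydisc n)) (hM : ∀ z ∈ polydisc n, ‖f z‖ ≤ M)
    {g : UnitAddTorus (Fin n) → ℂ} (hg : Integrable g) :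
    Tendsto (fun r : ℝ => ∫ θ, f (torusPoint n r θ) * g θ) (𝓝[<] 1)
      (𝓝 (boundaryPairing n g f)) := by
  refine tendsto_nhds_limUnder ?_
  obtain ⟨ρ, hρ, -, hρ1⟩ := exists_radii_tendsto_one
  have hρ' : ∀ k, ρ k ∈ Ico (0 : ℝ) 1 := fun k => ⟨(hρ k).1.le, (hρ k).2⟩
  obtain ⟨L, -, ms, hms, hL⟩ := (isCompact_closedBall (0 : ℂ) (M * ∫ θ, ‖g θ‖)).tendsto_subseq
    (x := fun k => ∫ θ, f (torusPoint n (ρ k) θ) * g θ) fun k => mem_closedBall_zero_iff.2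
      (norm_integral_torus_mul_le (fun θ => hM _ (torusPoint_mem n (hρ' k) θ)) hg)
  refine ⟨L, tendsto_iff_seq_tendsto.2 fun x hx => ?_⟩
  classical
  let y : ℕ → ℝ := fun k => if x k ∈ Ico (0 : ℝ) 1 then x k else 0
  have hy : ∀ k, y k ∈ Ico (0 : ℝ) 1 := fun k => by
    simp only [y]
    split_ifs with h
    exacts [h, ⟨le_rfl, one_pos⟩]
  have hxy : x =ᶠ[atTop] y := by
    filter_upwards [hx (Ico_mem_nhdsLT (zero_lt_one' ℝ))] with k hk
    exact (if_pos hk).symm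
  have hy1 : Tendsto y atTop (𝓝 1) := (hx.mono_right nhdsWithin_le_nhds).congr' hxy
  have h := (tendsto_integral_torus_sub_mul hf hM hg hy (fun k => hρ' (ms k)) hy1
    (hρ1.comp hms.tendsto_atTop)).add hL
  rw [zero_add] at h
  refine h.congr' (hxy.mono fun k hk => ?_)
  simp only [Function.comp_apply, hk, sub_mul]
  rw [integral_sub (integrable_torus_mul hf hM hg (hy k))
    (integrable_torus_mul hf hM hg (hρ' (ms k))), sub_add_cancel]

theorem HardySpace.exists_norm_le {n : ℕ} (f : HardySpace n ∞) :
    ∃ M : ℝ, ∀ z ∈ polydisc n, ‖f z‖ ≤ M := by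
  refine ⟨(hardyNorm n ∞ f).toReal, fun z hz => ?_⟩
  rw [← toReal_enorm]
  refine ENNReal.toReal_mono f.norm_lt_top'.ne ?_
  rw [hardyNorm, if_pos rfl]
  exact le_iSup₂ (f := fun z (_ : z ∈ polydisc n) => ‖f z‖ₑ) z hz

theorem tendsto_boundaryPairing_dilate_approx {n : ℕ} (f : HardySpace n ∞) {ρ : ℕ → ℝ}
    (hρ : ∀ k, ρ k ∈ Ioo (0 : ℝ) 1) (hρ1 : Tendsto ρ atTop (𝓝 1))
    {P : ℕ → MvPolynomial (Fin n) ℂ}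
    (hP : ∀ k, ∀ z ∈ polydisc n,
      ‖f ((ρ k : ℂ) • z) - MvPolynomial.eval z (P k)‖ ≤ 1 / ((k : ℝ) + 1))
    {g : UnitAddTorus (Fin n) → ℂ} (hg : Integrable g) :
    Tendsto (fun k => boundaryPairing n g (HardySpace.ofPolynomial ∞ (P k))) atTop
      (𝓝 (boundaryPairing n g f)) := by
  obtain ⟨M, hM⟩ := f.exists_norm_le
  have hδ := tendsto_one_div_add_atTop_nhds_zero_nat (𝕜 := ℝ)
  have hex : ∀ k : ℕ, ∃ r : ℝ, r ∈ Ico (ρ k) 1 ∧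
      ‖boundaryPairing n g (HardySpace.ofPolynomial ∞ (P k)) -
        ∫ θ, HardySpace.ofPolynomial ∞ (P k) (torusPoint n r θ) * g θ‖ ≤ 1 / ((k : ℝ) + 1) := by
    intro k
    obtain ⟨C, hC⟩ := (HardySpace.ofPolynomial ∞ (P k)).exists_norm_le
    have h := tendsto_boundaryPairing (HardySpace.ofPolynomial ∞ (P k)).analytic' hC hg
    have h1 := h.eventually (Metric.closedBall_mem_nhds _ (Nat.one_div_pos_of_nat (α := ℝ) (n := k)))
    obtain ⟨r, hr, hr'⟩ := (h1.and (Ico_mem_nhdsLT (hρ k).2)).exists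
    refine ⟨r, hr', ?_⟩
    rw [norm_sub_rev, ← dist_eq_norm]
    exact hr
  choose r hr hrP using hex
  have hr' : ∀ k, r k ∈ Ico (0 : ℝ) 1 := fun k => ⟨(hρ k).1.le.trans (hr k).1, (hr k).2⟩
  have hr1 : Tendsto r atTop (𝓝 1) :=
    tendsto_of_tendsto_of_tendsto_of_le_of_le hρ1 tendsto_const_nhds (fun k => (hr k).1)
      fun k => (hr k).2.le
  have hρr : ∀ k, ρ k * r k ∈ Ico (0 : ℝ) 1 := fun k => mul_mem_Ico (hρ k) (hr' k)
  have hprod : Tendsto (fun k => ρ k * r k) atTop (𝓝[<] 1) :=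
    tendsto_nhdsWithin_iff.2 ⟨by simpa using hρ1.mul hr1,
      Filter.Eventually.of_forall fun k => (hρr k).2⟩
  have hlim := (tendsto_boundaryPairing f.analytic' hM hg).comp hprod
  have hdiff : ∀ k, ‖boundaryPairing n g (HardySpace.ofPolynomial ∞ (P k)) -
      ∫ θ, f (torusPoint n (ρ k * r k) θ) * g θ‖ ≤
        1 / ((k : ℝ) + 1) + 1 / ((k : ℝ) + 1) * ∫ θ, ‖g θ‖ := fun k => by
    obtain ⟨C, hC⟩ := (HardySpace.ofPolynomial ∞ (P k)).exists_norm_le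
    refine (norm_sub_le_norm_sub_add_norm_sub _ _ _).trans (add_le_add (hrP k) ?_)
    rw [← integral_sub (integrable_torus_mul (HardySpace.ofPolynomial ∞ (P k)).analytic'
      hC hg (hr' k)) (integrable_torus_mul f.analytic' hM hg (hρr k))]
    simp only [← sub_mul]
    refine norm_integral_torus_mul_le (fun θ => ?_) hg
    rw [HardySpace.ofPolynomial_apply _ _ (torusPoint_mem n (hr' k) θ), norm_sub_rev,
      ← smul_torusPoint]
    exact hP k _ (torusPoint_mem n (hr' k) θ)
  have hz := squeeze_zero_norm hdiff (by simpa using hδ.add (hδ.mul_const (∫ θ, ‖g θ‖)))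
  simpa using hz.add hlim

theorem tendsto_hardyWeakStarTopology_iff {n : ℕ} {p : ℝ≥0∞} {ι : Type*} {l : Filter ι}
    {f : HardySpace n p} {F : ι → HardySpace n p} :
    Tendsto F l (@nhds _ (hardyWeakStarTopology n p) f) ↔
      ∀ g : UnitAddTorus (Fin n) → ℂ, Integrable g →
        Tendsto (fun k => boundaryPairing n g (F k)) l (𝓝 (boundaryPairing n g f)) := by
  rw [hardyWeakStarTopology, nhds_iInf]
  simp only [nhds_iInf, nhds_induced, tendsto_iInf, tendsto_comap_iff]
  rfl

theorem exists_polynomial_tendsto_hardyTopology {n : ℕ} {p : ℝ≥0∞} (hp : p ≠ 0)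
    (f : HardySpace n p) :
    ∃ P : ℕ → MvPolynomial (Fin n) ℂ,
      Tendsto (fun k => HardySpace.ofPolynomial p (P k)) atTop (@nhds _ (hardyTopology n p) f) ∧
      ∀ z ∈ polydisc n, Tendsto (fun k => MvPolynomial.eval z (P k)) atTop (𝓝 (f z)) := by
  obtain ⟨ρ, hρ, -, hρ1⟩ := exists_radii_tendsto_one
  choose P hP using fun k : ℕ => exists_polynomial_norm_dilate_sub_le f.analytic' (hρ k)
    (Nat.one_div_pos_of_nat (α := ℝ) (n := k))
  refine ⟨P, ?_, fun z hz => tendsto_eval_dilate_approx f.analytic' hρ1 hP hz⟩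
  rcases eq_or_ne p ∞ with rfl | hp'
  · rw [hardyTopology, if_pos rfl, tendsto_hardyWeakStarTopology_iff]
    exact fun g hg => tendsto_boundaryPairing_dilate_approx f hρ hρ1 hP hg
  · rw [hardyTopology, if_neg hp']
    exact tendsto_hardyNormTopology (tendsto_hardyNorm_dilate_approx hp hp' f hρ hρ1 hP)

end WeakStar

/-! ### Limits in the Hardy topologies agree with pointwise limits -/

section PointwiseLimits

theorem eLpNorm_torus_le_hardyNorm' {n : ℕ} (q : ℝ≥0∞) (f : (Fin n → ℂ) → ℂ) {r : ℝ}
    (hr : r ∈ Ico (0 : ℝ) 1) :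
    eLpNorm (fun θ => f (torusPoint n r θ)) q volume ≤ hardyNorm n q f := by
  rcases eq_or_ne q ∞ with rfl | hq
  · rw [eLpNorm_exponent_top, hardyNorm, if_pos rfl]
    exact eLpNormEssSup_le_of_ae_enorm_bound (Filter.Eventually.of_forall fun θ =>
      le_iSup₂ (f := fun z (_ : z ∈ polydisc n) => ‖f z‖ₑ) _ (torusPoint_mem n hr θ))
  · exact eLpNorm_torus_le_hardyNorm hq f hr

theorem lintegral_torus_sub_rpow_le_hardyNorm {n : ℕ} {q s : ℝ≥0∞} (hs0 : s ≠ 0) (hs : s ≠ ∞)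
    (hsq : s ≤ q) (F G : HardySpace n q) {r : ℝ} (hr : r ∈ Ico (0 : ℝ) 1) :
    ∫⁻ θ, ‖F (torusPoint n r θ) - G (torusPoint n r θ)‖ₑ ^ s.toReal ≤
      hardyNorm n q (fun z => F z - G z) ^ s.toReal := by
  have hm : Continuous fun θ => F (torusPoint n r θ) - G (torusPoint n r θ) :=
    (continuous_comp_torusPoint F.analytic'.continuousOn hr).sub
      (continuous_comp_torusPoint G.analytic'.continuousOn hr)
  have h := (eLpNorm_le_eLpNorm_of_exponent_le hsq hm.aestronglyMeasurable).trans
    (eLpNorm_torus_le_hardyNorm' q (fun z => F z - G z) hr)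
  rw [eLpNorm_eq_lintegral_rpow_enorm_toReal hs0 hs, one_div] at h
  exact (ENNReal.rpow_inv_le_iff (ENNReal.toReal_pos hs0 hs)).1 h

theorem isOpen_setOf_lintegral_torus_sub_lt {n : ℕ} {q s : ℝ≥0∞} (hs0 : s ≠ 0) (hs : s ≤ 1)
    (hsq : s ≤ q) (F : HardySpace n q) {r : ℝ} (hr : r ∈ Ico (0 : ℝ) 1) (η : ℝ≥0∞) :
    IsOpen[hardyNormTopology n q] {G : HardySpace n q |
      ∫⁻ θ, ‖G (torusPoint n r θ) - F (torusPoint n r θ)‖ₑ ^ s.toReal < η} := by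
  have hs' : s ≠ ∞ := ne_top_of_le_ne_top ENNReal.one_ne_top hs
  have hpos := ENNReal.toReal_pos hs0 hs'
  have hle : s.toReal ≤ 1 := by simpa using ENNReal.toReal_mono ENNReal.one_ne_top hs
  intro G (hG : _ < η)
  refine ⟨(η - ∫⁻ θ, ‖G (torusPoint n r θ) - F (torusPoint n r θ)‖ₑ ^ s.toReal) ^ s.toReal⁻¹,
    ?_, fun H hH => ?_⟩
  · rcases eq_or_ne η ∞ with rfl | hη
    · rw [ENNReal.top_sub hG.ne, ENNReal.top_rpow_of_pos (inv_pos.2 hpos)]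
      exact ENNReal.zero_lt_top
    · exact ENNReal.rpow_pos (tsub_pos_of_lt hG) (ENNReal.sub_ne_top hη)
  have h1 := (lintegral_torus_sub_rpow_le_hardyNorm hs0 hs' hsq H G hr).trans_lt
    ((ENNReal.lt_rpow_inv_iff hpos).1 hH)
  have hm : Measurable fun θ => ‖G (torusPoint n r θ) - F (torusPoint n r θ)‖ₑ ^ s.toReal :=
    ((continuous_comp_torusPoint G.analytic'.continuousOn hr).sub
      (continuous_comp_torusPoint F.analytic'.continuousOn hr)).measurable.enorm.pow_const _
  calc ∫⁻ θ, ‖H (torusPoint n r θ) - F (torusPoint n r θ)‖ₑ ^ s.toReal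
      ≤ ∫⁻ θ, (‖G (torusPoint n r θ) - F (torusPoint n r θ)‖ₑ ^ s.toReal +
          ‖H (torusPoint n r θ) - G (torusPoint n r θ)‖ₑ ^ s.toReal) := by
        refine lintegral_mono fun θ => ?_
        refine le_trans (ENNReal.rpow_le_rpow ?_ hpos.le)
          (ENNReal.rpow_add_le_add_rpow _ _ hpos.le hle)
        rw [← sub_add_sub_cancel' (G (torusPoint n r θ)) (F (torusPoint n r θ))
          (H (torusPoint n r θ))]
        exact enorm_add_le _ _
    _ = (∫⁻ θ, ‖G (torusPoint n r θ) - F (torusPoint n r θ)‖ₑ ^ s.toReal) +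
          ∫⁻ θ, ‖H (torusPoint n r θ) - G (torusPoint n r θ)‖ₑ ^ s.toReal :=
        lintegral_add_left hm _
    _ < (∫⁻ θ, ‖G (torusPoint n r θ) - F (torusPoint n r θ)‖ₑ ^ s.toReal) +
          (η - ∫⁻ θ, ‖G (torusPoint n r θ) - F (torusPoint n r θ)‖ₑ ^ s.toReal) :=
        ENNReal.add_lt_add_left hG.ne_top h1
    _ = η := add_tsub_cancel_of_le hG.le

theorem eqOn_of_tendsto_hardyNormTopology {n : ℕ} {q : ℝ≥0∞} (hq : q ≠ 0) {F : HardySpace n q}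
    {G : (Fin n → ℂ) → ℂ} (hG : AnalyticOnNhd ℂ G (polydisc n)) {u : ℕ → HardySpace n q}
    (hu : Tendsto u atTop (@nhds _ (hardyNormTopology n q) F))
    (huG : ∀ z ∈ polydisc n, Tendsto (fun k => u k z) atTop (𝓝 (G z))) :
    EqOn F G (polydisc n) := by
  set s : ℝ≥0∞ := min 1 q
  have hs0 : s ≠ 0 := by simp [s, hq, min_eq_iff]
  have hs1 : s ≤ 1 := min_le_left _ _
  have hpos := ENNReal.toReal_pos hs0 (ne_top_of_le_ne_top ENNReal.one_ne_top hs1)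
  have hae : ∀ r ∈ Ico (0 : ℝ) 1, ∀ᵐ θ, F (torusPoint n r θ) = G (torusPoint n r θ) := by
    intro r hr
    have hlim : Tendsto (fun k => ∫⁻ θ, ‖u k (torusPoint n r θ) - F (torusPoint n r θ)‖ₑ ^ s.toReal)
        atTop (𝓝 0) := by
      rw [ENNReal.tendsto_nhds_zero]
      intro η hη
      let _ := hardyNormTopology n q
      refine (hu.eventually ((isOpen_setOf_lintegral_torus_sub_lt hs0 hs1 (min_le_right _ _) F hr
        η).mem_nhds ?_)).mono fun k hk => le_of_lt hk
      simpa [hpos] using hη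
    have hmF := continuous_comp_torusPoint F.analytic'.continuousOn hr
    have hmG := continuous_comp_torusPoint hG.continuousOn hr
    have hzero : ∫⁻ θ, ‖G (torusPoint n r θ) - F (torusPoint n r θ)‖ₑ ^ s.toReal = 0 := by
      refine le_antisymm ?_ bot_le
      have hlimθ : ∀ θ, Tendsto
          (fun k => ‖u k (torusPoint n r θ) - F (torusPoint n r θ)‖ₑ ^ s.toReal) atTop
          (𝓝 (‖G (torusPoint n r θ) - F (torusPoint n r θ)‖ₑ ^ s.toReal)) := fun θ =>
        ((ENNReal.continuous_rpow_const.comp continuous_enorm).tendsto _).comp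
          ((huG _ (torusPoint_mem n hr θ)).sub_const _)
      calc ∫⁻ θ, ‖G (torusPoint n r θ) - F (torusPoint n r θ)‖ₑ ^ s.toReal
          = ∫⁻ θ, liminf (fun k => ‖u k (torusPoint n r θ) - F (torusPoint n r θ)‖ₑ ^ s.toReal)
              atTop := lintegral_congr fun θ => (hlimθ θ).liminf_eq.symm
        _ ≤ liminf (fun k => ∫⁻ θ, ‖u k (torusPoint n r θ) - F (torusPoint n r θ)‖ₑ ^ s.toReal)
              atTop := lintegral_liminf_le fun k =>
            ((continuous_comp_torusPoint (u k).analytic'.continuousOn hr).sub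
              hmF).measurable.enorm.pow_const _
        _ = 0 := hlim.liminf_eq
    have hm : Measurable fun θ => ‖G (torusPoint n r θ) - F (torusPoint n r θ)‖ₑ ^ s.toReal :=
      (hmG.sub hmF).measurable.enorm.pow_const _
    filter_upwards [(lintegral_eq_zero_iff hm).1 hzero] with θ hθ
    have h0 : ‖G (torusPoint n r θ) - F (torusPoint n r θ)‖ₑ ^ s.toReal = 0 := hθ
    rw [ENNReal.rpow_eq_zero_iff_of_pos hpos, enorm_eq_zero, sub_eq_zero] at h0
    exact h0.symm
  intro z hz
  obtain ⟨r, hzr, hr1⟩ := exists_between (mem_polydisc_iff_norm_lt.1 hz)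
  have hr0 : 0 < r := (norm_nonneg z).trans_lt hzr
  have hr : r ∈ Ico (0 : ℝ) 1 := ⟨hr0.le, hr1⟩
  have hrc : (r : ℂ) ≠ 0 := Complex.ofReal_ne_zero.2 hr0.ne'
  have hw : (r : ℂ)⁻¹ • z ∈ polydisc n := by
    rw [mem_polydisc_iff_norm_lt, norm_smul, norm_inv, Complex.norm_real,
      Real.norm_of_nonneg hr0.le, inv_mul_lt_iff₀ hr0, mul_one]
    exact hzr
  have h1 := integral_mul_polydiscKernel F.analytic' hr hw
  have h2 := integral_mul_polydiscKernel hG hr hw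
  rw [smul_inv_smul₀ hrc] at h1 h2
  rw [← h1, ← h2]
  refine integral_congr_ae ?_
  filter_upwards [hae r hr] with θ hθ
  rw [hθ]

theorem boundaryPairing_polydiscKernel {n : ℕ} {f : (Fin n → ℂ) → ℂ}
    (hf : AnalyticOnNhd ℂ f (polydisc n)) {w : Fin n → ℂ} (hw : w ∈ polydisc n) :
    boundaryPairing n (polydiscKernel w) f = f w := by
  refine Tendsto.limUnder_eq ?_
  have h1 : Tendsto (fun r : ℝ => (r : ℂ) • w) (𝓝[<] 1) (𝓝 w) := by
    have h : Continuous fun r : ℝ => (r : ℂ) • w := Complex.continuous_ofReal.smul continuous_const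
    simpa using (h.tendsto 1).mono_left nhdsWithin_le_nhds
  refine ((hf w hw).continuousAt.tendsto.comp h1).congr' ?_
  filter_upwards [Ico_mem_nhdsLT (zero_lt_one' ℝ)] with r hr
  exact (integral_mul_polydiscKernel hf hr hw).symm

theorem eqOn_of_tendsto_hardyTopology {n : ℕ} {q : ℝ≥0∞} (hq : q ≠ 0) {F : HardySpace n q}
    {G : (Fin n → ℂ) → ℂ} (hG : AnalyticOnNhd ℂ G (polydisc n)) {u : ℕ → HardySpace n q}
    (hu : Tendsto u atTop (@nhds _ (hardyTopology n q) F))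
    (huG : ∀ z ∈ polydisc n, Tendsto (fun k => u k z) atTop (𝓝 (G z))) :
    EqOn F G (polydisc n) := by
  rcases eq_or_ne q ∞ with hq' | hq'
  · rw [hardyTopology, if_pos hq', tendsto_hardyWeakStarTopology_iff] at hu
    intro z hz
    have h := hu _ (integrable_of_continuous_unitAddTorus (continuous_polydiscKernel hz))
    simp only [fun k => boundaryPairing_polydiscKernel (u k).analytic' hz,
      boundaryPairing_polydiscKernel F.analytic' hz] at h
    exact tendsto_nhds_unique h (huG z hz)
  · rw [hardyTopology, if_neg hq'] at hu
    exact eqOn_of_tendsto_hardyNormTopology hq hG hu huG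

end PointwiseLimits

theorem mainTheorem5 (n m : ℕ) (p q : ℝ≥0∞) (hp : 0 < p) (hq : 0 < q)
    (T : HardySpace n p → HardySpace m q)
    (hT : Continuous[hardyTopology n p, hardyNormTopology m q] T ∨
      Continuous[hardyTopology n p, hardyTopology m q] T)
    (hT0 : T 0 = 0)
    (hT1 : ∀ w ∈ polydisc m, T 1 w ≠ 0)
    (hzero : ∀ (P Q : MvPolynomial (Fin n) ℂ), ∀ w ∈ polydisc m, ∃ z ∈ polydisc n,
      MvPolynomial.eval z
        (MvPolynomial.C (T (HardySpace.ofPolynomial p P) w - T (HardySpace.ofPolynomial p Q) w)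
          - MvPolynomial.C (T 1 w) * (P - Q)) = 0) :
    ∃ (ψ : HardySpace m q) (φ : (Fin m → ℂ) → (Fin n → ℂ)),
      AnalyticOnNhd ℂ φ (polydisc m) ∧ MapsTo φ (polydisc m) (polydisc n) ∧
      ∀ (f : HardySpace n p), ∀ w ∈ polydisc m, T f w = ψ w * f (φ w) := by
  let φ : (Fin m → ℂ) → (Fin n → ℂ) := fun w i =>
    T (HardySpace.ofPolynomial p (MvPolynomial.X i)) w / T 1 w
  have hφa : AnalyticOnNhd ℂ φ (polydisc m) := fun w hw =>
    AnalyticAt.pi fun i => ((T _).analytic' w hw).div ((T 1).analytic' w hw) (hT1 w hw)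
  have heval : ∀ w ∈ polydisc m, φ w ∈ polydisc n ∧ ∀ P : MvPolynomial (Fin n) ℂ,
      T (HardySpace.ofPolynomial p P) w = T 1 w * MvPolynomial.eval (φ w) P := fun w hw => by
    obtain ⟨a, ha, haP⟩ := exists_eq_eval_of_sub_eq_eval_sub
      (lam := fun P => T (HardySpace.ofPolynomial p P) w / T 1 w) (by
        change T 0 w / T 1 w = 0
        rw [hT0, show (0 : HardySpace m q) w = MvPolynomial.eval w 0 from
          HardySpace.ofPolynomial_apply q 0 hw, map_zero, zero_div])
      (fun P Q => by
        obtain ⟨z, hz, h⟩ := hzero P Q w hw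
        refine ⟨z, hz, ?_⟩
        rw [map_sub, map_mul, MvPolynomial.eval_C, MvPolynomial.eval_C, sub_eq_zero] at h
        rw [← sub_div, h, mul_div_cancel_left₀ _ (hT1 w hw)])
    have hφ : φ w = a := funext fun i => by
      simpa using haP (MvPolynomial.X i)
    refine hφ ▸ ⟨ha, fun P => ?_⟩
    rw [← haP P, mul_div_cancel₀ _ (hT1 w hw)]
  refine ⟨T 1, φ, hφa, fun w hw => (heval w hw).1, fun f => ?_⟩
  obtain ⟨P, hP, hPz⟩ := exists_polynomial_tendsto_hardyTopology hp.ne' f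
  have hGa : AnalyticOnNhd ℂ (fun w => T 1 w * f (φ w)) (polydisc m) := fun w hw =>
    ((T 1).analytic' w hw).mul ((f.analytic' _ (heval w hw).1).comp (hφa w hw))
  have hlim : ∀ w ∈ polydisc m, Tendsto (fun k => T (HardySpace.ofPolynomial p (P k)) w) atTop
      (𝓝 (T 1 w * f (φ w))) := fun w hw => by
    simp only [(heval w hw).2]
    exact (hPz _ (heval w hw).1).const_mul _
  rcases hT with hT | hT
  · exact eqOn_of_tendsto_hardyNormTopology hq.ne' hGa
      ((@Continuous.tendsto _ _ (_) (_) _ hT f).comp hP) hlim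
  · exact eqOn_of_tendsto_hardyTopology hq.ne' hGa
      ((@Continuous.tendsto _ _ (_) (_) _ hT f).comp hP) hlim
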